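/- Let $\mathcal D$ be a choice of dyadic intervals of $\mathbb R$: for real numbers $(a_j)_{j\in\mathbb Z}$ with $a_{j+1}-a_j\in 2^j\mathbb Z$ for all $j$, it consists of all the intervals $[a_j+k2^j,\,a_j+(k+1)2^j)$, $j,k\in\mathbb Z$ (the standard dyadic intervals are the case $a_j=0$). Let $w:\mathbb R\to\mathbb R$ be a $C^2$ function such that, for some $r>1$ and some constant $C$, $$|w(x)|\le C(1+|x|)^{-r}\qquad (x\in\mathbb R).$$ For $I\in\mathcal D$ with center $c_I$ and length $|I|$ put $w_I(x)=|I|^{-1/2}\,w\big((x-c_I)/|I|\big)$, and assume that $\{w_I : I\in\mathcal D\}$ is an orthonormal basis of the real Hilbert space $L^2(\mathbb R)$. Let $S$ be the wavelet square function, $S f\ge 0$ with $$(Sf)^2=\sum_{I\in\mathcal D}\langle f,w_I\rangle^2\,w_I^2 .$$ Then there is a constant $\eta>0$ such that for every measurable set $V\subset\mathbb R$ of finite Lebesgue measure $$\int_V (S\mathbf 1_V)^2\,dx\ \ge\ \eta\,|V| .$$ -/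

import Mathlib

open MeasureTheory
open scoped ENNReal

noncomputable section

/-- A choice of dyadic intervals on the line: for each scale `j : ℤ` the intervals
`[offset j + k * 2 ^ j, offset j + (k + 1) * 2 ^ j)`, `k : ℤ`, with offsets such that every interval
of length `2 ^ (j + 1)` is the union of two intervals of length `2 ^ j`.
The standard dyadic intervals are those with `offset = 0`. -/
structure DyadicGrid where
  /-- an endpoint of an interval of length `2 ^ j` -/
  offset : ℤ → ℝ
  nested : ∀ j : ℤ, ∃ m : ℤ, offset (j + 1) = offset j + (m : ℝ) * (2 : ℝ) ^ j

namespace DyadicGrid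

/-- The length of the interval with index `I = (j, k)`. -/
def length (_D : DyadicGrid) (I : ℤ × ℤ) : ℝ := (2 : ℝ) ^ I.1

/-- The left endpoint of the interval with index `I = (j, k)`. -/
def left (D : DyadicGrid) (I : ℤ × ℤ) : ℝ := D.offset I.1 + (I.2 : ℝ) * D.length I

/-- The dyadic interval with index `I = (j, k)`; distinct indices give distinct intervals. -/
def interval (D : DyadicGrid) (I : ℤ × ℤ) : Set ℝ := Set.Ico (D.left I) (D.left I + D.length I)

/-- The center of the interval with index `I`. -/
def center (D : DyadicGrid) (I : ℤ × ℤ) : ℝ := D.left I + D.length I / 2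

end DyadicGrid

/-- The function `w_I (x) = |I| ^ (-1/2) * w ((x - c_I) / |I|)`. -/
def wavelet (w : ℝ → ℝ) (D : DyadicGrid) (I : ℤ × ℤ) (x : ℝ) : ℝ :=
  D.length I ^ (-(1 / 2) : ℝ) * w ((x - D.center I) / D.length I)

/-- The functions `e i` are (representatives of) an orthonormal basis of the real Hilbert space
`L²(ℝ)`. -/
def IsL2OrthonormalBasis {ι : Type*} (e : ι → ℝ → ℝ) : Prop :=
  ∃ b : HilbertBasis ι ℝ (Lp ℝ 2 (volume : Measure ℝ)),
    ∀ i, (b i : ℝ → ℝ) =ᵐ[volume] e i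

/-- The wavelet square function `S f = (∑_I ⟨f, w_I⟩² w_I²) ^ (1/2)`, with values in `[0, ∞]`. -/
def waveletSquareFunction (w : ℝ → ℝ) (D : DyadicGrid) (f : ℝ → ℝ) (x : ℝ) : ℝ≥0∞ :=
  (∑' I : ℤ × ℤ,
    ENNReal.ofReal ((∫ y, f y * wavelet w D I y) ^ 2 * wavelet w D I x ^ 2)) ^ (1 / 2 : ℝ)

end

/-! Write `a_I = ⟨1_V, w_I⟩` and `p_I = ∫_V w_I²`. Parseval gives `∑ a_I² = |V|`, while the integral
to be bounded below is `∑ a_I² p_I`. So it is enough to find `δ > 0`, independent of `V`, such that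
the intervals with `p_I ≤ δ` carry at most half of `|V|` (`exists_sum_sq_le_half`); the other
intervals then contribute at least `δ` times a fixed fraction of `|V|`.

To bound the low-mass coefficients, split `w = u + v` (`exists_split`): `v` is uniformly small, and
`u` lives on a bounded set where `|w| ≥ κ`. Both have mean zero, and their decay and Hölder bounds
do not deteriorate as `v` gets smaller. A Bessel inequality for such functions, proved by a weighted
Schur test on the Gram matrix (`IsMolecule.exists_bessel`), makes the coefficients against `v`
negligible.

For `u`, take the maximal dyadic intervals `Q` in which `V` has density above a small `l`. They
cover almost all of `V`, have density at most `2l`, and have total length at most `|V| / l`. There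
are two cases. If some `Q` near `I` is at least as long as `I`, then `p_I ≤ δ` forces `V` to be
sparse wherever `u_I` does not vanish. All these sparse places lie in fixed dilates of the `Q`, so
together they contain little of `V`, and Bessel is applied to the indicator of that little piece
(`sum_sq_fine_le`). If every `Q` near `I` is shorter than `I`, replace `1_V` by its averages over
the `Q`, whose squared norm is at most `2l|V|`. The remainder has mean zero on each `Q`, so Hölder
continuity of `u` gains `(|Q| / |I|) ^ s`, which is summable over `I` (`sum_sq_coarse_le`).

All this needs global Hölder continuity of `w`, whereas smoothness of `w` gives no bound that is
uniform near infinity. It is extracted from the basis property (`exists_holder`): a mean-zero bump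
at unit scale is paired with a very long wavelet through Parseval, which shows that the oscillation
of `w` halves whenever the scale is refined by a fixed factor. That `w` has mean zero also follows
from orthogonality. -/

/-! ### The polynomial weight and its lattice sums -/

/-- The polynomially decaying weight `(1 + |x|) ^ (-q)`. -/
noncomputable def bump (q x : ℝ) : ℝ := (1 + |x|) ^ (-q)

lemma bump_pos (q x : ℝ) : 0 < bump q x := Real.rpow_pos_of_pos (by positivity) _

lemma bump_nonneg (q x : ℝ) : 0 ≤ bump q x := (bump_pos q x).le

lemma bump_le_one {q : ℝ} (hq : 0 ≤ q) (x : ℝ) : bump q x ≤ 1 :=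
  Real.rpow_le_one_of_one_le_of_nonpos (by linarith [abs_nonneg x]) (by linarith)

lemma bump_neg (q x : ℝ) : bump q (-x) = bump q x := by simp [bump]

lemma bump_le_bump {q x y : ℝ} (hq : 0 ≤ q) (h : |x| ≤ |y|) : bump q y ≤ bump q x :=
  Real.rpow_le_rpow_of_nonpos (by positivity) (by linarith) (by linarith)

lemma bump_le_two_mul {q x y : ℝ} (hq : 0 ≤ q) (h : |x| ≤ 1 + 2 * |y|) :
    bump q y ≤ 2 ^ q * bump q x := by
  unfold bump
  have h1 : (2 * (1 + |y|)) ^ (-q) ≤ (1 + |x|) ^ (-q) :=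
    Real.rpow_le_rpow_of_nonpos (by positivity) (by linarith) (by linarith)
  rw [Real.mul_rpow (by norm_num) (by positivity)] at h1
  calc (1 + |y|) ^ (-q) = 2 ^ q * (2 ^ (-q) * (1 + |y|) ^ (-q)) := by
        rw [← mul_assoc, ← Real.rpow_add (by norm_num)]; simp
    _ ≤ _ := by gcongr

lemma bump_rpow (q p x : ℝ) : bump q x ^ p = bump (q * p) x := by
  unfold bump
  rw [← Real.rpow_mul (by positivity)]
  ring_nf

lemma rpow_mul_bump_le {s : ℝ} (hs : 0 ≤ s) (q x : ℝ) : |x| ^ s * bump q x ≤ bump (q - s) x := by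
  unfold bump
  calc |x| ^ s * (1 + |x|) ^ (-q) ≤ (1 + |x|) ^ s * (1 + |x|) ^ (-q) := by
        gcongr; linarith
    _ = _ := by rw [← Real.rpow_add (by positivity)]; ring_nf

lemma continuous_bump (q : ℝ) : Continuous (bump q) := by
  unfold bump
  exact (by fun_prop : Continuous fun x : ℝ => 1 + |x|).rpow_const
    (fun x => Or.inl (by positivity))

lemma integrable_bump {q : ℝ} (hq : 1 < q) : Integrable (bump q) := by
  have := integrable_one_add_norm (E := ℝ) (μ := volume) (r := q) (by simpa using hq)
  exact this

lemma integral_bump_pos {q : ℝ} (hq : 1 < q) : 0 < ∫ x, bump q x := by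
  rw [integral_pos_iff_support_of_nonneg (bump_nonneg q) (integrable_bump hq)]
  have : Function.support (bump q) = Set.univ := by
    ext x; simp [(bump_pos q x).ne']
  simp [this]

/-- Integral of a function of the rescaled variable `(x - c) / L`. -/
lemma integral_comp_sub_div (g : ℝ → ℝ) (c : ℝ) {L : ℝ} (hL : 0 < L) :
    ∫ x, g ((x - c) / L) = L * ∫ x, g x := by
  rw [integral_sub_right_eq_self (fun x => g (x / L)) c, Measure.integral_comp_div]
  simp [abs_of_pos hL]

lemma integrable_comp_sub_div {g : ℝ → ℝ} (hg : Integrable g) (c : ℝ) {L : ℝ} (hL : 0 < L) :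
    Integrable fun x => g ((x - c) / L) :=
  (hg.comp_div hL.ne').comp_sub_right c

/-- Riemann sums of the weight along a lattice of mesh `ρ ≤ 1`. -/
lemma sum_bump_le {q ρ : ℝ} (hq : 1 < q) (hρ : 0 < ρ) (hρ1 : ρ ≤ 1) (t : ℝ) (K : Finset ℤ) :
    ∑ k ∈ K, bump q (ρ * (t - k)) ≤ 2 ^ q * ρ⁻¹ * ∫ x, bump q x := by
  have hint : Integrable fun x => bump q ((x - t) / ρ⁻¹) :=
    integrable_comp_sub_div (integrable_bump hq) t (inv_pos.2 hρ)
  have hdisj : (K : Set ℤ).Pairwise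
      (Function.onFun Disjoint fun k : ℤ => Set.Ioc (k : ℝ) (k + 1)) :=
    fun a _ b _ hab => Set.pairwise_disjoint_Ioc_intCast ℝ hab
  -- Since `ρ ≤ 1`, moving `k` to any point of `(k, k + 1]` changes the argument by at most `1`,
  -- which costs the factor `2 ^ q`.
  calc ∑ k ∈ K, bump q (ρ * (t - k))
      ≤ ∑ k ∈ K, ∫ x in Set.Ioc (k : ℝ) (k + 1), 2 ^ q * bump q ((x - t) / ρ⁻¹) := by
        refine Finset.sum_le_sum fun k _ => ?_
        have : bump q (ρ * (t - k)) = ∫ _ in Set.Ioc (k : ℝ) (k + 1), bump q (ρ * (t - k)) := by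
          simp
        rw [this]
        refine setIntegral_mono_on (by simp) (hint.const_mul _).integrableOn measurableSet_Ioc
          fun x hx => bump_le_two_mul (by linarith) ?_
        have h1 : (x - t) / ρ⁻¹ = ρ * (x - k) - ρ * (t - k) := by
          rw [div_inv_eq_mul]; ring
        have h2 : |ρ * (x - k)| ≤ 1 := by
          rw [abs_of_nonneg (by nlinarith [hx.1])]
          nlinarith [hx.1, hx.2]
        rw [h1]
        calc _ ≤ |ρ * (x - k)| + |ρ * (t - k)| := abs_sub _ _
          _ ≤ _ := by linarith [abs_nonneg (ρ * (t - k))]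
    _ = ∫ x in ⋃ k ∈ K, Set.Ioc (k : ℝ) (k + 1), 2 ^ q * bump q ((x - t) / ρ⁻¹) :=
        (integral_biUnion_finset K (fun _ _ => measurableSet_Ioc) hdisj
          fun _ _ => (hint.const_mul _).integrableOn).symm
    _ ≤ ∫ x, 2 ^ q * bump q ((x - t) / ρ⁻¹) :=
        setIntegral_le_integral (hint.const_mul _)
          (Filter.Eventually.of_forall fun x => mul_nonneg (by positivity) (bump_nonneg _ _))
    _ = _ := by
        rw [integral_const_mul, integral_comp_sub_div _ _ (inv_pos.2 hρ)]; ring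

/-- A bound on the sums of the weight over translates by integers. -/
noncomputable def latticeConst (q : ℝ) : ℝ := 2 ^ q * ∫ x, bump q x

lemma latticeConst_pos {q : ℝ} (hq : 1 < q) : 0 < latticeConst q :=
  mul_pos (by positivity) (integral_bump_pos hq)

lemma sum_bump_sub_le {q : ℝ} (hq : 1 < q) (t : ℝ) (K : Finset ℤ) :
    ∑ k ∈ K, bump q (t - k) ≤ latticeConst q := by
  simpa [latticeConst] using sum_bump_le hq one_pos le_rfl t K

/-- A sum over a finite set of pairs is bounded by bounding the rows. -/
lemma sum_le_of_rows {g : ℤ × ℤ → ℝ} {B : ℤ → ℝ} {b : ℝ} (hg : ∀ I, 0 ≤ g I)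
    (hrow : ∀ j, ∀ K : Finset ℤ, ∑ k ∈ K, g (j, k) ≤ B j)
    (hB : ∀ K : Finset ℤ, ∑ j ∈ K, B j ≤ b) (F : Finset (ℤ × ℤ)) : ∑ I ∈ F, g I ≤ b := by
  calc ∑ I ∈ F, g I ≤ ∑ I ∈ F.image Prod.fst ×ˢ F.image Prod.snd, g I :=
        Finset.sum_le_sum_of_subset_of_nonneg Finset.subset_product fun I _ _ => hg I
    _ = ∑ j ∈ F.image Prod.fst, ∑ k ∈ F.image Prod.snd, g (j, k) := Finset.sum_product _ _ _
    _ ≤ ∑ j ∈ F.image Prod.fst, B j := Finset.sum_le_sum fun j _ => hrow j _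
    _ ≤ b := hB _

/-- Two-sided geometric sums are bounded. -/
lemma exists_sum_geometric_le {θ : ℝ} (h0 : 0 < θ) (h1 : θ < 1) :
    ∃ T : ℝ, 0 < T ∧ ∀ (i : ℤ) (K : Finset ℤ), ∑ j ∈ K, θ ^ (i - j).natAbs ≤ T := by
  have hsum : Summable fun n : ℤ => θ ^ n.natAbs := by
    refine Summable.of_nat_of_neg ?_ ?_ <;>
      simpa using summable_geometric_of_lt_one h0.le h1
  refine ⟨∑' n : ℤ, θ ^ n.natAbs,
    hsum.tsum_pos (fun n => by positivity) 0 (by positivity), fun i K => ?_⟩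
  rw [← Finset.sum_image (s := K) (g := fun j => i - j) (f := fun n : ℤ => θ ^ n.natAbs)
    (fun a _ b _ h => by simpa using h)]
  exact hsum.sum_le_tsum _ fun _ _ => by positivity

/-! ### Geometry of dyadic intervals -/

namespace DyadicGrid

variable (D : DyadicGrid)

lemma length_pos (I : ℤ × ℤ) : 0 < D.length I := by unfold length; positivity

lemma length_mk (j k : ℤ) : D.length (j, k) = (2 : ℝ) ^ j := rfl

lemma length_le_length {I J : ℤ × ℤ} (h : I.1 ≤ J.1) : D.length I ≤ D.length J :=
  zpow_le_zpow_right₀ (by norm_num) h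

lemma length_le_length_iff {I J : ℤ × ℤ} : D.length I ≤ D.length J ↔ I.1 ≤ J.1 :=
  zpow_le_zpow_iff_right₀ (by norm_num)

lemma length_lt_length_iff {I J : ℤ × ℤ} : D.length I < D.length J ↔ I.1 < J.1 :=
  zpow_lt_zpow_iff_right₀ (by norm_num)

lemma length_div_rpow {I J : ℤ × ℤ} (h : J.1 ≤ I.1) (s : ℝ) :
    (D.length J / D.length I) ^ s = ((2 : ℝ) ^ (-s)) ^ (I.1 - J.1).natAbs := by
  unfold length
  rw [← zpow_sub₀ (by norm_num), ← Real.rpow_intCast, ← Real.rpow_natCast, ← Real.rpow_mul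
    (by norm_num), ← Real.rpow_mul (by norm_num)]
  congr 1
  have : (((I.1 - J.1).natAbs : ℤ) : ℝ) = ((I.1 - J.1 : ℤ) : ℝ) := by
    rw [Int.natAbs_of_nonneg (by omega)]
  rw [Int.cast_natCast] at this
  rw [this]
  push_cast
  ring

lemma sub_center_div (x : ℝ) (j k : ℤ) :
    (x - D.center (j, k)) / D.length (j, k) = ((x - D.offset j) / (2 : ℝ) ^ j - 1 / 2) - k := by
  unfold center left length
  field_simp
  ring

lemma sum_bump_center_le {q : ℝ} (hq : 1 < q) (x : ℝ) (j : ℤ) (K : Finset ℤ) :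
    ∑ k ∈ K, bump q ((x - D.center (j, k)) / D.length (j, k)) ≤ latticeConst q := by
  simp_rw [sub_center_div]
  exact sum_bump_sub_le hq _ K

/-- Seen at scale `L`, the centers form a lattice of mesh `2 ^ j / L ≤ 1`; the factor `L / 2 ^ j`
counts the centers per unit of rescaled length. -/
lemma sum_bump_center_div_le {q : ℝ} (hq : 1 < q) (c : ℝ) {L : ℝ} {j : ℤ} (hL : (2 : ℝ) ^ j ≤ L)
    (K : Finset ℤ) :
    ∑ k ∈ K, bump q ((D.center (j, k) - c) / L) ≤ latticeConst q * (L / 2 ^ j) := by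
  have hj : (0 : ℝ) < 2 ^ j := by positivity
  have hL0 : 0 < L := hj.trans_le hL
  have h := sum_bump_le hq (div_pos hj hL0) ((div_le_one hL0).2 hL)
    ((c - D.offset j) / (2 : ℝ) ^ j - 1 / 2) K
  have e : ∀ k : ℤ, bump q ((D.center (j, k) - c) / L) =
      bump q ((2 : ℝ) ^ j / L * ((c - D.offset j) / (2 : ℝ) ^ j - 1 / 2 - k)) := fun k => by
    rw [← bump_neg]
    congr 1
    unfold center left length
    field_simp
    ring
  simp_rw [e]
  refine h.trans (le_of_eq ?_)
  unfold latticeConst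
  rw [inv_div]
  ring

lemma mem_interval {I : ℤ × ℤ} {x : ℝ} :
    x ∈ D.interval I ↔ D.left I ≤ x ∧ x < D.left I + D.length I := Iff.rfl

lemma center_mem (I : ℤ × ℤ) : D.center I ∈ D.interval I := by
  have := D.length_pos I
  constructor <;> unfold center <;> linarith

lemma measurableSet_interval (I : ℤ × ℤ) : MeasurableSet (D.interval I) := measurableSet_Ico

lemma volume_interval (I : ℤ × ℤ) : volume (D.interval I) = ENNReal.ofReal (D.length I) := by
  unfold interval; simp

lemma abs_sub_le_of_mem {I : ℤ × ℤ} {x y : ℝ} (hx : x ∈ D.interval I) (hy : y ∈ D.interval I) :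
    |x - y| ≤ D.length I := by
  rw [abs_le]
  rw [mem_interval] at hx hy
  constructor <;> linarith [hx.1, hx.2, hy.1, hy.2]

lemma exists_mem_interval (j : ℤ) (x : ℝ) : ∃ k : ℤ, x ∈ D.interval (j, k) := by
  have hj : (0 : ℝ) < 2 ^ j := by positivity
  refine ⟨⌊(x - D.offset j) / 2 ^ j⌋, ?_⟩
  have h1 := Int.floor_le ((x - D.offset j) / 2 ^ j)
  have h2 := Int.lt_floor_add_one ((x - D.offset j) / 2 ^ j)
  rw [le_div_iff₀ hj] at h1
  rw [div_lt_iff₀ hj] at h2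
  constructor <;> simp only [left, length] <;> linarith

lemma eq_of_mem_of_mem {I J : ℤ × ℤ} {x : ℝ} (hI : x ∈ D.interval I) (hJ : x ∈ D.interval J)
    (h : I.1 = J.1) : I = J := by
  obtain ⟨j, k⟩ := I
  obtain ⟨j', k'⟩ := J
  obtain rfl : j = j' := h
  have hj : (0 : ℝ) < 2 ^ j := by positivity
  simp only [mem_interval, left, length] at hI hJ
  have h1 : (k : ℝ) < k' + 1 := by
    by_contra hc; push Not at hc; nlinarith [hI.1, hJ.2, mul_le_mul_of_nonneg_right hc hj.le]
  have h2 : (k' : ℝ) < k + 1 := by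
    by_contra hc; push Not at hc; nlinarith [hI.1, hJ.2, mul_le_mul_of_nonneg_right hc hj.le]
  have h1' : k < k' + 1 := by exact_mod_cast h1
  have h2' : k' < k + 1 := by exact_mod_cast h2
  simp only [Prod.mk.injEq, true_and]
  omega

lemma exists_parent (I : ℤ × ℤ) : ∃ k : ℤ, D.interval I ⊆ D.interval (I.1 + 1, k) := by
  obtain ⟨j, k⟩ := I
  obtain ⟨m, hm⟩ := D.nested j
  -- Relative to the coarser offset the interval has index `k - m`; the division rounds down, which
  -- is what negative indices need.
  refine ⟨(k - m) / 2, ?_⟩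
  have hj : (0 : ℝ) < 2 ^ j := by positivity
  have e : (2 : ℝ) ^ (j + 1) = 2 * 2 ^ j := by rw [zpow_add₀ (by norm_num)]; simp [mul_comm]
  have h1 : (k - m) / 2 * 2 ≤ k - m := by omega
  have h2 : k - m ≤ (k - m) / 2 * 2 + 1 := by omega
  have h1' : (((k - m) / 2 : ℤ) : ℝ) * 2 ≤ k - m := by exact_mod_cast h1
  have h2' : (k : ℝ) - m ≤ (((k - m) / 2 : ℤ) : ℝ) * 2 + 1 := by exact_mod_cast h2
  intro x hx
  simp only [mem_interval, left, length, hm, e] at hx ⊢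
  constructor
  · nlinarith [hx.1]
  · nlinarith [hx.2]

lemma exists_ancestor (I : ℤ × ℤ) (n : ℕ) : ∃ k : ℤ, D.interval I ⊆ D.interval (I.1 + n, k) := by
  induction n with
  | zero => exact ⟨I.2, by simp⟩
  | succ n ih =>
    obtain ⟨k, hk⟩ := ih
    obtain ⟨k', hk'⟩ := D.exists_parent (I.1 + n, k)
    refine ⟨k', hk.trans ?_⟩
    simpa [add_assoc] using hk'

lemma subset_of_mem_of_mem {I J : ℤ × ℤ} {x : ℝ} (hI : x ∈ D.interval I) (hJ : x ∈ D.interval J)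
    (h : I.1 ≤ J.1) : D.interval I ⊆ D.interval J := by
  obtain ⟨k, hk⟩ := D.exists_ancestor I (J.1 - I.1).toNat
  have : ((J.1 - I.1).toNat : ℤ) = J.1 - I.1 := Int.toNat_of_nonneg (by omega)
  rw [this, add_sub_cancel] at hk
  rwa [D.eq_of_mem_of_mem hJ (hk hI) rfl]

lemma fst_le_of_subset {I J : ℤ × ℤ} (h : D.interval I ⊆ D.interval J) : I.1 ≤ J.1 := by
  rw [← D.length_le_length_iff]
  have := measure_mono (μ := volume) h
  rwa [volume_interval, volume_interval, ENNReal.ofReal_le_ofReal_iff (D.length_pos J).le] at this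

/-- The members of a family of dyadic intervals that are maximal under inclusion. -/
def maximals (F : Set (ℤ × ℤ)) : Set (ℤ × ℤ) :=
  {I | I ∈ F ∧ ∀ J ∈ F, D.interval I ⊆ D.interval J → J = I}

lemma disjoint_of_mem_maximals {F : Set (ℤ × ℤ)} {I J : ℤ × ℤ} (hI : I ∈ D.maximals F)
    (hJ : J ∈ D.maximals F) (h : I ≠ J) : Disjoint (D.interval I) (D.interval J) := by
  rw [Set.disjoint_left]
  intro x hx hx'
  rcases le_total I.1 J.1 with h1 | h1
  · exact h (hI.2 J hJ.1 (D.subset_of_mem_of_mem hx hx' h1)).symm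
  · exact h (hJ.2 I hI.1 (D.subset_of_mem_of_mem hx' hx h1))

/-- The bound on the scales leaves a largest scale among the members of `F` containing `I`, and
nestedness makes that member maximal. -/
lemma exists_mem_maximals {F : Set (ℤ × ℤ)} {j₀ : ℤ} (hF : ∀ I ∈ F, I.1 ≤ j₀) {I : ℤ × ℤ}
    (hI : I ∈ F) : ∃ J ∈ D.maximals F, D.interval I ⊆ D.interval J := by
  obtain ⟨j, ⟨J, hJF, hIJ, rfl⟩, hmax⟩ := Int.exists_greatest_of_bdd
    (P := fun j => ∃ J ∈ F, D.interval I ⊆ D.interval J ∧ J.1 = j)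
    ⟨j₀, fun z ⟨J, hJ, _, h⟩ => h ▸ hF J hJ⟩ ⟨I.1, I, hI, subset_rfl, rfl⟩
  refine ⟨J, ⟨hJF, fun J' hJ' hsub => ?_⟩, hIJ⟩
  have h1 := hmax J'.1 ⟨J', hJ', hIJ.trans hsub, rfl⟩
  have h2 := D.fst_le_of_subset hsub
  exact D.eq_of_mem_of_mem (hsub (D.center_mem J)) (D.center_mem J) (le_antisymm h1 h2)

/-- Almost every point of a measurable set lies in dyadic intervals that the set nearly fills. -/
lemma ae_exists_dense_interval (V : Set ℝ) {l : ℝ} (hl : l < 1) :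
    ∀ᵐ x ∂volume.restrict V, ∃ I, x ∈ D.interval I ∧
      ENNReal.ofReal (l * D.length I) < volume (V ∩ D.interval I) := by
  filter_upwards [IsUnifLocDoublingMeasure.ae_tendsto_measure_inter_div.{0, 0} volume V 1] with x hx
  choose k hk using fun n : ℕ => D.exists_mem_interval (-(n : ℤ)) x
  have hlen : ∀ n : ℕ, D.length (-(n : ℤ), k n) = (1 / 2 : ℝ) ^ n := fun n => by
    rw [length_mk, zpow_neg, zpow_natCast, one_div, inv_pow]
  have hball : ∀ n : ℕ, Metric.closedBall (D.center (-(n : ℤ), k n)) ((1 / 2) ^ n / 2) =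
      Set.Icc (D.left (-(n : ℤ), k n)) (D.left (-(n : ℤ), k n) + D.length (-(n : ℤ), k n)) :=
    fun n => by
      rw [Real.closedBall_eq_Icc, center, hlen]
      congr 1 <;> ring
  -- The density theorem concerns closed balls; a half-open interval differs from the ball about its
  -- center by an endpoint. The points are not centers, but they stay in the balls, which suffices.
  have hae : ∀ n : ℕ, (Metric.closedBall (D.center (-(n : ℤ), k n)) ((1 / 2) ^ n / 2) : Set ℝ)
      =ᵐ[volume] D.interval (-(n : ℤ), k n) := fun n => by
    rw [hball]; exact Ico_ae_eq_Icc.symm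
  have hlim := hx (l := Filter.atTop) (fun n : ℕ => D.center (-(n : ℤ), k n))
    (fun n => (1 / 2) ^ n / 2) ?_ ?_
  · have hl' : ENNReal.ofReal l < 1 := by simpa using hl
    obtain ⟨n, hn⟩ := (hlim.eventually (lt_mem_nhds hl')).exists
    refine ⟨(-(n : ℤ), k n), hk n, ?_⟩
    rw [measure_congr (hae n), measure_congr ((Filter.EventuallyEq.refl _ V).inter (hae n)),
      volume_interval, ENNReal.lt_div_iff_mul_lt (Or.inl (by simpa using D.length_pos _))
        (Or.inl ENNReal.ofReal_ne_top)] at hn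
    rwa [ENNReal.ofReal_mul' (D.length_pos _).le]
  · refine tendsto_nhdsWithin_iff.2 ⟨?_, Filter.Eventually.of_forall fun n => ?_⟩
    · simpa using (tendsto_pow_atTop_nhds_zero_of_lt_one (r := (1 / 2 : ℝ)) (by norm_num)
        (by norm_num)).div_const 2
    · simp only [Set.mem_Ioi]; positivity
  · refine Filter.Eventually.of_forall fun n => ?_
    rw [one_mul, hball]
    exact Set.Ico_subset_Icc_self (hk n)

end DyadicGrid

/-! ### Size and integrability of rescaled functions -/

section Wavelet

variable (v : ℝ → ℝ) (D : DyadicGrid) (I : ℤ × ℤ)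

lemma DyadicGrid.length_rpow_pos : 0 < D.length I ^ (-(1 / 2) : ℝ) :=
  Real.rpow_pos_of_pos (D.length_pos I) _

lemma DyadicGrid.length_rpow_mul_self :
    D.length I ^ (-(1 / 2) : ℝ) * D.length I ^ (-(1 / 2) : ℝ) = (D.length I)⁻¹ := by
  rw [← Real.rpow_add (D.length_pos I), ← Real.rpow_neg_one]
  norm_num

lemma wavelet_sq (x : ℝ) :
    wavelet v D I x ^ 2 = (D.length I)⁻¹ * v ((x - D.center I) / D.length I) ^ 2 := by
  rw [wavelet, mul_pow, sq, D.length_rpow_mul_self]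

variable {v}

lemma abs_wavelet_le {A q : ℝ} (hv : ∀ x, |v x| ≤ A * bump q x) (x : ℝ) :
    |wavelet v D I x| ≤
      A * (D.length I ^ (-(1 / 2) : ℝ) * bump q ((x - D.center I) / D.length I)) := by
  rw [wavelet, abs_mul, abs_of_pos (D.length_rpow_pos I)]
  calc _ ≤ D.length I ^ (-(1 / 2) : ℝ) * (A * bump q ((x - D.center I) / D.length I)) := by
        gcongr; exacts [(D.length_rpow_pos I).le, hv _]
    _ = _ := by ring

lemma continuous_wavelet (hv : Continuous v) : Continuous (wavelet v D I) := by
  unfold wavelet; fun_prop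

lemma integrable_of_le_bump {A q : ℝ} (hc : Continuous v) (hq : 1 < q)
    (hv : ∀ x, |v x| ≤ A * bump q x) : Integrable v :=
  ((integrable_bump hq).const_mul A).mono' hc.aestronglyMeasurable
    (Filter.Eventually.of_forall hv)

lemma memLp_two_of_le_bump {A q : ℝ} (hc : Continuous v) (hq : 1 < q)
    (hv : ∀ x, |v x| ≤ A * bump q x) : MemLp v 2 := by
  rw [memLp_two_iff_integrable_sq hc.aestronglyMeasurable]
  refine ((integrable_bump hq).const_mul (A ^ 2)).mono' (hc.pow 2).aestronglyMeasurable
    (Filter.Eventually.of_forall fun x => ?_)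
  have h1 := bump_le_one (q := q) (by linarith) x
  have h0 := bump_nonneg q x
  rw [Real.norm_eq_abs, abs_pow]
  calc |v x| ^ 2 ≤ (A * bump q x) ^ 2 := by gcongr; exact hv x
    _ = A ^ 2 * (bump q x * bump q x) := by ring
    _ ≤ A ^ 2 * (1 * bump q x) := by gcongr
    _ = _ := by ring

lemma integrable_wavelet (hv : Integrable v) : Integrable (wavelet v D I) :=
  (integrable_comp_sub_div hv _ (D.length_pos I)).const_mul _

lemma integral_wavelet (hv : ∫ x, v x = 0) : ∫ x, wavelet v D I x = 0 := by
  unfold wavelet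
  rw [integral_const_mul, integral_comp_sub_div _ _ (D.length_pos I), hv]
  simp

lemma memLp_wavelet (hc : Continuous v) (hv : MemLp v 2) : MemLp (wavelet v D I) 2 := by
  have h1 : Integrable fun x => v x ^ 2 := (memLp_two_iff_integrable_sq hv.1).1 hv
  rw [memLp_two_iff_integrable_sq (continuous_wavelet D I hc).aestronglyMeasurable]
  simp_rw [wavelet_sq]
  exact (integrable_comp_sub_div h1 _ (D.length_pos I)).const_mul _

end Wavelet

/-! ### Molecules and the Bessel inequality -/

/-- A function with mean zero, decay of order `q` and Hölder regularity of order `s`, with the same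
decay for the Hölder quotients. -/
structure IsMolecule (A q s : ℝ) (v : ℝ → ℝ) : Prop where
  bound : ∀ x, |v x| ≤ A * bump q x
  holder : ∀ x y, |v x - v y| ≤ A * |x - y| ^ s * (bump q x + bump q y)
  integral_eq_zero : ∫ x, v x = 0

namespace IsMolecule

variable {A q s : ℝ} {v : ℝ → ℝ}

lemma nonneg (hv : IsMolecule A q s v) : 0 ≤ A := by
  have := (abs_nonneg _).trans (hv.bound 0)
  simpa [bump] using this

lemma continuous (hv : IsMolecule A q s v) (hs : 0 < s) (hq : 0 ≤ q) : Continuous v := by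
  refine continuous_iff_continuousAt.2 fun x => ?_
  refine tendsto_iff_norm_sub_tendsto_zero.2 ?_
  have h0 : Filter.Tendsto (fun y : ℝ => A * |y - x| ^ s * 2) (nhds x) (nhds 0) := by
    have hc : Continuous fun y : ℝ => A * |y - x| ^ s * 2 := by
      have : Continuous fun y : ℝ => |y - x| ^ s :=
        (by fun_prop : Continuous fun y : ℝ => |y - x|).rpow_const fun _ => Or.inr hs.le
      fun_prop
    simpa [Real.zero_rpow hs.ne'] using hc.tendsto x
  refine squeeze_zero (fun _ => norm_nonneg _) (fun y => (hv.holder y x).trans ?_) h0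
  have h1 := bump_le_one hq x
  have h2 := bump_le_one hq y
  have := hv.nonneg
  gcongr
  linarith

/-- As `w_J` has mean zero, the constant `w_I(c_J)` may be subtracted from `w_I`. Hölder continuity
then gives `(|J| / |I|) ^ s`, a gain when `J` is the shorter interval, times `(|x - c_J| / |J|) ^
s`; the latter factor is absorbed by the decay of `w_J`, hence the exponent `q - s`. -/
lemma abs_integral_mul_le (hv : IsMolecule A q s v) (hs : 0 < s) (hq : 1 < q - s)
    (D : DyadicGrid) {I J : ℤ × ℤ} :
    |∫ x, wavelet v D I x * wavelet v D J x| ≤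
      A ^ 2 * (D.length I ^ (-(1 / 2) : ℝ) * D.length J ^ (-(1 / 2) : ℝ) *
        (D.length J / D.length I) ^ s) *
      ∫ x, bump (q - s) ((x - D.center J) / D.length J) *
        (bump q ((x - D.center I) / D.length I) +
          bump q ((D.center J - D.center I) / D.length I)) := by
  have hA := hv.nonneg
  have hI := D.length_pos I
  have hJ := D.length_pos J
  have hc := hv.continuous hs (by linarith)
  have hvi := integrable_of_le_bump hc (by linarith) hv.bound
  have hJi := integrable_wavelet D J hvi
  have h2 : ∀ K, MemLp (wavelet v D K) 2 := fun K =>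
    memLp_wavelet D K hc (memLp_two_of_le_bump hc (by linarith) hv.bound)
  have e : ∫ x, wavelet v D I x * wavelet v D J x =
      ∫ x, (wavelet v D I x - wavelet v D I (D.center J)) * wavelet v D J x := by
    have hIJ : Integrable fun x => wavelet v D I x * wavelet v D J x :=
      (h2 I).integrable_mul (h2 J)
    simp_rw [sub_mul]
    rw [integral_sub hIJ (hJi.const_mul _), integral_const_mul,
      integral_wavelet D J hv.integral_eq_zero]
    simp
  rw [e, ← integral_const_mul]
  refine norm_integral_le_of_norm_le (f := fun x => (wavelet v D I x - wavelet v D I (D.center J)) *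
    wavelet v D J x) ?_ (Filter.Eventually.of_forall fun x => ?_)
  · refine Integrable.const_mul ?_ _
    refine ((integrable_comp_sub_div (integrable_bump hq) (D.center J) hJ).const_mul 2).mono' ?_
      (Filter.Eventually.of_forall fun x => ?_)
    · have h1 := continuous_bump (q - s)
      have h2 := continuous_bump q
      exact (by fun_prop : Continuous _).aestronglyMeasurable
    · have h1 := bump_le_one (q := q) (by linarith) ((x - D.center I) / D.length I)
      have h2 := bump_le_one (q := q) (by linarith) ((D.center J - D.center I) / D.length I)
      have h3 := bump_nonneg q ((x - D.center I) / D.length I)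
      have h4 := bump_nonneg q ((D.center J - D.center I) / D.length I)
      have h5 := bump_nonneg (q - s) ((x - D.center J) / D.length J)
      rw [Real.norm_eq_abs, abs_of_nonneg (by positivity)]
      nlinarith
  · rw [Real.norm_eq_abs, abs_mul]
    have h1 : |wavelet v D I x - wavelet v D I (D.center J)| ≤ D.length I ^ (-(1 / 2) : ℝ) *
        (A * ((D.length J / D.length I) ^ s * |(x - D.center J) / D.length J| ^ s) *
          (bump q ((x - D.center I) / D.length I) +
            bump q ((D.center J - D.center I) / D.length I))) := by
      unfold wavelet
      rw [← mul_sub, abs_mul, abs_of_pos (D.length_rpow_pos I)]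
      refine mul_le_mul_of_nonneg_left ((hv.holder _ _).trans (le_of_eq ?_))
        (D.length_rpow_pos I).le
      rw [← Real.mul_rpow (by positivity) (by positivity)]
      congr 3
      rw [← abs_of_pos (div_pos hJ hI), ← abs_mul]
      congr 1
      field_simp
      ring
    have h2 := abs_wavelet_le D J hv.bound x
    have h3 := rpow_mul_bump_le hs.le q ((x - D.center J) / D.length J)
    have p1 := bump_nonneg q ((x - D.center I) / D.length I)
    have p2 := bump_nonneg q ((D.center J - D.center I) / D.length I)
    have p3 := D.length_rpow_pos I
    have p4 := D.length_rpow_pos J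
    have p5 : 0 ≤ (D.length J / D.length I) ^ s := by positivity
    calc _ ≤ _ := mul_le_mul h1 h2 (abs_nonneg _) (by positivity)
      _ = A ^ 2 * (D.length I ^ (-(1 / 2) : ℝ) * D.length J ^ (-(1 / 2) : ℝ) *
            (D.length J / D.length I) ^ s) *
          ((|(x - D.center J) / D.length J| ^ s * bump q ((x - D.center J) / D.length J)) *
          (bump q ((x - D.center I) / D.length I) +
            bump q ((D.center J - D.center I) / D.length I))) := by ring
      _ ≤ _ := by gcongr

lemma integrable_bump_mul_bump {q q' : ℝ} (hq : 1 < q) (hq' : 0 ≤ q') {c c' L L' : ℝ}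
    (hL : 0 < L) :
    Integrable fun x => bump q ((x - c) / L) * bump q' ((x - c') / L') := by
  refine (integrable_comp_sub_div (integrable_bump hq) c hL).mono' ?_
    (Filter.Eventually.of_forall fun x => ?_)
  · have h1 := continuous_bump q
    have h2 := continuous_bump q'
    exact (by fun_prop : Continuous _).aestronglyMeasurable
  · have h1 := bump_le_one hq' ((x - c') / L')
    have h3 := bump_nonneg q' ((x - c') / L')
    have h5 := bump_nonneg q ((x - c) / L)
    rw [Real.norm_eq_abs, abs_of_nonneg (by positivity)]
    nlinarith

lemma integral_split {q s : ℝ} (hs : 0 < s) (hq : 1 < q - s) (D : DyadicGrid) (I J : ℤ × ℤ) :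
    ∫ x, bump (q - s) ((x - D.center J) / D.length J) *
        (bump q ((x - D.center I) / D.length I) +
          bump q ((D.center J - D.center I) / D.length I)) =
      (∫ x, bump (q - s) ((x - D.center J) / D.length J) *
        bump q ((x - D.center I) / D.length I)) +
      D.length J * (∫ x, bump (q - s) x) * bump q ((D.center J - D.center I) / D.length I) := by
  simp_rw [mul_add]
  rw [integral_add (integrable_bump_mul_bump hq (by linarith) (D.length_pos J))
    ((integrable_comp_sub_div (integrable_bump hq) _ (D.length_pos J)).mul_const _),
    integral_mul_const, integral_comp_sub_div _ _ (D.length_pos J)]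

/-- The constant in the bounds of the Gram matrix of a molecule. -/
noncomputable def gramConst (q s : ℝ) : ℝ :=
  latticeConst (q - s) * (∫ x, bump q x) + 2 * latticeConst q * ∫ x, bump (q - s) x

lemma gramConst_pos {q s : ℝ} (hs : 0 < s) (hq : 1 < q - s) : 0 < gramConst q s := by
  have h1 := latticeConst_pos hq
  have h2 := latticeConst_pos (q := q) (by linarith)
  have h3 := integral_bump_pos hq
  have h4 := integral_bump_pos (q := q) (by linarith)
  unfold gramConst
  positivity

/-- With `a = |I| ^ (-1/2)` and `b = |J| ^ (-1/2)`, the Schur weight `a / b` turns the normalisation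
`a * b` of a Gram entry into `a * a = |I|⁻¹`. -/
lemma mul_weight_cancel {a b c X A : ℝ} (hb : 0 < b) :
    A * (a * b * c) * X * (a / b) = A * (a * a * c) * X := by
  field_simp

/-- Rows of the weighted Gram matrix: the second interval is the smaller one. -/
lemma sum_gram_le_of_le (hv : IsMolecule A q s v) (hs : 0 < s) (hq : 1 < q - s)
    (D : DyadicGrid) (I : ℤ × ℤ) {j : ℤ} (hj : j ≤ I.1) (K : Finset ℤ) :
    ∑ k ∈ K, |∫ x, wavelet v D I x * wavelet v D (j, k) x| *
        (D.length I ^ (-(1 / 2) : ℝ) / D.length (j, k) ^ (-(1 / 2) : ℝ)) ≤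
      A ^ 2 * gramConst q s * ((2 : ℝ) ^ (-s)) ^ (I.1 - j).natAbs := by
  have hI := D.length_pos I
  have hj0 : (0 : ℝ) < 2 ^ j := by positivity
  have hjI : (2 : ℝ) ^ j ≤ D.length I := D.length_le_length (I := (j, 0)) hj
  set θ := ((2 : ℝ) ^ (-s)) ^ (I.1 - j).natAbs with hθ
  have hθ0 : 0 ≤ θ := by positivity
  calc _ ≤ ∑ k ∈ K, A ^ 2 * ((D.length I)⁻¹ * θ) *
        ((∫ x, bump (q - s) ((x - D.center (j, k)) / D.length (j, k)) *
          bump q ((x - D.center I) / D.length I)) +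
        2 ^ j * (∫ x, bump (q - s) x) *
          bump q ((D.center (j, k) - D.center I) / D.length I)) := by
        refine Finset.sum_le_sum fun k _ => ?_
        have h := hv.abs_integral_mul_le hs hq D (I := I) (J := (j, k))
        have p3 := D.length_rpow_pos I
        have p4 := D.length_rpow_pos (j, k)
        rw [integral_split hs hq, D.length_div_rpow (I := I) (J := (j, k)) hj] at h
        refine (mul_le_mul_of_nonneg_right h (by positivity)).trans (le_of_eq ?_)
        rw [← D.length_rpow_mul_self I, mul_weight_cancel p4]
        rfl
    _ = A ^ 2 * ((D.length I)⁻¹ * θ) *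
        ((∫ x, (∑ k ∈ K, bump (q - s) ((x - D.center (j, k)) / D.length (j, k))) *
          bump q ((x - D.center I) / D.length I)) +
        2 ^ j * (∫ x, bump (q - s) x) *
          ∑ k ∈ K, bump q ((D.center (j, k) - D.center I) / D.length I)) := by
        rw [← Finset.mul_sum, Finset.sum_add_distrib, ← Finset.mul_sum]
        simp_rw [Finset.sum_mul]
        rw [integral_finsetSum _ fun k _ =>
          integrable_bump_mul_bump hq (by linarith) (D.length_pos (j, k))]
    _ ≤ A ^ 2 * ((D.length I)⁻¹ * θ) *
        ((∫ x, latticeConst (q - s) * bump q ((x - D.center I) / D.length I)) +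
        2 ^ j * (∫ x, bump (q - s) x) * (latticeConst q * (D.length I / 2 ^ j))) := by
        have hb := (integral_bump_pos hq).le
        refine mul_le_mul_of_nonneg_left (add_le_add (integral_mono ?_ ?_ fun x => ?_)
          (mul_le_mul_of_nonneg_left ?_ (by positivity))) (by positivity)
        · simp_rw [Finset.sum_mul]
          exact integrable_finsetSum _ fun k _ =>
            integrable_bump_mul_bump hq (by linarith) (D.length_pos (j, k))
        · exact (integrable_comp_sub_div (integrable_bump (by linarith)) _ hI).const_mul _
        · exact mul_le_mul_of_nonneg_right (D.sum_bump_center_le hq x j K) (bump_nonneg _ _)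
        · exact D.sum_bump_center_div_le (by linarith) _ hjI K
    _ = A ^ 2 * (latticeConst (q - s) * (∫ x, bump q x) +
          latticeConst q * ∫ x, bump (q - s) x) * θ := by
        rw [integral_const_mul, integral_comp_sub_div _ _ hI]
        field_simp
    _ ≤ _ := by
        have h2 := latticeConst_pos (q := q) (by linarith)
        have h3 := integral_bump_pos hq
        unfold gramConst
        gcongr
        linarith

/-- Rows of the weighted Gram matrix: the second interval is the larger one. -/
lemma sum_gram_le_of_ge (hv : IsMolecule A q s v) (hs : 0 < s) (hq : 1 < q - s)
    (D : DyadicGrid) (J : ℤ × ℤ) {i : ℤ} (hi : J.1 ≤ i) (K : Finset ℤ) :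
    ∑ k ∈ K, |∫ x, wavelet v D J x * wavelet v D (i, k) x| *
        (D.length J ^ (-(1 / 2) : ℝ) / D.length (i, k) ^ (-(1 / 2) : ℝ)) ≤
      A ^ 2 * gramConst q s * ((2 : ℝ) ^ (-s)) ^ (J.1 - i).natAbs := by
  have hJ := D.length_pos J
  set θ := ((2 : ℝ) ^ (-s)) ^ (J.1 - i).natAbs with hθ
  have hθ0 : 0 ≤ θ := by positivity
  have hθ' : θ = ((2 : ℝ) ^ (-s)) ^ (i - J.1).natAbs := by
    rw [hθ, ← Int.natAbs_neg, neg_sub]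
  calc _ ≤ ∑ k ∈ K, A ^ 2 * ((D.length J)⁻¹ * θ) *
        ((∫ x, bump (q - s) ((x - D.center J) / D.length J) *
          bump q ((x - D.center (i, k)) / D.length (i, k))) +
        D.length J * (∫ x, bump (q - s) x) *
          bump q ((D.center J - D.center (i, k)) / D.length (i, k))) := by
        refine Finset.sum_le_sum fun k _ => ?_
        have h := hv.abs_integral_mul_le hs hq D (I := (i, k)) (J := J)
        have p3 := D.length_rpow_pos J
        have p4 := D.length_rpow_pos (i, k)
        rw [integral_split hs hq, D.length_div_rpow (I := (i, k)) (J := J) hi, ← hθ'] at h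
        simp_rw [mul_comm (wavelet v D (i, k) _)] at h
        refine (mul_le_mul_of_nonneg_right h (by positivity)).trans (le_of_eq ?_)
        rw [← D.length_rpow_mul_self J]
        rw [mul_comm (D.length (i, k) ^ _), mul_weight_cancel p4]
    _ = A ^ 2 * ((D.length J)⁻¹ * θ) *
        ((∫ x, bump (q - s) ((x - D.center J) / D.length J) *
          ∑ k ∈ K, bump q ((x - D.center (i, k)) / D.length (i, k))) +
        D.length J * (∫ x, bump (q - s) x) *
          ∑ k ∈ K, bump q ((D.center J - D.center (i, k)) / D.length (i, k))) := by
        rw [← Finset.mul_sum, Finset.sum_add_distrib, ← Finset.mul_sum]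
        simp_rw [Finset.mul_sum]
        rw [integral_finsetSum _ fun k _ =>
          integrable_bump_mul_bump hq (by linarith) (D.length_pos J)]
    _ ≤ A ^ 2 * ((D.length J)⁻¹ * θ) *
        ((∫ x, bump (q - s) ((x - D.center J) / D.length J) * latticeConst q) +
        D.length J * (∫ x, bump (q - s) x) * latticeConst q) := by
        have hb := (integral_bump_pos hq).le
        refine mul_le_mul_of_nonneg_left (add_le_add (integral_mono ?_ ?_ fun x => ?_)
          (mul_le_mul_of_nonneg_left ?_ (by positivity))) (by positivity)
        · simp_rw [Finset.mul_sum]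
          exact integrable_finsetSum _ fun k _ =>
            integrable_bump_mul_bump hq (by linarith) (D.length_pos J)
        · exact (integrable_comp_sub_div (integrable_bump (by linarith)) _ hJ).mul_const _
        · exact mul_le_mul_of_nonneg_left (D.sum_bump_center_le (by linarith) x i K)
            (bump_nonneg _ _)
        · exact D.sum_bump_center_le (by linarith) _ i K
    _ = A ^ 2 * (2 * latticeConst q * ∫ x, bump (q - s) x) * θ := by
        rw [integral_mul_const, integral_comp_sub_div _ _ hJ]
        field_simp
        ring
    _ ≤ _ := by
        have h2 := latticeConst_pos hq
        have h3 := integral_bump_pos (q := q) (by linarith)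
        unfold gramConst
        gcongr
        nlinarith

/-- **Bessel inequality for molecules.** -/
theorem exists_bessel {q s : ℝ} (hs : 0 < s) (hq : 1 < q - s) :
    ∃ B : ℝ, 0 < B ∧ ∀ (A : ℝ) (v : ℝ → ℝ), IsMolecule A q s v → ∀ (D : DyadicGrid) (f : ℝ → ℝ),
      MemLp f 2 → ∀ F : Finset (ℤ × ℤ),
        ∑ I ∈ F, (∫ x, f x * wavelet v D I x) ^ 2 ≤ B * A ^ 2 * ∫ x, f x ^ 2 := by
  obtain ⟨T, hT0, hT⟩ := exists_sum_geometric_le (θ := (2 : ℝ) ^ (-s)) (by positivity)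
    (Real.rpow_lt_one_of_one_lt_of_neg (by norm_num) (by linarith))
  have hg := gramConst_pos hs hq
  refine ⟨gramConst q s * T, by positivity, fun A v hv D f hf F => ?_⟩
  have hc := hv.continuous hs (by linarith)
  have h2 : ∀ K, MemLp (wavelet v D K) 2 := fun K =>
    memLp_wavelet D K hc (memLp_two_of_le_bump hc (by linarith) hv.bound)
  set b := gramConst q s * T * A ^ 2 with hb
  have hb0 : 0 ≤ b := by positivity
  -- Schur test with weights `|I| ^ (-1/2)`: they balance the number of short intervals inside a
  -- long one, so that each scale contributes only the gain `2 ^ (-s)` to the power of the scale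
  -- difference, however small `s` is.
  have hrow : ∀ I, ∀ F : Finset (ℤ × ℤ), ∑ J ∈ F,
      |∫ x, wavelet v D I x * wavelet v D J x| *
        (D.length I ^ (-(1 / 2) : ℝ) / D.length J ^ (-(1 / 2) : ℝ)) ≤ b := by
    intro I F
    refine sum_le_of_rows (B := fun j => A ^ 2 * gramConst q s *
      ((2 : ℝ) ^ (-s)) ^ (I.1 - j).natAbs) (fun J => ?_) (fun j K => ?_) (fun K => ?_) F
    · have p3 := D.length_rpow_pos I
      have p4 := D.length_rpow_pos J
      positivity
    · rcases le_total j I.1 with h | h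
      · exact hv.sum_gram_le_of_le hs hq D I h K
      · exact hv.sum_gram_le_of_ge hs hq D I h K
    · rw [← Finset.mul_sum]
      calc _ ≤ A ^ 2 * gramConst q s * T := by gcongr; exact hT _ _
        _ = b := by rw [hb]; ring
  set a : ℤ × ℤ → ℝ := fun I => ∫ x, f x * wavelet v D I x with ha
  set G : ℤ × ℤ → ℤ × ℤ → ℝ := fun I J => |∫ x, wavelet v D I x * wavelet v D J x| with hG
  set N : ℤ × ℤ → ℝ := fun I => D.length I ^ (-(1 / 2) : ℝ) with hN
  have hN0 : ∀ I, 0 < N I := fun I => D.length_rpow_pos I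
  have hGsymm : ∀ I J, G I J = G J I := fun I J => by
    simp only [hG, mul_comm]
  set g : ℝ → ℝ := fun x => ∑ I ∈ F, a I * wavelet v D I x with hgdef
  have hgL : MemLp g 2 := by
    have := memLp_finsetSum F (fun I _ => (h2 I).const_mul (a I))
    exact this
  have e1 : ∫ x, f x * g x = ∑ I ∈ F, a I ^ 2 := by
    simp only [hgdef, Finset.mul_sum]
    rw [integral_finsetSum]
    · refine Finset.sum_congr rfl fun I _ => ?_
      simp_rw [mul_left_comm (f _)]
      rw [integral_const_mul, sq]
    · intro I _
      exact hf.integrable_mul ((h2 I).const_mul (a I))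
  have e2 : ∫ x, g x ^ 2 ≤ b * ∑ I ∈ F, a I ^ 2 := by
    have e3 : ∫ x, g x ^ 2 =
        ∑ I ∈ F, ∑ J ∈ F, a I * a J * ∫ x, wavelet v D I x * wavelet v D J x := by
      simp only [hgdef, sq, Finset.sum_mul_sum]
      rw [integral_finsetSum]
      · refine Finset.sum_congr rfl fun I _ => ?_
        rw [integral_finsetSum]
        · refine Finset.sum_congr rfl fun J _ => ?_
          rw [← integral_const_mul]
          congr 1 with x
          ring
        · intro J _
          exact ((h2 I).const_mul (a I)).integrable_mul ((h2 J).const_mul (a J))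
      · intro I _
        refine integrable_finsetSum _ fun J _ => ?_
        exact ((h2 I).const_mul (a I)).integrable_mul ((h2 J).const_mul (a J))
    -- Weighted inequality between geometric and arithmetic means; by symmetry of the Gram matrix
    -- both halves then have the same double sum.
    have key : ∀ I J, a I * a J * ∫ x, wavelet v D I x * wavelet v D J x ≤
        (a I ^ 2 * (G I J * (N I / N J)) + a J ^ 2 * (G J I * (N J / N I))) / 2 := by
      intro I J
      have h1 : a I * a J * ∫ x, wavelet v D I x * wavelet v D J x ≤ |a I| * |a J| * G I J := by
        refine (le_abs_self _).trans (le_of_eq ?_)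
        rw [abs_mul, abs_mul]
      have hGn : 0 ≤ G I J := abs_nonneg _
      have hI := hN0 I
      have hJ := hN0 J
      rw [hGsymm J I]
      refine h1.trans ?_
      have h3 : |a I| * |a J| ≤ (a I ^ 2 * (N I / N J) + a J ^ 2 * (N J / N I)) / 2 := by
        rw [← sq_abs (a I), ← sq_abs (a J)]
        have : 0 ≤ (|a I| * N I - |a J| * N J) ^ 2 / (2 * (N I * N J)) := by positivity
        have e : (|a I| * N I - |a J| * N J) ^ 2 / (2 * (N I * N J)) =
          (|a I| ^ 2 * (N I / N J) + |a J| ^ 2 * (N J / N I)) / 2 - |a I| * |a J| := by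
          field_simp
          ring
        linarith
      calc _ ≤ ((a I ^ 2 * (N I / N J) + a J ^ 2 * (N J / N I)) / 2) * G I J := by gcongr
        _ = _ := by ring
    have hsum : ∑ I ∈ F, ∑ J ∈ F, a I ^ 2 * (G I J * (N I / N J)) ≤ b * ∑ I ∈ F, a I ^ 2 := by
      rw [Finset.mul_sum]
      refine Finset.sum_le_sum fun I _ => ?_
      rw [← Finset.mul_sum, mul_comm b]
      gcongr
      exact hrow I F
    rw [e3]
    calc _ ≤ ∑ I ∈ F, ∑ J ∈ F,
          (a I ^ 2 * (G I J * (N I / N J)) + a J ^ 2 * (G J I * (N J / N I))) / 2 :=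
          Finset.sum_le_sum fun I _ => Finset.sum_le_sum fun J _ => key I J
      _ = (∑ I ∈ F, ∑ J ∈ F, a I ^ 2 * (G I J * (N I / N J)) +
            ∑ I ∈ F, ∑ J ∈ F, a J ^ 2 * (G J I * (N J / N I))) / 2 := by
          rw [← Finset.sum_add_distrib, Finset.sum_div]
          refine Finset.sum_congr rfl fun I _ => ?_
          rw [← Finset.sum_add_distrib, Finset.sum_div]
      _ = ∑ I ∈ F, ∑ J ∈ F, a I ^ 2 * (G I J * (N I / N J)) := by
          rw [Finset.sum_comm (f := fun I J => a J ^ 2 * (G J I * (N J / N I)))]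
          ring
      _ ≤ _ := hsum
  have hff : Integrable fun x => f x ^ 2 := (memLp_two_iff_integrable_sq hf.1).1 hf
  have hgg : Integrable fun x => g x ^ 2 := (memLp_two_iff_integrable_sq hgL.1).1 hgL
  have hfg : Integrable fun x => f x * g x := hf.integrable_mul hgL
  -- Duality by expanding a square: with `∫ f g = ∑ a_I²` and `∫ g² ≤ b ∑ a_I²` this gives `b ∑ a_I²
  -- ≤ b² ∫ f²`.
  have hpos : 0 ≤ ∫ x, (b * f x - g x) ^ 2 := integral_nonneg fun x => sq_nonneg _
  have hexp : ∫ x, (b * f x - g x) ^ 2 =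
      b ^ 2 * (∫ x, f x ^ 2) - 2 * b * (∫ x, f x * g x) + ∫ x, g x ^ 2 := by
    have : ∀ x, (b * f x - g x) ^ 2 = (b ^ 2 * f x ^ 2 - 2 * b * (f x * g x)) + g x ^ 2 :=
      fun x => by ring
    simp_rw [this]
    have h3 : Integrable fun x => b ^ 2 * f x ^ 2 - 2 * b * (f x * g x) :=
      (hff.const_mul _).sub (hfg.const_mul _)
    rw [integral_add h3 hgg,
      integral_sub (hff.const_mul _) (hfg.const_mul _), integral_const_mul, integral_const_mul]
  rw [hexp, e1] at hpos
  change ∑ I ∈ F, a I ^ 2 ≤ b * ∫ x, f x ^ 2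
  -- Cancelling `b` needs `b > 0`; when `b = 0` one has `A = 0` and `v` vanishes.
  rcases hb0.eq_or_lt with h0 | h0
  · have hA0 : A = 0 := by
      have := h0.symm
      rw [hb] at this
      simpa [hg.ne', hT0.ne'] using this
    have hv0 : ∀ x, v x = 0 := fun x => by
      have := hv.bound x
      rw [hA0, zero_mul] at this
      exact abs_nonpos_iff.1 this
    rw [← h0, zero_mul]
    refine le_of_eq (Finset.sum_eq_zero fun I _ => ?_)
    simp [ha, wavelet, hv0]
  · have : b * ∑ I ∈ F, a I ^ 2 ≤ b * (b * ∫ x, f x ^ 2) := by nlinarith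
    exact le_of_mul_le_mul_left this h0

end IsMolecule

/-! ### Consequences of orthonormality: Parseval and mean zero -/

namespace IsL2OrthonormalBasis

variable {ι : Type*} {e : ι → ℝ → ℝ}

lemma inner_toLp_eq {f g : ℝ → ℝ} (hf : MemLp f 2) (b : Lp ℝ 2 (volume : Measure ℝ))
    (hb : (b : ℝ → ℝ) =ᵐ[volume] g) : inner ℝ (hf.toLp f) b = ∫ x, f x * g x := by
  rw [L2.inner_def]
  refine integral_congr_ae ?_
  filter_upwards [hf.coeFn_toLp, hb] with x h1 h2
  simp [h1, h2, mul_comm]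

/-- Parseval's identity. -/
lemma hasSum_integral_mul (h : IsL2OrthonormalBasis e) {f g : ℝ → ℝ} (hf : MemLp f 2)
    (hg : MemLp g 2) :
    HasSum (fun i => (∫ x, f x * e i x) * ∫ x, g x * e i x) (∫ x, f x * g x) := by
  obtain ⟨b, hb⟩ := h
  have := b.hasSum_inner_mul_inner (hf.toLp f) (hg.toLp g)
  rw [inner_toLp_eq hf _ hg.coeFn_toLp] at this
  have e : (fun i => (∫ x, f x * e i x) * ∫ x, g x * e i x) =
      fun i => inner ℝ (hf.toLp f) (b i) * inner ℝ (b i) (hg.toLp g) := by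
    funext i
    rw [inner_toLp_eq hf _ (hb i), real_inner_comm, inner_toLp_eq hg _ (hb i)]
  rw [e]
  exact this

lemma integral_mul_eq_zero (h : IsL2OrthonormalBasis e) {i j : ι} (hij : i ≠ j) :
    ∫ x, e i x * e j x = 0 := by
  obtain ⟨b, hb⟩ := h
  have : inner ℝ (b i) (b j) = 0 := b.orthonormal.2 hij
  rw [L2.inner_def] at this
  rw [← this]
  refine integral_congr_ae ?_
  filter_upwards [hb i, hb j] with x h1 h2
  simp [h1, h2, mul_comm]

lemma integral_sq_eq_one (h : IsL2OrthonormalBasis e) (i : ι) : ∫ x, e i x ^ 2 = 1 := by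
  obtain ⟨b, hb⟩ := h
  have := real_inner_self_eq_norm_sq (b i)
  rw [b.orthonormal.1 i, L2.inner_def] at this
  rw [one_pow] at this
  rw [← this]
  refine integral_congr_ae ?_
  filter_upwards [hb i] with x h1
  simp [h1, sq]

end IsL2OrthonormalBasis

lemma exists_ne_zero_of_isL2OrthonormalBasis {w : ℝ → ℝ} {D : DyadicGrid}
    (hb : IsL2OrthonormalBasis (wavelet w D)) : ∃ x, w x ≠ 0 := by
  by_contra! h
  have := hb.integral_sq_eq_one (0, 0)
  simp [wavelet, h] at this

/-- An integrable continuous wavelet has mean zero. -/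
lemma integral_eq_zero_of_isL2OrthonormalBasis {w : ℝ → ℝ} {D : DyadicGrid} {C r : ℝ}
    (hr : 1 < r) (hc : Continuous w) (hw : ∀ x, |w x| ≤ C * bump r x)
    (hb : IsL2OrthonormalBasis (wavelet w D)) : ∫ x, w x = 0 := by
  obtain ⟨x₀, hx₀⟩ := exists_ne_zero_of_isL2OrthonormalBasis hb
  have hwi := integrable_of_le_bump hc hr hw
  have hC : 0 ≤ C := by simpa [bump] using (abs_nonneg _).trans (hw 0)
  have hwC : ∀ x, |w x| ≤ C := fun x => (hw x).trans
    (mul_le_of_le_one_right hC (bump_le_one (by linarith) x))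
  set c₀ := D.center (0, 0) with hc₀
  -- Ever shorter intervals around the point where the wavelet of index `(0, 0)` takes the value `w
  -- x₀ ≠ 0`. After rescaling, orthogonality to the short wavelets tends to `w x₀ * ∫ w = 0`.
  choose k hk using fun n : ℕ => D.exists_mem_interval (-(n : ℤ)) (c₀ + x₀)
  have hlen : ∀ n : ℕ, D.length (-(n : ℤ), k n) = (1 / 2 : ℝ) ^ n := fun n => by
    rw [D.length_mk, zpow_neg, zpow_natCast, one_div, inv_pow]
  have hpow : Filter.Tendsto (fun n : ℕ => (1 / 2 : ℝ) ^ n) Filter.atTop (nhds 0) :=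
    tendsto_pow_atTop_nhds_zero_of_lt_one (by norm_num) (by norm_num)
  have hcen : Filter.Tendsto (fun n : ℕ => D.center (-(n : ℤ), k n) - c₀) Filter.atTop
      (nhds x₀) := by
    rw [tendsto_iff_norm_sub_tendsto_zero]
    refine squeeze_zero (fun _ => norm_nonneg _) (fun n => ?_) hpow
    have := D.abs_sub_le_of_mem (D.center_mem (-(n : ℤ), k n)) (hk n)
    rw [hlen] at this
    rw [Real.norm_eq_abs]
    convert this using 2
    ring
  have hzero : ∀ n : ℕ, 1 ≤ n →
      ∫ t, w (D.center (-(n : ℤ), k n) - c₀ + (1 / 2) ^ n * t) * w t = 0 := by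
    intro n hn
    have h1 := hb.integral_mul_eq_zero (i := (0, 0)) (j := (-(n : ℤ), k n))
      (by simp only [ne_eq, Prod.mk.injEq, not_and]; omega)
    set c := D.center (-(n : ℤ), k n)
    have hL : (0 : ℝ) < (1 / 2) ^ n := by positivity
    have e : ∀ x, wavelet w D (0, 0) x * wavelet w D (-(n : ℤ), k n) x =
        (((1 / 2 : ℝ) ^ n) ^ (-(1 / 2) : ℝ)) * (fun t => w (c - c₀ + (1 / 2) ^ n * t) * w t)
          ((x - c) / (1 / 2) ^ n) := fun x => by
      unfold wavelet
      rw [hlen, D.length_mk]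
      have : (x - D.center (0, 0)) / (2 : ℝ) ^ (0 : ℤ) =
          c - c₀ + (1 / 2) ^ n * ((x - c) / (1 / 2) ^ n) := by
        rw [mul_div_cancel₀ _ hL.ne', hc₀]
        simp
      rw [this]
      simp
      ring
    simp_rw [e] at h1
    rw [integral_const_mul, integral_comp_sub_div
      (fun t => w (c - c₀ + (1 / 2) ^ n * t) * w t) c hL] at h1
    have p := Real.rpow_pos_of_pos hL (-(1 / 2) : ℝ)
    simpa [p.ne', hL.ne'] using h1
  have hlim : Filter.Tendsto
      (fun n : ℕ => ∫ t, w (D.center (-(n : ℤ), k n) - c₀ + (1 / 2) ^ n * t) * w t)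
      Filter.atTop (nhds (∫ t, w x₀ * w t)) := by
    refine tendsto_integral_of_dominated_convergence (fun t => C * |w t|) (fun n => ?_)
      (hwi.abs.const_mul C) (fun n => Filter.Eventually.of_forall fun t => ?_)
      (Filter.Eventually.of_forall fun t => ?_)
    · exact (by fun_prop : Continuous _).aestronglyMeasurable
    · rw [Real.norm_eq_abs, abs_mul]
      gcongr
      exact hwC _
    · refine Filter.Tendsto.mul_const _ ((hc.tendsto x₀).comp ?_)
      simpa using hcen.add (hpow.mul_const t)
  have : ∫ t, w x₀ * w t = 0 := by
    refine tendsto_nhds_unique hlim (tendsto_const_nhds.congr' ?_)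
    filter_upwards [Filter.eventually_ge_atTop 1] with n hn using (hzero n hn).symm
  rw [integral_const_mul] at this
  simpa [hx₀] using this

/-! ### Hölder continuity from the basis property -/

/-- One of `a`, `b` has absolute value at least half the distance `|a - b|`; its weight becomes the
off-diagonal factor and the other weight is kept. -/
lemma bump_mul_bump_le {q a b : ℝ} (hq : 0 ≤ q) :
    bump q a * bump q b ≤ bump q ((a - b) / 2) * (bump q a + bump q b) := by
  have ha := bump_nonneg q a
  have hb := bump_nonneg q b
  have h0 := bump_nonneg q ((a - b) / 2)
  have h : |(a - b) / 2| ≤ |a| ∨ |(a - b) / 2| ≤ |b| := by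
    by_contra! h
    have := abs_sub a b
    rw [abs_div, abs_two] at h
    linarith
  rcases h with h | h
  · have := bump_le_bump hq h
    nlinarith
  · have := bump_le_bump hq h
    nlinarith

section Kernel

variable {w : ℝ → ℝ} {C r : ℝ}

/-- Summation of a wavelet over the intervals of length at least `2`. -/
lemma exists_sum_coarse_le (hr : 1 < r) (hw : ∀ x, |w x| ≤ C * bump r x) (D : DyadicGrid) :
    ∃ M : ℝ, 0 < M ∧ ∀ F : Finset (ℤ × ℤ), (∀ I ∈ F, 1 ≤ I.1) → ∀ y,
      ∑ I ∈ F, D.length I ^ (-(1 / 2) : ℝ) * |wavelet w D I y| ≤ M := by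
  have hC : 0 ≤ C := by simpa [bump] using (abs_nonneg _).trans (hw 0)
  obtain ⟨T, hT0, hT⟩ := exists_sum_geometric_le (θ := (1 / 2 : ℝ)) (by norm_num) (by norm_num)
  have hΛ := latticeConst_pos hr
  refine ⟨C * latticeConst r * T + 1, by positivity, fun F hF y => ?_⟩
  have key : ∑ I ∈ F, (if 1 ≤ I.1 then D.length I ^ (-(1 / 2) : ℝ) * |wavelet w D I y| else 0) ≤
      C * latticeConst r * T := by
    -- The extra factor `|I| ^ (-1/2)` and the one inside the wavelet give `|I|⁻¹`, a geometric
    -- series over the long scales.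
    refine sum_le_of_rows (B := fun j => C * latticeConst r * (1 / 2) ^ (0 - j).natAbs)
      (fun I => ?_) (fun j K => ?_) (fun K => ?_) F
    · have := D.length_rpow_pos I
      split_ifs <;> positivity
    · by_cases hj : 1 ≤ j
      · simp only [hj, if_true]
        calc _ ≤ ∑ k ∈ K, C * (1 / 2) ^ (0 - j).natAbs *
              bump r ((y - D.center (j, k)) / D.length (j, k)) := by
              refine Finset.sum_le_sum fun k _ => ?_
              have h1 := abs_wavelet_le D (j, k) hw y
              have h2 := D.length_rpow_pos (j, k)
              have h3 : (D.length (j, k))⁻¹ = (1 / 2) ^ (0 - j).natAbs := by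
                rw [D.length_mk, one_div, inv_pow, ← zpow_natCast]
                congr 2
                omega
              calc _ ≤ _ := mul_le_mul_of_nonneg_left h1 h2.le
                _ = C * (D.length (j, k) ^ (-(1 / 2) : ℝ) * D.length (j, k) ^ (-(1 / 2) : ℝ)) *
                    bump r ((y - D.center (j, k)) / D.length (j, k)) := by ring
                _ = _ := by rw [D.length_rpow_mul_self, h3]
          _ ≤ C * (1 / 2) ^ (0 - j).natAbs * latticeConst r := by
              rw [← Finset.mul_sum]
              gcongr
              exact D.sum_bump_center_le hr y j K
          _ = _ := by ring
      · simp only [hj, if_false, Finset.sum_const_zero]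
        positivity
    · rw [← Finset.mul_sum]
      gcongr
      exact hT 0 K
  rw [Finset.sum_congr rfl fun I hI => if_pos (hF I hI)] at key
  linarith

/-- Off-diagonal decay of the sum over the intervals of length at most `1`. -/
lemma exists_sum_fine_le (hr : 1 < r) (hw : ∀ x, |w x| ≤ C * bump r x) (D : DyadicGrid) :
    ∃ M : ℝ, 0 < M ∧ ∀ F : Finset (ℤ × ℤ), (∀ I ∈ F, I.1 ≤ 0) → ∀ x y z, |x - z| ≤ 2 →
      5 ≤ |y - z| → ∑ I ∈ F, |wavelet w D I x| * |wavelet w D I y| ≤ M * bump r (y - z) := by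
  have hC : 0 ≤ C := by simpa [bump] using (abs_nonneg _).trans (hw 0)
  obtain ⟨T, hT0, hT⟩ := exists_sum_geometric_le (θ := (2 : ℝ) ^ (-(r - 1))) (by positivity)
    (Real.rpow_lt_one_of_one_lt_of_neg (by norm_num) (by linarith))
  have hΛ := latticeConst_pos hr
  refine ⟨C ^ 2 * (2 * latticeConst r) * 4 ^ r * T + 1, by positivity,
    fun F hF x y z hxz hyz => ?_⟩
  have hbz := bump_nonneg r (y - z)
  set P := C ^ 2 * (2 * latticeConst r) * (4 ^ r * bump r (y - z)) with hP
  have hP0 : 0 ≤ P := by positivity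
  have key : ∑ I ∈ F, (if I.1 ≤ 0 then |wavelet w D I x| * |wavelet w D I y| else 0) ≤ P * T := by
    -- At scale `2 ^ j` the normalisation gives `2 ^ (-j)` and the off-diagonal decay gives `2 ^ (j
    -- * r)`; the product is summable over `j ≤ 0` because `r > 1`.
    refine sum_le_of_rows (B := fun j => P * ((2 : ℝ) ^ (-(r - 1))) ^ (0 - j).natAbs)
      (fun I => ?_) (fun j K => ?_) (fun K => ?_) F
    · split_ifs <;> positivity
    · by_cases hj : j ≤ 0
      · simp only [hj, if_true]
        have hL : (0 : ℝ) < 2 ^ j := by positivity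
        have hfar : bump r ((x - y) / 2 ^ j / 2) ≤
            (2 ^ j) ^ r * (4 ^ r * bump r (y - z)) := by
          -- This is where the separation `5` is used: `2 (|y - z| - 2) ≥ 1 + |y - z|`.
          have h1 : 1 + |y - z| ≤ 2 * |x - y| := by
            have : |y - z| ≤ |x - y| + |x - z| := by
              rw [abs_sub_comm x y]; exact abs_sub_le y x z
            linarith
          unfold bump
          rw [Real.rpow_neg (by positivity), Real.rpow_neg (by positivity),
            ← div_eq_mul_inv, ← Real.div_rpow (by positivity) (by positivity),
            ← Real.mul_rpow (by positivity) (by positivity),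
            ← Real.inv_rpow (by positivity)]
          refine Real.rpow_le_rpow (by positivity) ?_ (by linarith)
          have h2 : |(x - y) / 2 ^ j / 2| = |x - y| / (2 ^ j * 2) := by
            rw [abs_div, abs_div, abs_of_pos hL, abs_two, div_div]
          have h3 : 0 < |x - y| := by linarith [abs_nonneg (y - z)]
          rw [h2]
          calc (1 + |x - y| / (2 ^ j * 2))⁻¹ ≤ (|x - y| / (2 ^ j * 2))⁻¹ := by
                gcongr
                linarith
            _ = 2 ^ j * (4 / (2 * |x - y|)) := by rw [inv_div]; field_simp; norm_num
            _ ≤ _ := by gcongr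
        have hpow : (D.length (j, 0))⁻¹ * (2 ^ j) ^ r =
            ((2 : ℝ) ^ (-(r - 1))) ^ (0 - j).natAbs := by
          rw [← D.length_div_rpow (I := (0, 0)) (J := (j, 0)) hj, D.length_mk, D.length_mk,
            Real.rpow_sub (by positivity)]
          simp [div_eq_inv_mul]
        calc _ ≤ ∑ k ∈ K, C ^ 2 * (D.length (j, 0))⁻¹ * bump r ((x - y) / 2 ^ j / 2) *
              (bump r ((x - D.center (j, k)) / D.length (j, k)) +
                bump r ((y - D.center (j, k)) / D.length (j, k))) := by
              refine Finset.sum_le_sum fun k _ => ?_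
              have h2 := D.length_rpow_pos (j, k)
              have p1 := bump_nonneg r ((x - D.center (j, k)) / D.length (j, k))
              have h3 := bump_mul_bump_le (q := r) (a := (x - D.center (j, k)) / D.length (j, k))
                (b := (y - D.center (j, k)) / D.length (j, k)) (by linarith)
              have e : (x - D.center (j, k)) / D.length (j, k) -
                  (y - D.center (j, k)) / D.length (j, k) = (x - y) / 2 ^ j := by
                rw [D.length_mk]; ring
              rw [e] at h3
              calc _ ≤ _ := mul_le_mul (abs_wavelet_le D (j, k) hw x)
                    (abs_wavelet_le D (j, k) hw y) (abs_nonneg _) (by positivity)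
                _ = C ^ 2 * (D.length (j, k) ^ (-(1 / 2) : ℝ) * D.length (j, k) ^ (-(1 / 2) : ℝ)) *
                    (bump r ((x - D.center (j, k)) / D.length (j, k)) *
                      bump r ((y - D.center (j, k)) / D.length (j, k))) := by ring
                _ ≤ C ^ 2 * (D.length (j, k) ^ (-(1 / 2) : ℝ) * D.length (j, k) ^ (-(1 / 2) : ℝ)) *
                    (bump r ((x - y) / 2 ^ j / 2) *
                      (bump r ((x - D.center (j, k)) / D.length (j, k)) +
                        bump r ((y - D.center (j, k)) / D.length (j, k)))) := by gcongr
                _ = _ := by rw [D.length_rpow_mul_self, D.length_mk, D.length_mk]; ring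
          _ ≤ C ^ 2 * (D.length (j, 0))⁻¹ * ((2 ^ j) ^ r * (4 ^ r * bump r (y - z))) *
              (latticeConst r + latticeConst r) := by
              rw [← Finset.mul_sum, Finset.sum_add_distrib]
              have hp := (D.length_pos (j, 0)).le
              refine mul_le_mul (by gcongr) (add_le_add (D.sum_bump_center_le hr x j K)
                (D.sum_bump_center_le hr y j K)) ?_ (by positivity)
              exact add_nonneg (Finset.sum_nonneg fun _ _ => bump_nonneg _ _)
                (Finset.sum_nonneg fun _ _ => bump_nonneg _ _)
          _ = P * ((D.length (j, 0))⁻¹ * (2 ^ j) ^ r) := by rw [hP]; ring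
          _ = _ := by rw [hpow]
      · simp only [hj, if_false, Finset.sum_const_zero]
        positivity
    · rw [← Finset.mul_sum]
      gcongr
      exact hT 0 K
  rw [Finset.sum_congr rfl fun I hI => if_pos (hF I hI)] at key
  rw [hP] at key
  nlinarith

end Kernel

/-- The tail of the weight outside `[-ρ, ρ]`. -/
noncomputable def bumpTail (q ρ : ℝ) : ℝ := ∫ x in (Set.Icc (-ρ) ρ)ᶜ, bump q x

lemma bumpTail_nonneg (q ρ : ℝ) : 0 ≤ bumpTail q ρ := integral_nonneg fun _ => bump_nonneg _ _

lemma setIntegral_bump_sub (q ρ z : ℝ) :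
    ∫ y in (Set.Icc (z - ρ) (z + ρ))ᶜ, bump q (y - z) = bumpTail q ρ := by
  unfold bumpTail
  rw [← integral_indicator measurableSet_Icc.compl, ← integral_indicator measurableSet_Icc.compl,
    ← integral_sub_right_eq_self ((Set.Icc (-ρ) ρ)ᶜ.indicator fun x => bump q x) z]
  congr 1 with y
  simp only [Set.indicator, Set.mem_compl_iff, Set.mem_Icc]
  congr 2
  simp only [eq_iff_iff]
  constructor <;> rintro ⟨h1, h2⟩ <;> constructor <;> linarith

lemma exists_bumpTail_lt {q ε : ℝ} (hq : 1 < q) (hε : 0 < ε) :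
    ∃ ρ : ℝ, 5 ≤ ρ ∧ bumpTail q ρ < ε := by
  have h : Filter.Tendsto (fun n : ℕ => bumpTail q n) Filter.atTop (nhds 0) := by
    have := tendsto_setIntegral_of_antitone (μ := volume) (f := bump q)
      (s := fun n : ℕ => (Set.Icc (-(n : ℝ)) n)ᶜ) (fun n => measurableSet_Icc.compl)
      (fun a b hab => by
        have : (a : ℝ) ≤ b := by exact_mod_cast hab
        exact Set.compl_subset_compl.2 (Set.Icc_subset_Icc (by linarith) this))
      ⟨0, (integrable_bump hq).integrableOn⟩
    have he : ⋂ n : ℕ, (Set.Icc (-(n : ℝ)) n)ᶜ = ∅ := by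
      rw [← Set.compl_iUnion, Set.compl_empty_iff, Set.eq_univ_iff_forall]
      intro x
      obtain ⟨n, hn⟩ := exists_nat_ge |x|
      exact Set.mem_iUnion.2 ⟨n, abs_le.1 hn⟩
    rw [he] at this
    simpa [bumpTail] using this
  obtain ⟨n, hn⟩ := ((h.eventually (gt_mem_nhds hε)).and (Filter.eventually_ge_atTop 5)).exists
  exact ⟨n, by exact_mod_cast hn.2, hn.1⟩

section Holder

variable {w : ℝ → ℝ} {D : DyadicGrid} {C r s M₁ M₂ : ℝ}

/-- Estimate of the pairing of a coarse wavelet with a function of mean zero and small support,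
through the expansion of the latter in the wavelet basis. -/
lemma abs_integral_mul_coarse_le (hr : 1 < r) (hc : Continuous w)
    (hw : ∀ x, |w x| ≤ C * bump r x) (hb : IsL2OrthonormalBasis (wavelet w D))
    (hs1 : 1 < r - s) (hs0 : 0 < s)
    (hM₁ : ∀ F : Finset (ℤ × ℤ), (∀ I ∈ F, 1 ≤ I.1) → ∀ y,
      ∑ I ∈ F, D.length I ^ (-(1 / 2) : ℝ) * |wavelet w D I y| ≤ M₁)
    (hM₂ : ∀ F : Finset (ℤ × ℤ), (∀ I ∈ F, I.1 ≤ 0) → ∀ x y z, |x - z| ≤ 2 →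
      5 ≤ |y - z| → ∑ I ∈ F, |wavelet w D I x| * |wavelet w D I y| ≤ M₂ * bump r (y - z))
    {f : ℝ → ℝ} (hf2 : MemLp f 2) (hf1 : Integrable f) (hf0 : ∫ x, f x = 0) {z : ℝ}
    (hfz : ∀ x, 2 < |x - z| → f x = 0) {J : ℤ × ℤ} (hJ : 1 ≤ J.1) {A : ℝ}
    (hA : ∀ y, |wavelet w D J y - wavelet w D J z| ≤ A * (1 + |y - z|) ^ s)
    {a : ℝ} (ha : ∀ I : ℤ × ℤ, 1 ≤ I.1 →
      |∫ x, f x * wavelet w D I x| ≤ D.length I ^ (-(1 / 2) : ℝ) * a) {ρ : ℝ} (hρ : 5 ≤ ρ) :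
    |∫ x, f x * wavelet w D J x| ≤
      a * M₁ * (2 * ρ * (A * (1 + ρ) ^ s)) + (∫ x, |f x|) * (A * M₂ * bumpTail (r - s) ρ) := by
  have hwi := integrable_of_le_bump hc hr hw
  have hw2 := memLp_two_of_le_bump hc hr hw
  have hmean := integral_eq_zero_of_isL2OrthonormalBasis hr hc hw hb
  have hW2 : ∀ I, MemLp (wavelet w D I) 2 := fun I => memLp_wavelet D I hc hw2
  have hW1 : ∀ I, Integrable (wavelet w D I) := fun I => integrable_wavelet D I hwi
  have hWc : ∀ I, Continuous (wavelet w D I) := fun I => continuous_wavelet D I hc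
  have hA0 : 0 ≤ A := by
    have := (abs_nonneg _).trans (hA z)
    simpa using this
  have ha0 : 0 ≤ a := by
    have h1 := (abs_nonneg _).trans (ha (1, 0) le_rfl)
    exact nonneg_of_mul_nonneg_right h1 (D.length_rpow_pos _)
  set H : ℝ → ℝ := fun y => wavelet w D J y - wavelet w D J z with hH
  have hHc : Continuous H := (hWc J).sub continuous_const
  set B := Set.Icc (z - ρ) (z + ρ) with hB
  have hBm : MeasurableSet B := measurableSet_Icc
  have hBnear : ∀ y ∈ B, |H y| ≤ A * (1 + ρ) ^ s := fun y hy => by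
    refine (hA y).trans ?_
    have : |y - z| ≤ ρ := abs_le.2 ⟨by linarith [hy.1], by linarith [hy.2]⟩
    gcongr
  have hBfar : ∀ y ∈ Bᶜ, 5 ≤ |y - z| := fun y hy => by
    by_contra! hcon
    have := abs_lt.1 hcon
    exact hy ⟨by linarith, by linarith⟩
  set h : ℝ → ℝ := B.indicator H with hh
  have hh2 : MemLp h 2 := by
    rw [hh, memLp_indicator_iff_restrict hBm]
    refine MemLp.of_bound (hHc.aestronglyMeasurable) (A * (1 + ρ) ^ s) ?_
    exact (ae_restrict_iff' hBm).2 (Filter.Eventually.of_forall hBnear)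
  -- `f` is supported within `2` of `z`, hence in `B`, and its mean zero kills the constant
  -- subtracted in `H`.
  have hfh : ∫ x, f x * h x = ∫ x, f x * wavelet w D J x := by
    have h1 : ∀ x, f x * h x = f x * wavelet w D J x - f x * wavelet w D J z := fun x => by
      by_cases hx : x ∈ B
      · simp [hh, hx, hH]; ring
      · simp [hfz x (by linarith [hBfar x hx])]
    simp_rw [h1]
    have h2 : Integrable fun x => f x * wavelet w D J x := hf2.integrable_mul (hW2 J)
    rw [integral_sub h2 (hf1.mul_const _), integral_mul_const, hf0]
    simp
  have hHI : ∀ I, Integrable fun y => H y * wavelet w D I y := fun I => by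
    have h2 : Integrable fun x => wavelet w D J x * wavelet w D I x :=
      (hW2 J).integrable_mul (hW2 I)
    simp only [hH, sub_mul]
    exact h2.sub ((hW1 I).const_mul _)
  have hhI : ∀ I, ∫ y, h y * wavelet w D I y = ∫ y in B, H y * wavelet w D I y := fun I => by
    rw [← integral_indicator hBm]
    congr 1 with y
    by_cases hy : y ∈ B <;> simp [hh, hy]
  -- Over the long intervals the smallness comes from the coefficients of `f`, through `a`.
  have hcoarse : ∀ F : Finset (ℤ × ℤ), (∀ I ∈ F, 1 ≤ I.1) →
      ∑ I ∈ F, |(∫ x, f x * wavelet w D I x) * ∫ x, h x * wavelet w D I x| ≤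
        a * M₁ * (2 * ρ * (A * (1 + ρ) ^ s)) := by
    intro F hF
    calc _ ≤ ∑ I ∈ F, a * ∫ y in B, |H y| * (D.length I ^ (-(1 / 2) : ℝ) * |wavelet w D I y|) := by
          refine Finset.sum_le_sum fun I hI => ?_
          rw [abs_mul, hhI]
          have h1 := ha I (hF I hI)
          have h2 : |∫ y in B, H y * wavelet w D I y| ≤ ∫ y in B, |H y| * |wavelet w D I y| := by
            simp_rw [← abs_mul]
            exact abs_integral_le_integral_abs
          have p := D.length_rpow_pos I
          calc _ ≤ _ := mul_le_mul h1 h2 (abs_nonneg _) (by positivity)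
            _ = _ := by
              rw [mul_comm _ a, mul_assoc, ← integral_const_mul]
              congr 2 with y
              ring
      _ = a * ∫ y in B, |H y| * ∑ I ∈ F, D.length I ^ (-(1 / 2) : ℝ) * |wavelet w D I y| := by
          rw [← Finset.mul_sum, ← integral_finsetSum]
          · simp_rw [Finset.mul_sum]
          · intro I _
            have := hWc I
            exact (by fun_prop : Continuous _).integrableOn_Icc
      _ ≤ a * ∫ _ in B, (A * (1 + ρ) ^ s) * M₁ := by
          refine mul_le_mul_of_nonneg_left (setIntegral_mono_on ?_ continuous_const.integrableOn_Icc hBm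
            fun y hy => ?_) ha0
          · have := hWc
            exact (by fun_prop : Continuous _).integrableOn_Icc
          · have := hM₁ F hF y
            exact mul_le_mul (hBnear y hy) this (Finset.sum_nonneg fun I _ =>
              mul_nonneg (D.length_rpow_pos I).le (abs_nonneg _)) (by positivity)
      _ = _ := by
          have : volume.real B = 2 * ρ := by
            rw [hB, Real.volume_real_Icc_of_le (by linarith)]; ring
          rw [setIntegral_const, this, smul_eq_mul]
          ring
  have hM₂0 : 0 ≤ M₂ := by
    have h1 := hM₂ ∅ (by simp) 0 5 0 (by simp) (by simp)
    simp only [Finset.sum_empty] at h1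
    exact nonneg_of_mul_nonneg_left h1 (bump_pos _ _)
  have hfine : ∀ F : Finset (ℤ × ℤ), (∀ I ∈ F, I.1 ≤ 0) →
      ∑ I ∈ F, |(∫ x, f x * wavelet w D I x) * ∫ x, h x * wavelet w D I x| ≤
        (∫ x, |f x|) * (A * M₂ * bumpTail (r - s) ρ) := by
    intro F hF
    have hγ : ∀ I ∈ F, |∫ x, h x * wavelet w D I x| ≤
        ∫ y in Bᶜ, |H y| * |wavelet w D I y| := by
      intro I hI
      -- `J` is long and `I` is not, so orthogonality and mean zero annihilate the full integral.
      -- The coefficient of `h` is therefore minus the integral over `Bᶜ`, far from the support of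
      -- `f`.
      have h0 : ∫ y, H y * wavelet w D I y = 0 := by
        simp only [hH, sub_mul]
        have h2 : Integrable fun x => wavelet w D J x * wavelet w D I x :=
          (hW2 J).integrable_mul (hW2 I)
        rw [integral_sub h2 ((hW1 I).const_mul _), integral_const_mul,
          integral_wavelet D I hmean, hb.integral_mul_eq_zero]
        · simp
        · rintro rfl
          have := hF J hI
          omega
      have h1 := integral_add_compl hBm (hHI I)
      rw [hhI, show (∫ y in B, H y * wavelet w D I y) = -∫ y in Bᶜ, H y * wavelet w D I y by
        linarith, abs_neg]
      simp_rw [← abs_mul]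
      exact abs_integral_le_integral_abs
    have hfI : ∀ I, Integrable fun x => |f x| * |wavelet w D I x| := fun I => by
      simp_rw [← abs_mul]
      exact (hf2.integrable_mul (hW2 I)).abs
    have hHI' : ∀ I, IntegrableOn (fun y => |H y| * |wavelet w D I y|) Bᶜ := fun I => by
      simp_rw [← abs_mul]
      exact (hHI I).abs.integrableOn
    calc _ ≤ ∑ I ∈ F, (∫ x, |f x| * |wavelet w D I x|) * ∫ y in Bᶜ, |H y| * |wavelet w D I y| := by
          refine Finset.sum_le_sum fun I hI => ?_
          rw [abs_mul]
          have h2 : |∫ x, f x * wavelet w D I x| ≤ ∫ x, |f x| * |wavelet w D I x| := by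
            simp_rw [← abs_mul]
            exact abs_integral_le_integral_abs
          exact mul_le_mul h2 (hγ I hI) (abs_nonneg _) (integral_nonneg fun x => by positivity)
      _ = ∫ x, |f x| * ∑ I ∈ F, |wavelet w D I x| * ∫ y in Bᶜ, |H y| * |wavelet w D I y| := by
          simp_rw [Finset.mul_sum, ← integral_mul_const]
          rw [← integral_finsetSum]
          · simp_rw [mul_assoc]
          · intro I _
            exact (hfI I).mul_const _
      _ ≤ ∫ x, |f x| * (A * M₂ * bumpTail (r - s) ρ) := by
          refine integral_mono ?_ (hf1.abs.mul_const _) fun x => ?_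
          · simp_rw [Finset.mul_sum, ← mul_assoc]
            exact integrable_finsetSum _ fun I _ => (hfI I).mul_const _
          · by_cases hx : 2 < |x - z|
            · simp [hfz x hx]
            refine mul_le_mul_of_nonneg_left ?_ (abs_nonneg _)
            simp_rw [← integral_const_mul]
            rw [← integral_finsetSum _ fun I _ => (hHI' I).const_mul _,
              ← setIntegral_bump_sub (r - s) ρ z, ← integral_const_mul]
            refine setIntegral_mono_on (integrable_finsetSum _ fun I _ => (hHI' I).const_mul _)
              ((((integrable_bump hs1).comp_sub_right z).const_mul _).integrableOn) hBm.compl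
              fun y hy => ?_
            have h3 := hM₂ F hF x y z (not_lt.1 hx) (hBfar y hy)
            have h4 : (1 + |y - z|) ^ s * bump r (y - z) = bump (r - s) (y - z) := by
              unfold bump
              rw [← Real.rpow_add (by positivity)]
              ring_nf
            calc _ = |H y| * ∑ I ∈ F, |wavelet w D I x| * |wavelet w D I y| := by
                  rw [Finset.mul_sum]
                  exact Finset.sum_congr rfl fun I _ => by ring
              _ ≤ (A * (1 + |y - z|) ^ s) * (M₂ * bump r (y - z)) :=
                  mul_le_mul (hA y) h3 (Finset.sum_nonneg fun I _ => by positivity)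
                    (by positivity)
              _ = _ := by rw [← h4]; ring
      _ = _ := integral_mul_const _ _
  have hsum := hb.hasSum_integral_mul hf2 hh2
  rw [hfh] at hsum
  refine le_of_tendsto hsum.norm (Filter.Eventually.of_forall fun F => ?_)
  refine (norm_sum_le _ _).trans ?_
  simp_rw [Real.norm_eq_abs]
  rw [← Finset.sum_filter_add_sum_filter_not F (fun I => 1 ≤ I.1)]
  refine add_le_add (hcoarse _ fun I hI => (Finset.mem_filter.1 hI).2) (hfine _ fun I hI => ?_)
  have := (Finset.mem_filter.1 hI).2
  omega

lemma tendsto_zero_of_le_bump (hr : 1 < r) (hw : ∀ x, |w x| ≤ C * bump r x) :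
    Filter.Tendsto w (Filter.cocompact ℝ) (nhds 0) := by
  have h1 : Filter.Tendsto (fun x : ℝ => bump r x) (Filter.cocompact ℝ) (nhds 0) := by
    have h2 : Filter.Tendsto (fun x : ℝ => 1 + |x|) (Filter.cocompact ℝ) Filter.atTop :=
      Filter.tendsto_atTop_add_const_left _ _ (tendsto_norm_cocompact_atTop (E := ℝ))
    exact (tendsto_rpow_neg_atTop (by linarith : 0 < r)).comp h2
  refine squeeze_zero_norm hw ?_
  simpa using h1.const_mul C

end Holder

/-- The difference of the indicators of two translates of `(0, ε]`. -/
noncomputable def indicatorDiff (z z' ε : ℝ) (x : ℝ) : ℝ :=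
  (Set.Ioc z (z + ε)).indicator (fun _ => (1 : ℝ)) x -
    (Set.Ioc z' (z' + ε)).indicator (fun _ => (1 : ℝ)) x

lemma memLp_indicatorDiff (z z' ε : ℝ) (p : ℝ≥0∞) : MemLp (indicatorDiff z z' ε) p := by
  refine MemLp.sub ?_ ?_ <;>
    exact memLp_indicator_const p measurableSet_Ioc 1 (Or.inr measure_Ioc_lt_top.ne)

/-- Dividing by `ε` and letting `ε` tend to `0` recovers `g z - g z'`; thus `indicatorDiff` is a
square-integrable, mean-zero substitute for a difference of point masses. -/
lemma integral_indicatorDiff_mul {g : ℝ → ℝ} (hg : Continuous g) (z z' : ℝ) {ε : ℝ}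
    (hε : 0 ≤ ε) :
    ∫ x, indicatorDiff z z' ε x * g x = ∫ t in (0 : ℝ)..ε, (g (z + t) - g (z' + t)) := by
  have h1 : ∀ c x, (Set.Ioc c (c + ε)).indicator (fun _ => (1 : ℝ)) x * g x =
      (Set.Ioc c (c + ε)).indicator g x := fun c x => by
    by_cases hx : x ∈ Set.Ioc c (c + ε) <;> simp [hx]
  have h2 : ∀ c, Integrable ((Set.Ioc c (c + ε)).indicator g) := fun c =>
    (integrable_indicator_iff measurableSet_Ioc).2
      ((hg.integrableOn_Icc).mono_set Set.Ioc_subset_Icc_self)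
  have h3 : ∀ c, ∫ x, (Set.Ioc c (c + ε)).indicator g x = ∫ t in (0 : ℝ)..ε, g (c + t) := by
    intro c
    rw [integral_indicator measurableSet_Ioc, intervalIntegral.integral_comp_add_left, add_zero,
      intervalIntegral.integral_of_le (by linarith)]
  unfold indicatorDiff
  simp_rw [sub_mul, h1]
  rw [integral_sub (h2 z) (h2 z'), h3, h3, ← intervalIntegral.integral_sub]
  · exact (by fun_prop : Continuous fun t => g (z + t)).intervalIntegrable _ _
  · exact (by fun_prop : Continuous fun t => g (z' + t)).intervalIntegrable _ _

lemma integral_indicatorDiff (z z' : ℝ) {ε : ℝ} (hε : 0 ≤ ε) :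
    ∫ x, indicatorDiff z z' ε x = 0 := by
  simpa using integral_indicatorDiff_mul (g := fun _ => 1) continuous_const z z' hε

lemma integral_abs_indicatorDiff_le (z z' : ℝ) {ε : ℝ} (hε : 0 ≤ ε) :
    ∫ x, |indicatorDiff z z' ε x| ≤ 2 * ε := by
  have h2 : ∀ c, Integrable ((Set.Ioc c (c + ε)).indicator fun _ => (1 : ℝ)) := fun c =>
    (integrable_indicator_iff measurableSet_Ioc).2 (by simp)
  have h3 : ∀ c, ∫ x, (Set.Ioc c (c + ε)).indicator (fun _ => (1 : ℝ)) x = ε := fun c => by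
    rw [integral_indicator measurableSet_Ioc]
    simp [hε]
  calc _ ≤ ∫ x, ((Set.Ioc z (z + ε)).indicator (fun _ => (1 : ℝ)) x +
        (Set.Ioc z' (z' + ε)).indicator (fun _ => (1 : ℝ)) x) := by
        refine integral_mono (memLp_one_iff_integrable.1 (memLp_indicatorDiff z z' ε 1)).abs
          ((h2 z).add (h2 z')) fun x => ?_
        refine (abs_sub _ _).trans (le_of_eq ?_)
        rw [abs_of_nonneg, abs_of_nonneg] <;> exact Set.indicator_nonneg (fun _ _ => zero_le_one) _
    _ = _ := by rw [integral_add (h2 z) (h2 z'), h3, h3]; ring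

lemma indicatorDiff_eq_zero {z z' ε x : ℝ} (hε : ε ≤ 1) (hz : |z - z'| ≤ 1)
    (hx : 2 < |x - z|) : indicatorDiff z z' ε x = 0 := by
  have hz := abs_le.1 hz
  unfold indicatorDiff
  rw [Set.indicator_of_notMem, Set.indicator_of_notMem, sub_zero]
  · rintro ⟨h1, h2⟩
    exact hx.not_ge (abs_le.2 ⟨by linarith, by linarith⟩)
  · rintro ⟨h1, h2⟩
    exact hx.not_ge (abs_le.2 ⟨by linarith, by linarith⟩)

/-- The averages over `(0, ε]` converge to `φ 0` by continuity. -/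
lemma abs_le_of_integral_le {φ : ℝ → ℝ} (hφ : Continuous φ) {b : ℝ}
    (h : ∀ ε, 0 < ε → ε ≤ 1 → |∫ t in (0 : ℝ)..ε, φ t| ≤ ε * b) : |φ 0| ≤ b := by
  refine le_of_forall_pos_le_add fun e he => ?_
  obtain ⟨δ, hδ, hδe⟩ := Metric.continuous_iff.1 hφ 0 e he
  set ε := min 1 (δ / 2) with hε
  have hε0 : 0 < ε := by positivity
  have hεδ : ε < δ := (min_le_right _ _).trans_lt (by linarith)
  have h1 := h ε hε0 (min_le_left _ _)
  have h2 : |∫ t in (0 : ℝ)..ε, (φ 0 - φ t)| ≤ e * |ε - 0| := by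
    refine intervalIntegral.norm_integral_le_of_norm_le_const (f := fun t => φ 0 - φ t) fun t ht => ?_
    rw [Set.uIoc_of_le hε0.le] at ht
    have := hδe t (by rw [Real.dist_eq, sub_zero, abs_of_pos ht.1]; linarith [ht.2])
    rw [Real.dist_eq, abs_sub_comm] at this
    exact this.le
  rw [intervalIntegral.integral_sub (by simp) (hφ.intervalIntegrable _ _)] at h2
  simp only [intervalIntegral.integral_const, sub_zero, smul_eq_mul, abs_of_pos hε0] at h2
  have h3 : ε * |φ 0| ≤ ε * (b + e) := by
    calc ε * |φ 0| = |ε * φ 0| := by rw [abs_mul, abs_of_pos hε0]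
      _ = |(ε * φ 0 - ∫ t in (0 : ℝ)..ε, φ t) + ∫ t in (0 : ℝ)..ε, φ t| := by ring_nf
      _ ≤ e * ε + ε * b := (abs_add_le _ _).trans (add_le_add h2 h1)
      _ = _ := by ring
  exact le_of_mul_le_mul_left h3 hε0

section Holder

variable {w : ℝ → ℝ} {D : DyadicGrid} {C r s : ℝ}

/-- Passing to a much finer scale halves the oscillation of a wavelet. -/
lemma exists_osc_improvement (hr : 1 < r) (hc : Continuous w)
    (hw : ∀ x, |w x| ≤ C * bump r x) (hb : IsL2OrthonormalBasis (wavelet w D))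
    (hs1 : 1 < r - s) (hs0 : 0 < s) :
    ∃ n : ℕ, 1 ≤ n ∧ ∀ m : ℕ, 1 ≤ m → ∀ A : ℝ, (∀ x y, |w x - w y| ≤ A * (1 + 2 ^ m * |x - y|) ^ s) →
      ∀ x x', |x - x'| ≤ (1 / 2) ^ (m + n) → |w x - w x'| ≤ A / 2 := by
  obtain ⟨M₁, hM₁0, hM₁⟩ := exists_sum_coarse_le hr hw D
  obtain ⟨M₂, hM₂0, hM₂⟩ := exists_sum_fine_le hr hw D
  -- The choices of `ρ` and then `ω` make the short and the long intervals contribute at most a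
  -- quarter of `ε * (N * A)` each.
  obtain ⟨ρ, hρ, hρt⟩ := exists_bumpTail_lt hs1 (ε := 1 / (8 * M₂)) (by positivity)
  have huc := hc.uniformContinuous_of_tendsto_cocompact (tendsto_zero_of_le_bump hr hw)
  set ω := 1 / (4 * (M₁ * (2 * ρ * (1 + ρ) ^ s))) with hω
  have hρs : 0 < (1 + ρ) ^ s := Real.rpow_pos_of_pos (by linarith) _
  have hρ0 : 0 < ρ := by linarith
  have hω0 : 0 < ω := by positivity
  obtain ⟨δ, hδ, hδω⟩ := Metric.uniformContinuous_iff.1 huc ω hω0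
  obtain ⟨n, hn⟩ := exists_pow_lt_of_lt_one hδ (by norm_num : (1 / 2 : ℝ) < 1)
  -- The shift keeps the gap in scales positive, so that the induction in `exists_holder` descends.
  replace hn : (1 / 2 : ℝ) ^ (n + 1) < δ :=
    (pow_le_pow_of_le_one (by norm_num) (by norm_num) n.le_succ).trans_lt hn
  generalize hn' : n + 1 = n' at hn
  refine ⟨n', by omega, fun m hm A hA x x' hxx' => ?_⟩
  -- Stretching by `2 ^ m` turns oscillation of `w` at scale `2 ^ (-m)` into oscillation of a long
  -- wavelet at unit scale, where the estimates do not depend on `m`.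
  set J : ℤ × ℤ := ((m : ℤ), 0) with hJ
  have hL : D.length J = 2 ^ m := by rw [hJ, D.length_mk, zpow_natCast]
  have hL0 : (0 : ℝ) < 2 ^ m := by positivity
  set N := D.length J ^ (-(1 / 2) : ℝ) with hN
  have hN0 : 0 < N := D.length_rpow_pos J
  have hA0 : 0 ≤ A := by
    have := (abs_nonneg _).trans (hA 0 0)
    simpa using this
  set z := D.center J + 2 ^ m * x with hz
  set z' := D.center J + 2 ^ m * x' with hz'
  have hzz : |z - z'| ≤ (1 / 2) ^ n' := by
    have : z - z' = 2 ^ m * (x - x') := by rw [hz, hz']; ring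
    rw [this, abs_mul, abs_of_pos hL0]
    calc _ ≤ 2 ^ m * (1 / 2 : ℝ) ^ (m + n') := by gcongr
      _ = _ := by rw [pow_add, ← mul_assoc, ← mul_pow]; norm_num
  have hzz1 : |z - z'| ≤ 1 := hzz.trans (pow_le_one₀ (by norm_num) (by norm_num))
  have hval : ∀ y t, wavelet w D J (D.center J + 2 ^ m * y + t) = N * w (y + t / 2 ^ m) := by
    intro y t
    rw [wavelet, ← hN, hL]
    congr 2
    field_simp
    ring
  have hWc : ∀ I, Continuous (wavelet w D I) := fun I => continuous_wavelet D I hc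
  have key := abs_le_of_integral_le (φ := fun t => wavelet w D J (z + t) - wavelet w D J (z' + t))
    (b := N * A / 2) (by have := hWc J; fun_prop) ?_
  · simp only [hz, hz', hval, zero_div, add_zero x, add_zero x', ← mul_sub, abs_mul,
      abs_of_pos hN0, mul_div_assoc] at key
    exact le_of_mul_le_mul_left key hN0
  intro ε hε0 hε1
  rw [← integral_indicatorDiff_mul (hWc J) z z' hε0.le]
  have hmain := abs_integral_mul_coarse_le hr hc hw hb hs1 hs0 hM₁ hM₂
    (memLp_indicatorDiff z z' ε 2) (memLp_one_iff_integrable.1 (memLp_indicatorDiff z z' ε 1))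
    (integral_indicatorDiff z z' hε0.le) (fun x hx => indicatorDiff_eq_zero hε1 hzz1 hx)
    (J := J) (by simpa [hJ] using hm) (A := N * A) (fun y => ?_) (a := ε * ω)
    (fun I hI => ?_) hρ
  · refine hmain.trans ?_
    have h1 := integral_abs_indicatorDiff_le z z' hε0.le
    have h2 := bumpTail_nonneg (r - s) ρ
    have h3 : ε * ω * M₁ * (2 * ρ * (N * A * (1 + ρ) ^ s)) = ε * (N * A) / 4 := by
      rw [hω]
      field_simp
    have h4 : (∫ x, |indicatorDiff z z' ε x|) * (N * A * M₂ * bumpTail (r - s) ρ) ≤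
        ε * (N * A) / 4 := by
      calc _ ≤ 2 * ε * (N * A * M₂ * (1 / (8 * M₂))) := by gcongr
        _ = _ := by field_simp; ring
    rw [h3]
    linarith
  · have e : ∀ y, wavelet w D J y = N * w ((y - D.center J) / 2 ^ m) := fun y => by
      rw [wavelet, ← hN, hL]
    rw [e, e, ← mul_sub, abs_mul, abs_of_pos hN0, mul_assoc]
    refine mul_le_mul_of_nonneg_left ((hA _ _).trans (le_of_eq ?_)) hN0.le
    congr 3
    rw [← abs_of_pos hL0, ← abs_mul, abs_of_pos hL0]
    congr 1
    field_simp
    ring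
  · rw [integral_indicatorDiff_mul (hWc I) z z' hε0.le]
    have hI0 := D.length_pos I
    have hI1 : 1 ≤ D.length I :=
      one_le_zpow₀ (by norm_num) (by omega)
    have : ∀ t ∈ Set.uIoc 0 ε, ‖wavelet w D I (z + t) - wavelet w D I (z' + t)‖ ≤
        D.length I ^ (-(1 / 2) : ℝ) * ω := by
      intro t _
      unfold wavelet
      rw [← mul_sub, Real.norm_eq_abs, abs_mul, abs_of_pos (D.length_rpow_pos I)]
      refine mul_le_mul_of_nonneg_left ?_ (D.length_rpow_pos I).le
      refine (hδω ?_).le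
      rw [Real.dist_eq]
      have e : (z + t - D.center I) / D.length I - (z' + t - D.center I) / D.length I =
          (z - z') / D.length I := by ring
      rw [e, abs_div, abs_of_pos hI0]
      calc _ ≤ |z - z'| := div_le_self (abs_nonneg _) hI1
        _ < δ := hzz.trans_lt hn
    refine (intervalIntegral.norm_integral_le_of_norm_le_const this).trans (le_of_eq ?_)
    rw [sub_zero, abs_of_pos hε0]
    ring

/-- A continuous wavelet with integrable decay is Hölder continuous. -/
theorem exists_holder (hr : 1 < r) (hc : Continuous w)
    (hw : ∀ x, |w x| ≤ C * bump r x) (hb : IsL2OrthonormalBasis (wavelet w D)) :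
    ∃ s A : ℝ, 0 < s ∧ 0 < A ∧ ∀ x y, |w x - w y| ≤ A * |x - y| ^ s := by
  have hC : 0 ≤ C := by simpa [bump] using (abs_nonneg _).trans (hw 0)
  have hwC : ∀ x, |w x| ≤ C := fun x => (hw x).trans
    (mul_le_of_le_one_right hC (bump_le_one (by linarith) x))
  set s₁ := (r - 1) / 2 with hs₁
  have hs₁0 : 0 < s₁ := by linarith
  obtain ⟨n, hn1, hn⟩ := exists_osc_improvement hr hc hw hb (s := s₁) (by linarith) hs₁0
  -- Small enough that one gain of `1/2` pays for the `n` scales it costs and for the constant `2 ^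
  -- s`: `2 ^ (s * (n + 1)) ≤ 2`.
  set s := min s₁ (1 / (n + 1)) with hs
  have hs0 : 0 < s := by positivity
  have hss : s ≤ s₁ := min_le_left _ _
  have hsn : s * (n + 1) ≤ 1 := by
    have : s ≤ 1 / (n + 1) := min_le_right _ _
    rwa [le_div_iff₀ (by positivity)] at this
  have h2pos : (0 : ℝ) < (2 : ℝ) ^ s := by positivity
  have h2one : 1 ≤ (2 : ℝ) ^ s := Real.one_le_rpow (by norm_num) hs0.le
  have h2n : (2 : ℝ) ^ (s * (n + 1)) ≤ 2 := by
    calc (2 : ℝ) ^ (s * (n + 1)) ≤ 2 ^ (1 : ℝ) :=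
          Real.rpow_le_rpow_of_exponent_le (by norm_num) hsn
      _ = 2 := by simp
  set A₀ := 4 * (C + 1) with hA₀
  have hA₀0 : 0 < A₀ := by positivity
  have hosc : ∀ x y, |w x - w y| ≤ A₀ / 2 := fun x y => by
    have h1 := hwC x
    have h2 := hwC y
    have h3 := abs_sub (w x) (w y)
    linarith
  -- Hölder bounds at the scales before `M` give one for every pair at distance more than `2 ^
  -- (-M)`, with a loss of `2 ^ s`.
  have hnear : ∀ M : ℕ, (∀ i < M, ∀ x y, |x - y| ≤ (1 / 2) ^ i →
      |w x - w y| ≤ A₀ * ((1 / 2 : ℝ) ^ i) ^ s) → ∀ x y, (1 / 2) ^ M < |x - y| →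
      |w x - w y| ≤ A₀ * (2 * |x - y|) ^ s := by
    intro M hM x y hxy
    have hpos : 0 < |x - y| := lt_trans (by positivity) hxy
    rcases le_or_gt |x - y| 1 with h1 | h1
    · obtain ⟨i, hi1, hi2⟩ := exists_nat_pow_near_of_lt_one hpos h1
        (by norm_num : (0 : ℝ) < 1 / 2) (by norm_num)
      have hiM : i < M := by
        by_contra! hcon
        have := pow_le_pow_of_le_one (by norm_num : (0 : ℝ) ≤ 1 / 2) (by norm_num) hcon
        linarith
      refine (hM i hiM x y hi2).trans ?_
      gcongr
      rw [pow_succ] at hi1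
      linarith
    · refine (hosc x y).trans ?_
      have : 1 ≤ (2 * |x - y|) ^ s := Real.one_le_rpow (by linarith) hs0.le
      nlinarith
  have hall : ∀ M : ℕ, ∀ x y, |x - y| ≤ (1 / 2) ^ M → |w x - w y| ≤ A₀ * ((1 / 2 : ℝ) ^ M) ^ s := by
    intro M
    induction M using Nat.strong_induction_on with
    | _ M ih =>
      intro x y hxy
      have hhalf : ∀ k : ℕ, ((1 / 2 : ℝ) ^ k) ^ s = 2 ^ (-(s * k)) := fun k => by
        rw [one_div, inv_pow, Real.inv_rpow (by positivity), ← Real.rpow_natCast,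
          ← Real.rpow_mul (by norm_num), Real.rpow_neg (by norm_num), mul_comm]
      rcases le_or_gt M n with hMn | hMn
      · refine (hosc x y).trans ?_
        have : (1 / 2 : ℝ) ≤ ((1 / 2 : ℝ) ^ M) ^ s := by
          rw [hhalf, Real.rpow_neg (by norm_num), one_div]
          refine inv_anti₀ (by positivity) (le_trans ?_ h2n)
          refine Real.rpow_le_rpow_of_exponent_le (by norm_num) ?_
          have : (M : ℝ) ≤ n := by exact_mod_cast hMn
          gcongr
          linarith
        nlinarith
      · obtain ⟨m, rfl⟩ : ∃ m, M = m + n := ⟨M - n, by omega⟩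
        have hm : 1 ≤ m := by omega
        have h1 := hn m hm (A₀ * (2 : ℝ) ^ s * ((1 / 2 : ℝ) ^ m) ^ s) (fun x y => ?_) x y hxy
        · refine h1.trans ?_
          rw [hhalf, hhalf]
          have e1 : (2 : ℝ) ^ s * 2 ^ (-(s * m)) =
              2 ^ (s * (n + 1)) * 2 ^ (-(s * ((m + n : ℕ) : ℝ))) := by
            rw [← Real.rpow_add (by norm_num), ← Real.rpow_add (by norm_num)]
            push_cast
            ring_nf
          rw [mul_assoc, e1]
          have p : (0 : ℝ) < 2 ^ (-(s * ((m + n : ℕ) : ℝ))) := by positivity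
          calc _ ≤ A₀ * (2 * 2 ^ (-(s * ((m + n : ℕ) : ℝ)))) / 2 := by gcongr
            _ = _ := by ring
        · have hs_le : ∀ t : ℝ, 0 ≤ t → (1 + t) ^ s ≤ (1 + t) ^ s₁ := fun t ht =>
            Real.rpow_le_rpow_of_exponent_le (by linarith) hss
          have hp : 0 ≤ 2 ^ m * |x - y| := by positivity
          rcases le_or_gt |x - y| ((1 / 2) ^ m) with h | h
          · refine (ih m (by omega) x y h).trans ?_
            have h3 : 1 ≤ (1 + 2 ^ m * |x - y|) ^ s₁ := Real.one_le_rpow (by linarith) hs₁0.le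
            have h4 : (1 : ℝ) ≤ 2 ^ s * (1 + 2 ^ m * |x - y|) ^ s₁ := by nlinarith
            calc A₀ * ((1 / 2 : ℝ) ^ m) ^ s = A₀ * ((1 / 2 : ℝ) ^ m) ^ s * 1 := by ring
              _ ≤ A₀ * ((1 / 2 : ℝ) ^ m) ^ s * (2 ^ s * (1 + 2 ^ m * |x - y|) ^ s₁) := by gcongr
              _ = _ := by ring
          · refine (hnear m (fun i hi => ih i (by omega)) x y h).trans ?_
            have e2 : 2 * |x - y| = 2 * ((1 / 2) ^ m * (2 ^ m * |x - y|)) := by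
              rw [← mul_assoc ((1 / 2 : ℝ) ^ m), ← mul_pow]
              norm_num
            rw [e2, Real.mul_rpow (by norm_num) (by positivity),
              Real.mul_rpow (by positivity) (by positivity), ← mul_assoc, ← mul_assoc]
            refine mul_le_mul_of_nonneg_left (le_trans ?_ (hs_le _ hp)) (by positivity)
            gcongr
            linarith
  refine ⟨s, A₀ * 2 ^ s, hs0, by positivity, fun x y => ?_⟩
  rcases eq_or_ne x y with rfl | hxy
  · simp [Real.zero_rpow hs0.ne']
  · obtain ⟨M, hM⟩ := exists_pow_lt_of_lt_one (abs_pos.2 (sub_ne_zero.2 hxy))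
      (by norm_num : (1 / 2 : ℝ) < 1)
    have := hnear M (fun i _ => hall i) x y hM
    rwa [Real.mul_rpow (by norm_num) (abs_nonneg _), ← mul_assoc] at this

end Holder

/-! ### Interpolation and the splitting of the wavelet -/

/-- A minimum is at most any weighted geometric mean. This trades a little decay and regularity for
a power of a small supremum. -/
lemma le_rpow_mul_rpow_mul_rpow {m a b c θ : ℝ} (hm : 0 ≤ m) (ha : m ≤ a) (hb : m ≤ b)
    (hc : m ≤ c) (hθ : 0 < θ) (hθ2 : 2 * θ < 1) : m ≤ a ^ θ * b ^ θ * c ^ (1 - 2 * θ) := by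
  have e : m = m ^ θ * m ^ θ * m ^ (1 - 2 * θ) := by
    rw [← Real.rpow_add_of_nonneg hm hθ.le hθ.le,
      ← Real.rpow_add_of_nonneg hm (by linarith) (by linarith)]
    ring_nf
    simp
  have ha0 := hm.trans ha
  have hb0 := hm.trans hb
  calc m = m ^ θ * m ^ θ * m ^ (1 - 2 * θ) := e
    _ ≤ _ := by
      have : 0 ≤ 1 - 2 * θ := by linarith
      gcongr

/-- Interpolation between smallness, decay and Hölder regularity. -/
lemma isMolecule_of_bounds {r s P ε θ : ℝ} (hr : 1 < r) (hθ : 0 < θ) (hθ2 : 2 * θ < 1)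
    (hP : 0 ≤ P) (hε : 0 ≤ ε) {v : ℝ → ℝ} (h1 : ∀ x, |v x| ≤ P * ε)
    (h2 : ∀ x, |v x| ≤ P * bump r x) (h3 : ∀ x y, |v x - v y| ≤ P * |x - y| ^ s)
    (h4 : ∫ x, v x = 0) : IsMolecule (2 * P * ε ^ θ) (r * (1 - 2 * θ)) (s * θ) v := by
  have hsplit : ∀ a b : ℝ, 0 ≤ a → 0 ≤ b →
      (P * a) ^ θ * (P * ε) ^ θ * (P * b) ^ (1 - 2 * θ) =
        P * a ^ θ * ε ^ θ * b ^ (1 - 2 * θ) := fun a b ha hb => by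
    rw [Real.mul_rpow hP ha, Real.mul_rpow hP hε, Real.mul_rpow hP hb]
    have : P ^ θ * P ^ θ * P ^ (1 - 2 * θ) = P := by
      rw [← Real.rpow_add_of_nonneg hP hθ.le hθ.le,
        ← Real.rpow_add_of_nonneg hP (by linarith) (by linarith)]
      ring_nf
      simp
    calc _ = (P ^ θ * P ^ θ * P ^ (1 - 2 * θ)) * a ^ θ * ε ^ θ * b ^ (1 - 2 * θ) := by ring
      _ = _ := by rw [this]
  have hεθ : 0 ≤ ε ^ θ := by positivity
  refine ⟨fun x => ?_, fun x y => ?_, h4⟩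
  · have hb := bump_nonneg r x
    have hb1 := bump_le_one (q := r) (by linarith) x
    have h := le_rpow_mul_rpow_mul_rpow (abs_nonneg (v x)) ((h2 x).trans
      (mul_le_mul_of_nonneg_left hb1 hP)) (h1 x) (h2 x) hθ hθ2
    rw [hsplit 1 _ zero_le_one hb, Real.one_rpow, bump_rpow, mul_one] at h
    have := bump_nonneg (r * (1 - 2 * θ)) x
    calc _ ≤ _ := h
      _ ≤ _ := by gcongr; linarith
  · have hbx := bump_nonneg r x
    have hby := bump_nonneg r y
    have k2 : |v x - v y| ≤ 2 * P * ε := by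
      have := abs_sub (v x) (v y)
      linarith [h1 x, h1 y]
    have k3 : |v x - v y| ≤ P * (bump r x + bump r y) := by
      have := abs_sub (v x) (v y)
      linarith [h2 x, h2 y]
    -- Half the difference is used so that the supremum bound holds with `P * ε`; this is the source
    -- of the factor `2` in the constant.
    have h := le_rpow_mul_rpow_mul_rpow (m := |v x - v y| / 2) (by positivity)
      (a := P * |x - y| ^ s) (b := P * ε) (c := P * (bump r x + bump r y))
      (by linarith [h3 x y, abs_nonneg (v x - v y)]) (by linarith)
      (by linarith [abs_nonneg (v x - v y)]) hθ hθ2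
    rw [hsplit _ _ (by positivity) (by positivity), ← Real.rpow_mul (abs_nonneg _)] at h
    have h5 := Real.rpow_add_le_add_rpow hbx hby (p := 1 - 2 * θ) (by linarith) (by linarith)
    rw [bump_rpow, bump_rpow] at h5
    have p : 0 ≤ P * |x - y| ^ (s * θ) * ε ^ θ := by positivity
    calc |v x - v y| ≤ 2 * (P * |x - y| ^ (s * θ) * ε ^ θ *
          (bump r x + bump r y) ^ (1 - 2 * θ)) := by linarith
      _ ≤ 2 * (P * |x - y| ^ (s * θ) * ε ^ θ *
          (bump (r * (1 - 2 * θ)) x + bump (r * (1 - 2 * θ)) y)) := by gcongr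
      _ = _ := by ring

/-- Truncation of a real number to `[-κ, κ]`. -/
noncomputable def truncate (κ t : ℝ) : ℝ := max (-κ) (min t κ)

lemma abs_truncate_le {κ : ℝ} (hκ : 0 ≤ κ) (t : ℝ) : |truncate κ t| ≤ κ :=
  abs_le.2 ⟨le_max_left _ _, max_le (by linarith) (min_le_right _ _)⟩

lemma abs_truncate_le_abs {κ : ℝ} (hκ : 0 ≤ κ) (t : ℝ) : |truncate κ t| ≤ |t| := by
  unfold truncate
  refine abs_le.2 ⟨?_, max_le (by linarith [abs_nonneg t]) ((min_le_left _ _).trans (le_abs_self t))⟩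
  refine le_max_of_le_right (le_min (neg_abs_le t) (by linarith [abs_nonneg t]))

lemma truncate_of_abs_le {κ t : ℝ} (h : |t| ≤ κ) : truncate κ t = t := by
  have := abs_le.1 h
  rw [truncate, min_eq_left this.2, max_eq_right this.1]

lemma abs_truncate_sub_le (κ a b : ℝ) : |truncate κ a - truncate κ b| ≤ |a - b| := by
  unfold truncate
  rw [max_comm, max_comm (-κ)]
  exact (abs_max_sub_max_le_abs _ _ _).trans (by
    simpa using abs_min_sub_min_le_max a κ b κ)

lemma continuous_truncate (κ : ℝ) : Continuous (truncate κ) := by unfold truncate; fun_prop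

/-- A wavelet splits into a compactly supported part living where the wavelet is not small, and
a part with small supremum; both have mean zero and keep decay and regularity. -/
theorem exists_split {w : ℝ → ℝ} {C r s A : ℝ} (hr : 1 < r) (hc : Continuous w)
    (hw : ∀ x, |w x| ≤ C * bump r x) (hA : 0 < A) (hol : ∀ x y, |w x - w y| ≤ A * |x - y| ^ s)
    (hmean : ∫ x, w x = 0) (hne : ∃ x, w x ≠ 0) :
    ∃ P : ℝ, 0 < P ∧ ∀ ε : ℝ, 0 < ε → ε ≤ 1 → ∃ (κ K : ℝ) (u v : ℝ → ℝ), 0 < κ ∧ 0 ≤ K ∧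
      (∀ x, w x = u x + v x) ∧ (∀ x, u x ≠ 0 → κ ≤ |w x| ∧ |x| ≤ K) ∧
      (∀ x, |u x| ≤ P * bump r x) ∧ (∀ x y, |u x - u y| ≤ P * |x - y| ^ s) ∧ (∫ x, u x = 0) ∧
      (∀ x, |v x| ≤ P * ε) ∧
      (∀ x, |v x| ≤ P * bump r x) ∧ (∀ x y, |v x - v y| ≤ P * |x - y| ^ s) ∧ (∫ x, v x = 0) := by
  have hC : 0 ≤ C := by simpa [bump] using (abs_nonneg _).trans (hw 0)
  have hwC : ∀ x, |w x| ≤ C := fun x => (hw x).trans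
    (mul_le_of_le_one_right hC (bump_le_one (by linarith) x))
  have hwi := integrable_of_le_bump hc hr hw
  obtain ⟨x₀, hx₀⟩ := hne
  set κ₀ := |w x₀| / 2 with hκ₀
  have hκ₀0 : 0 < κ₀ := by have := abs_pos.2 hx₀; positivity
  -- A fixed, compactly supported bump living where `|w| ≥ κ₀`. A small multiple of it moves mean
  -- between the two parts without enlarging the set where `u` may be nonzero.
  set ψ : ℝ → ℝ := fun x => max (|w x| - κ₀) 0 with hψ
  have hψc : Continuous ψ := by fun_prop
  have hψ0 : ∀ x, 0 ≤ ψ x := fun x => le_max_right _ _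
  have hψw : ∀ x, ψ x ≤ |w x| := fun x => max_le (by linarith) (abs_nonneg _)
  have hψa : ∀ x, |ψ x| ≤ C * bump r x := fun x => by
    rw [abs_of_nonneg (hψ0 x)]; exact (hψw x).trans (hw x)
  have hψi := integrable_of_le_bump hψc hr hψa
  have hψh : ∀ x y, |ψ x - ψ y| ≤ |w x - w y| := fun x y => by
    refine (abs_max_sub_max_le_abs _ _ _).trans ?_
    rw [sub_sub_sub_cancel_right]
    exact abs_abs_sub_abs_le _ _
  set Ψ := ∫ x, ψ x with hΨ
  have hΨ0 : 0 < Ψ := by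
    refine (hψc.integral_pos_of_hasCompactSupport_nonneg_nonzero ?_ hψ0 (x := x₀) ?_)
    · rw [hasCompactSupport_iff_eventuallyEq]
      have := (tendsto_zero_of_le_bump hr hw).norm
      rw [norm_zero] at this
      rw [Filter.EventuallyEq, Filter.coclosedCompact_eq_cocompact]
      filter_upwards [this.eventually (gt_mem_nhds hκ₀0)] with x hx
      rw [Real.norm_eq_abs] at hx
      simp only [hψ, Pi.zero_apply]
      exact max_eq_right (by linarith)
    · simp only [hψ]
      have := abs_pos.2 hx₀
      exact (lt_max_of_lt_left (by rw [hκ₀]; linarith)).ne'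
  -- Then `r * (1 - 2 * θ) = (r + 1) / 2 > 1`, so the interpolated weight is still integrable.
  set θ := (r - 1) / (4 * r) with hθ
  have hθ0 : 0 < θ := by
    have : 0 < r - 1 := by linarith
    positivity
  have hθ1 : 2 * θ < 1 := by
    rw [hθ, mul_div_assoc', div_lt_one (by linarith)]; linarith
  have hq : 1 < r * (1 - 2 * θ) := by
    have : r * (1 - 2 * θ) = (r + 1) / 2 := by rw [hθ]; field_simp; ring
    rw [this]; linarith
  set R := ∫ x, bump (r * (1 - 2 * θ)) x with hR
  have hR0 : 0 < R := integral_bump_pos hq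
  set Q := (C + 1) * R / Ψ with hQ
  have hQ0 : 0 < Q := by positivity
  refine ⟨(1 + Q) * (C + 1) + (2 + Q) * A, by positivity, fun ε hε hε1 => ?_⟩
  set P := (1 + Q) * (C + 1) + (2 + Q) * A with hP
  -- The three bounds make `ψ` vanish where `|w| < κ`, make the truncation at most `ε`, and make its
  -- integral `O(ε)` through `κ ^ θ ≤ ε`.
  set κ := min κ₀ (min ε (ε ^ (1 / θ))) with hκ
  have hκ0 : 0 < κ := by positivity
  have hκκ₀ : κ ≤ κ₀ := min_le_left _ _
  have hκε : κ ≤ ε := (min_le_right _ _).trans (min_le_left _ _)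
  have hκθ : κ ^ θ ≤ ε := by
    calc κ ^ θ ≤ (ε ^ (1 / θ)) ^ θ := by
          gcongr; exact (min_le_right _ _).trans (min_le_right _ _)
      _ = ε := by rw [← Real.rpow_mul hε.le, one_div_mul_cancel hθ0.ne', Real.rpow_one]
  set τ : ℝ → ℝ := fun x => truncate κ (w x) with hτ
  have hτc : Continuous τ := (continuous_truncate κ).comp hc
  have hτw : ∀ x, |τ x| ≤ |w x| := fun x => abs_truncate_le_abs hκ0.le _
  have hτκ : ∀ x, |τ x| ≤ κ := fun x => abs_truncate_le hκ0.le _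
  have hτb : ∀ x, |τ x| ≤ C * bump r x := fun x => (hτw x).trans (hw x)
  have hτi := integrable_of_le_bump hτc hr hτb
  have hτint : |∫ x, τ x| ≤ (C + 1) * R * ε := by
    have h1 : ∀ x, |τ x| ≤ (C + 1) * ε * bump (r * (1 - 2 * θ)) x := fun x => by
      have hb := bump_nonneg r x
      have h := le_rpow_mul_rpow_mul_rpow (abs_nonneg (τ x)) (a := C + 1) (b := κ)
        (c := (C + 1) * bump r x)
        (by linarith [hτw x, hwC x]) (hτκ x) (by linarith [hτb x]) hθ0 hθ1
      rw [Real.mul_rpow (by positivity) hb, bump_rpow] at h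
      have h2 : (C + 1) ^ θ * (C + 1) ^ (1 - 2 * θ) ≤ C + 1 := by
        rw [← Real.rpow_add (by positivity)]
        calc (C + 1) ^ (θ + (1 - 2 * θ)) ≤ (C + 1) ^ (1 : ℝ) :=
              Real.rpow_le_rpow_of_exponent_le (by linarith) (by linarith)
          _ = C + 1 := Real.rpow_one _
      have hb' := bump_nonneg (r * (1 - 2 * θ)) x
      calc _ ≤ _ := h
        _ = ((C + 1) ^ θ * (C + 1) ^ (1 - 2 * θ)) * κ ^ θ * bump (r * (1 - 2 * θ)) x := by ring
        _ ≤ _ := by gcongr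
    calc |∫ x, τ x| ≤ ∫ x, (C + 1) * ε * bump (r * (1 - 2 * θ)) x :=
          norm_integral_le_of_norm_le (f := τ) ((integrable_bump hq).const_mul _)
            (Filter.Eventually.of_forall h1)
      _ = _ := by rw [integral_const_mul]; ring
  -- The multiple of `ψ` with the same integral as `τ`; it is `O(ε)`, so subtracting it keeps `v`
  -- small.
  set c := (∫ x, τ x) / Ψ with hcdef
  have hcε : |c| ≤ Q * ε := by
    rw [hcdef, abs_div, abs_of_pos hΨ0, div_le_iff₀ hΨ0, hQ]
    refine hτint.trans (le_of_eq ?_)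
    field_simp
  have hcQ : |c| ≤ Q := hcε.trans (mul_le_of_le_one_right hQ0.le hε1)
  have hτh : ∀ x y, |τ x - τ y| ≤ |w x - w y| := fun x y => abs_truncate_sub_le _ _ _
  obtain ⟨K, hK0, hK⟩ : ∃ K : ℝ, 0 ≤ K ∧ ∀ x, κ ≤ |w x| → |x| ≤ K := by
    have h1 := (tendsto_zero_of_le_bump hr hw).norm
    rw [norm_zero] at h1
    have h2 := h1.eventually (gt_mem_nhds hκ0)
    rw [← Metric.cobounded_eq_cocompact, ← comap_norm_atTop, Filter.eventually_comap] at h2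
    obtain ⟨K, hK⟩ := Filter.eventually_atTop.1 h2
    refine ⟨max K 0, le_max_right _ _, fun x hx => ?_⟩
    by_contra! hcon
    exact (hK |x| ((le_max_left _ _).trans hcon.le) x rfl).not_ge hx
  refine ⟨κ, K, fun x => w x - τ x + c * ψ x, fun x => τ x - c * ψ x, hκ0, hK0,
    fun x => by ring, fun x hx => ?_, fun x => ?_, fun x y => ?_, ?_, fun x => ?_, fun x => ?_,
    fun x y => ?_, ?_⟩
  · have : κ ≤ |w x| := by
      by_contra! hlt
      refine hx ?_
      have h1 : τ x = w x := truncate_of_abs_le hlt.le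
      have h2 : ψ x = 0 := max_eq_right (by linarith)
      simp only [h1, h2]; ring
    exact ⟨this, hK x this⟩
  · have hb := bump_nonneg r x
    have h1 : |w x - τ x| ≤ |w x| := by
      simp only [hτ, truncate]
      rcases le_total (w x) κ with h | h
      · rw [min_eq_left h]
        rcases le_total (-κ) (w x) with h' | h'
        · simp [max_eq_right h']
        · rw [max_eq_left h', abs_of_nonpos (by linarith), abs_of_nonpos (by linarith)]
          linarith
      · rw [min_eq_right h, max_eq_right (by linarith), abs_of_nonneg (by linarith),
          abs_of_nonneg (by linarith)]
        linarith
    calc |w x - τ x + c * ψ x| ≤ |w x - τ x| + |c| * |ψ x| := by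
          rw [← abs_mul]; exact abs_add_le _ _
      _ ≤ C * bump r x + Q * (C * bump r x) :=
          add_le_add (h1.trans (hw x)) (mul_le_mul hcQ (hψa x) (abs_nonneg _) hQ0.le)
      _ = ((1 + Q) * C) * bump r x := by ring
      _ ≤ P * bump r x := by
          gcongr
          rw [hP]
          nlinarith
  · have hxy : 0 ≤ |x - y| ^ s := by positivity
    calc |w x - τ x + c * ψ x - (w y - τ y + c * ψ y)|
        = |(w x - w y) - (τ x - τ y) + c * (ψ x - ψ y)| := by ring_nf
      _ ≤ |w x - w y| + |τ x - τ y| + |c| * |ψ x - ψ y| := by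
          rw [← abs_mul]
          exact (abs_add_le _ _).trans (by gcongr; exact abs_sub _ _)
      _ ≤ |w x - w y| + |w x - w y| + Q * |w x - w y| :=
          add_le_add (add_le_add le_rfl (hτh x y))
            (mul_le_mul hcQ (hψh x y) (abs_nonneg _) hQ0.le)
      _ = (2 + Q) * |w x - w y| := by ring
      _ ≤ (2 + Q) * (A * |x - y| ^ s) := by gcongr; exact hol x y
      _ ≤ P * |x - y| ^ s := by
          rw [← mul_assoc]
          gcongr
          rw [hP]
          nlinarith
  · have h1 : Integrable fun x => w x - τ x := hwi.sub hτi
    rw [integral_add h1 (hψi.const_mul c), integral_sub hwi hτi, integral_const_mul, hmean, ← hΨ,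
      hcdef, div_mul_cancel₀ _ hΨ0.ne']
    ring
  · calc |τ x - c * ψ x| ≤ |τ x| + |c| * |ψ x| := by rw [← abs_mul]; exact abs_sub _ _
      _ ≤ ε + Q * ε * C := by
          refine add_le_add ((hτκ x).trans hκε) (mul_le_mul hcε ?_ (abs_nonneg _) (by positivity))
          rw [abs_of_nonneg (hψ0 x)]
          exact (hψw x).trans (hwC x)
      _ = (1 + Q * C) * ε := by ring
      _ ≤ P * ε := by
          gcongr
          rw [hP]
          nlinarith [mul_pos hQ0 hA]
  · have hb := bump_nonneg r x
    calc |τ x - c * ψ x| ≤ |τ x| + |c| * |ψ x| := by rw [← abs_mul]; exact abs_sub _ _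
      _ ≤ C * bump r x + Q * (C * bump r x) :=
          add_le_add (hτb x) (mul_le_mul hcQ (hψa x) (abs_nonneg _) hQ0.le)
      _ = ((1 + Q) * C) * bump r x := by ring
      _ ≤ P * bump r x := by
          gcongr
          rw [hP]
          nlinarith
  · have hxy : 0 ≤ |x - y| ^ s := by positivity
    calc |τ x - c * ψ x - (τ y - c * ψ y)|
        = |(τ x - τ y) - c * (ψ x - ψ y)| := by ring_nf
      _ ≤ |τ x - τ y| + |c| * |ψ x - ψ y| := by
          rw [← abs_mul]
          exact abs_sub _ _
      _ ≤ |w x - w y| + Q * |w x - w y| :=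
          add_le_add (hτh x y) (mul_le_mul hcQ (hψh x y) (abs_nonneg _) hQ0.le)
      _ = (1 + Q) * |w x - w y| := by ring
      _ ≤ (1 + Q) * (A * |x - y| ^ s) := by gcongr; exact hol x y
      _ ≤ P * |x - y| ^ s := by
          rw [← mul_assoc]
          gcongr
          rw [hP]
          nlinarith
  · rw [integral_sub hτi (hψi.const_mul c), integral_const_mul, ← hΨ, hcdef,
      div_mul_cancel₀ _ hΨ0.ne', sub_self]

/-! ### Stopping intervals and averages over them -/

namespace DyadicGrid

variable (D : DyadicGrid) {V : Set ℝ} {l : ℝ}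

/-- The dyadic intervals in which the density of `V` exceeds `l`. -/
def dense (V : Set ℝ) (l : ℝ) : Set (ℤ × ℤ) :=
  {I | ENNReal.ofReal (l * D.length I) < volume (V ∩ D.interval I)}

/-- The maximal dyadic intervals in which the density of `V` exceeds `l`. -/
def stopping (V : Set ℝ) (l : ℝ) : Set (ℤ × ℤ) := D.maximals (D.dense V l)

/-- A dense interval has length below `|V| / l`; this finiteness is what guarantees maximal ones. -/
lemma exists_dense_bound (hV : volume V ≠ ∞) (hl : 0 < l) :
    ∃ j₀ : ℤ, ∀ I ∈ D.dense V l, I.1 ≤ j₀ := by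
  obtain ⟨n, hn⟩ := pow_unbounded_of_one_lt ((volume V).toReal / l) (by norm_num : (1 : ℝ) < 2)
  refine ⟨n, fun I hI => ?_⟩
  have h1 : ENNReal.ofReal (l * D.length I) < volume V :=
    lt_of_lt_of_le hI (measure_mono Set.inter_subset_left)
  have h2 : l * D.length I < (volume V).toReal := (ENNReal.ofReal_lt_iff_lt_toReal
    (mul_nonneg hl.le (D.length_pos I).le) hV).1 h1
  rw [div_lt_iff₀ hl] at hn
  have h3 : D.length I < D.length ((n : ℤ), 0) := by
    rw [D.length_mk (n : ℤ), zpow_natCast]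
    nlinarith
  exact ((D.length_lt_length_iff).1 h3).le

lemma pairwise_disjoint_maximals (F : Set (ℤ × ℤ)) :
    Pairwise (Function.onFun Disjoint fun I : D.maximals F => D.interval I) := fun I J h =>
  D.disjoint_of_mem_maximals I.2 J.2 fun h' => h (Subtype.ext h')

lemma tsum_volume_inter_maximals_le (hV : MeasurableSet V) (F : Set (ℤ × ℤ)) :
    ∑' I : D.maximals F, volume (V ∩ D.interval I) ≤ volume V := by
  rw [← measure_iUnion (fun I J h => (D.pairwise_disjoint_maximals F h).mono
    Set.inter_subset_right Set.inter_subset_right)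
    fun I => hV.inter (D.measurableSet_interval I), ← Set.inter_iUnion]
  exact measure_mono Set.inter_subset_left

lemma ofReal_length_le_of_mem_stopping (hl : 0 < l) {I : ℤ × ℤ} (hI : I ∈ D.stopping V l) :
    ENNReal.ofReal (D.length I) ≤ ENNReal.ofReal (1 / l) * volume (V ∩ D.interval I) := by
  have h : ENNReal.ofReal (l * D.length I) < volume (V ∩ D.interval I) := hI.1
  calc ENNReal.ofReal (D.length I) = ENNReal.ofReal (1 / l) * ENNReal.ofReal (l * D.length I) := by
        rw [← ENNReal.ofReal_mul (by positivity)]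
        congr 1
        field_simp
    _ ≤ _ := by gcongr

/-- By maximality the parent, of twice the length, is not dense. -/
lemma volume_inter_le_of_mem_stopping {I : ℤ × ℤ} (hI : I ∈ D.stopping V l) :
    volume (V ∩ D.interval I) ≤ ENNReal.ofReal (2 * l * D.length I) := by
  obtain ⟨k, hk⟩ := D.exists_parent I
  have h1 : (I.1 + 1, k) ∉ D.dense V l := fun h => by
    have := congrArg Prod.fst (hI.2 _ h hk)
    simp at this
  have h2 : volume (V ∩ D.interval (I.1 + 1, k)) ≤
      ENNReal.ofReal (l * D.length (I.1 + 1, k)) := not_lt.1 h1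
  refine (measure_mono (Set.inter_subset_inter_right _ hk)).trans (h2.trans (le_of_eq ?_))
  congr 1
  rw [D.length_mk, zpow_add₀ (by norm_num)]
  simp only [length]
  ring

lemma ae_mem_stopping (hVm : MeasurableSet V) (hV : volume V ≠ ∞) (hl : 0 < l) (hl1 : l < 1) :
    ∀ᵐ x, x ∈ V → ∃ I ∈ D.stopping V l, x ∈ D.interval I := by
  rw [← ae_restrict_iff' hVm]
  obtain ⟨j₀, hj₀⟩ := D.exists_dense_bound hV hl
  filter_upwards [D.ae_exists_dense_interval V hl1] with x hx
  obtain ⟨I, hxI, hI⟩ := hx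
  obtain ⟨J, hJ, hIJ⟩ := D.exists_mem_maximals hj₀ (I := I) hI
  exact ⟨J, hJ, hIJ hxI⟩

/-- A union of cells of low density near the stopping intervals meets `V` in a small set. -/
lemma volume_inter_cells_le (hVm : MeasurableSet V) (hV : volume V ≠ ∞) (hl : 0 < l)
    {R β : ℝ} (hR : 0 ≤ R) (hβ : 0 ≤ β) {N : Set (ℤ × ℤ)}
    (hcell : ∀ J ∈ N, volume (V ∩ D.interval J) ≤ ENNReal.ofReal (β * D.length J))
    (hnear : ∀ J ∈ N, ∃ Q ∈ D.stopping V l, J.1 ≤ Q.1 ∧ D.interval J ⊆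
      Set.Icc (D.center Q - R * D.length Q) (D.center Q + R * D.length Q)) :
    volume (V ∩ ⋃ J ∈ N, D.interval J) ≤ ENNReal.ofReal (β * (2 * R) / l) * volume V := by
  obtain ⟨j₀, hj₀⟩ := D.exists_dense_bound hV hl
  have hN : ∀ J ∈ N, J.1 ≤ j₀ := fun J hJ => by
    obtain ⟨Q, hQ, h, _⟩ := hnear J hJ
    exact h.trans (hj₀ Q hQ.1)
  have hU : ⋃ J ∈ N, D.interval J = ⋃ J : D.maximals N, D.interval J := by
    ext x
    simp only [Set.mem_iUnion, Subtype.exists, exists_prop]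
    constructor
    · rintro ⟨J, hJ, hx⟩
      obtain ⟨J', hJ', h⟩ := D.exists_mem_maximals hN hJ
      exact ⟨J', hJ', h hx⟩
    · rintro ⟨J, hJ, hx⟩
      exact ⟨J, hJ.1, hx⟩
  have hsub : ⋃ J : D.maximals N, D.interval J ⊆ ⋃ Q : D.stopping V l,
      Set.Icc (D.center Q - R * D.length Q) (D.center Q + R * D.length Q) := by
    refine Set.iUnion_subset fun J => ?_
    obtain ⟨Q, hQ, _, h⟩ := hnear J J.2.1
    exact h.trans (Set.subset_iUnion_of_subset ⟨Q, hQ⟩ subset_rfl)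
  -- The maximal cells are disjoint, so `V` meets them in at most `β` times the measure of their
  -- union. That union lies in dilates of the stopping intervals, whose total length is at most `|V|
  -- / l`.
  calc volume (V ∩ ⋃ J ∈ N, D.interval J)
      = volume (⋃ J : D.maximals N, V ∩ D.interval J) := by rw [hU, Set.inter_iUnion]
    _ ≤ ∑' J : D.maximals N, volume (V ∩ D.interval J) := measure_iUnion_le _
    _ ≤ ∑' J : D.maximals N, ENNReal.ofReal β * volume (D.interval J) := by
        refine ENNReal.tsum_le_tsum fun J => (hcell J J.2.1).trans (le_of_eq ?_)
        rw [ENNReal.ofReal_mul hβ, volume_interval]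
    _ = ENNReal.ofReal β * volume (⋃ J : D.maximals N, D.interval J) := by
        rw [ENNReal.tsum_mul_left, measure_iUnion (D.pairwise_disjoint_maximals N)
          fun J => D.measurableSet_interval J]
    _ ≤ ENNReal.ofReal β * ∑' Q : D.stopping V l,
        volume (Set.Icc (D.center Q - R * D.length Q) (D.center Q + R * D.length Q)) := by
        gcongr
        exact (measure_mono hsub).trans (measure_iUnion_le _)
    _ ≤ ENNReal.ofReal β * ∑' Q : D.stopping V l,
        ENNReal.ofReal (2 * R) * (ENNReal.ofReal (1 / l) * volume (V ∩ D.interval Q)) := by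
        gcongr with Q
        rw [Real.volume_Icc]
        calc _ = ENNReal.ofReal (2 * R) * ENNReal.ofReal (D.length Q) := by
              rw [← ENNReal.ofReal_mul (by positivity)]; congr 1; ring
          _ ≤ _ := by gcongr; exact D.ofReal_length_le_of_mem_stopping hl Q.2
    _ = ENNReal.ofReal (β * (2 * R) / l) * ∑' Q : D.stopping V l, volume (V ∩ D.interval Q) := by
        rw [ENNReal.tsum_mul_left, ENNReal.tsum_mul_left, ← mul_assoc, ← mul_assoc,
          ← ENNReal.ofReal_mul hβ, ← ENNReal.ofReal_mul (by positivity)]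
        congr 2
        ring
    _ ≤ _ := by gcongr; exact D.tsum_volume_inter_maximals_le hVm _

/-- The averages of the indicator of `V` over the stopping intervals. -/
noncomputable def stoppingAverage (V : Set ℝ) (l : ℝ) (x : ℝ) : ℝ :=
  (∑' Q : D.stopping V l, (D.interval Q).indicator
    (fun _ => volume (V ∩ D.interval Q) / ENNReal.ofReal (D.length Q)) x).toReal

lemma tsum_indicator_of_mem {Q : ℤ × ℤ} (hQ : Q ∈ D.stopping V l) {x : ℝ} (hx : x ∈ D.interval Q) :
    (∑' Q : D.stopping V l, (D.interval Q).indicator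
      (fun _ => volume (V ∩ D.interval Q) / ENNReal.ofReal (D.length Q)) x) =
    volume (V ∩ D.interval Q) / ENNReal.ofReal (D.length Q) := by
  rw [tsum_eq_single (⟨Q, hQ⟩ : D.stopping V l)]
  · simp [hx]
  · intro Q' hQ'
    refine Set.indicator_of_notMem (fun hx' => hQ' ?_) _
    by_contra hne
    exact Set.disjoint_left.1 (D.pairwise_disjoint_maximals _ hne) hx' hx

lemma stoppingAverage_of_mem {Q : ℤ × ℤ} (hQ : Q ∈ D.stopping V l) {x : ℝ}
    (hx : x ∈ D.interval Q) :
    D.stoppingAverage V l x = volume.real (V ∩ D.interval Q) / D.length Q := by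
  rw [stoppingAverage, D.tsum_indicator_of_mem hQ hx, ENNReal.toReal_div,
    ENNReal.toReal_ofReal (D.length_pos Q).le, Measure.real]

lemma stoppingAverage_of_notMem {x : ℝ} (hx : ∀ Q ∈ D.stopping V l, x ∉ D.interval Q) :
    D.stoppingAverage V l x = 0 := by
  have : ∀ Q : D.stopping V l, (D.interval Q).indicator
    (fun _ => volume (V ∩ D.interval Q) / ENNReal.ofReal (D.length Q)) x = 0 := fun Q =>
    Set.indicator_of_notMem (hx Q Q.2) _
  simp [stoppingAverage, this]

lemma measurable_stoppingAverage : Measurable (D.stoppingAverage V l) :=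
  (Measurable.tsum fun Q : D.stopping V l =>
    measurable_const.indicator (D.measurableSet_interval Q)).ennreal_toReal

lemma stoppingAverage_nonneg (x : ℝ) : 0 ≤ D.stoppingAverage V l x := ENNReal.toReal_nonneg

lemma real_volume_inter_le_of_mem_stopping (hl : 0 < l) {I : ℤ × ℤ}
    (hI : I ∈ D.stopping V l) : volume.real (V ∩ D.interval I) ≤ 2 * l * D.length I := by
  have hp := D.length_pos I
  exact ENNReal.toReal_le_of_le_ofReal (by positivity) (D.volume_inter_le_of_mem_stopping hI)

lemma stoppingAverage_le (hl : 0 < l) (x : ℝ) : D.stoppingAverage V l x ≤ 2 * l := by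
  by_cases hx : ∃ Q ∈ D.stopping V l, x ∈ D.interval Q
  · obtain ⟨Q, hQ, hx⟩ := hx
    rw [D.stoppingAverage_of_mem hQ hx, div_le_iff₀ (D.length_pos Q)]
    exact D.real_volume_inter_le_of_mem_stopping hl hQ
  · push Not at hx
    rw [D.stoppingAverage_of_notMem hx]
    positivity

lemma lintegral_stoppingAverage_le (hVm : MeasurableSet V) :
    ∫⁻ x, ENNReal.ofReal (D.stoppingAverage V l x) ≤ volume V := by
  calc _ ≤ ∫⁻ x, ∑' Q : D.stopping V l, (D.interval Q).indicator
        (fun _ => volume (V ∩ D.interval Q) / ENNReal.ofReal (D.length Q)) x :=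
        lintegral_mono fun x => ENNReal.ofReal_toReal_le
    _ = ∑' Q : D.stopping V l, volume (V ∩ D.interval Q) := by
        rw [lintegral_tsum fun Q =>
          (measurable_const.indicator (D.measurableSet_interval _)).aemeasurable]
        refine tsum_congr fun Q => ?_
        rw [lintegral_indicator_const (D.measurableSet_interval _), volume_interval]
        exact ENNReal.div_mul_cancel (by simpa using D.length_pos _) ENNReal.ofReal_ne_top
    _ ≤ _ := D.tsum_volume_inter_maximals_le hVm _

lemma integrable_stoppingAverage (hVm : MeasurableSet V) (hV : volume V ≠ ∞) :
    Integrable (D.stoppingAverage V l) := by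
  refine ⟨D.measurable_stoppingAverage.aestronglyMeasurable, ?_⟩
  rw [hasFiniteIntegral_iff_ofReal (Filter.Eventually.of_forall D.stoppingAverage_nonneg)]
  exact (D.lintegral_stoppingAverage_le hVm).trans_lt hV.lt_top

lemma integral_stoppingAverage_sq_le (hVm : MeasurableSet V) (hV : volume V ≠ ∞) (hl : 0 < l) :
    Integrable (fun x => D.stoppingAverage V l x ^ 2) ∧
      ∫ x, D.stoppingAverage V l x ^ 2 ≤ 2 * l * volume.real V := by
  have hi := D.integrable_stoppingAverage (l := l) hVm hV
  have hle : ∀ x, D.stoppingAverage V l x ^ 2 ≤ 2 * l * D.stoppingAverage V l x := fun x => by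
    have h1 := D.stoppingAverage_nonneg (V := V) (l := l) x
    have h2 := D.stoppingAverage_le (V := V) hl x
    nlinarith
  have hi2 : Integrable (fun x => D.stoppingAverage V l x ^ 2) := by
    refine (hi.const_mul (2 * l)).mono'
      (D.measurable_stoppingAverage.pow_const 2).aestronglyMeasurable
      (Filter.Eventually.of_forall fun x => ?_)
    rw [Real.norm_eq_abs, abs_of_nonneg (sq_nonneg _)]
    exact hle x
  refine ⟨hi2, (integral_mono hi2 (hi.const_mul _) hle).trans ?_⟩
  rw [integral_const_mul]
  have : ∫ x, D.stoppingAverage V l x ≤ volume.real V := by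
    rw [integral_eq_lintegral_of_nonneg_ae (Filter.Eventually.of_forall D.stoppingAverage_nonneg)
      D.measurable_stoppingAverage.aestronglyMeasurable]
    exact ENNReal.toReal_mono hV (D.lintegral_stoppingAverage_le hVm)
  gcongr

lemma integrable_indicator_one (hVm : MeasurableSet V) (hV : volume V ≠ ∞) :
    Integrable (V.indicator fun _ => (1 : ℝ)) :=
  (integrable_indicator_iff hVm).2 (integrableOn_const hV)

lemma setIntegral_interval_indicator (hVm : MeasurableSet V) (I : ℤ × ℤ) :
    ∫ x in D.interval I, V.indicator (fun _ => (1 : ℝ)) x = volume.real (V ∩ D.interval I) := by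
  rw [setIntegral_indicator hVm, setIntegral_const, smul_eq_mul, mul_one, Set.inter_comm]

/-- On a stopping interval, the indicator of `V` minus its average. -/
lemma setIntegral_sub_stoppingAverage (hVm : MeasurableSet V) (hV : volume V ≠ ∞)
    {Q : ℤ × ℤ} (hQ : Q ∈ D.stopping V l) :
    (∫ x in D.interval Q, (V.indicator (fun _ => (1 : ℝ)) x - D.stoppingAverage V l x) = 0) ∧
      ∫ x in D.interval Q, |V.indicator (fun _ => (1 : ℝ)) x - D.stoppingAverage V l x| ≤
        2 * volume.real (V ∩ D.interval Q) := by
  have h1 := (integrable_indicator_one hVm hV).integrableOn (s := D.interval Q)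
  have h2 := (D.integrable_stoppingAverage (l := l) hVm hV).integrableOn (s := D.interval Q)
  have e : ∫ x in D.interval Q, D.stoppingAverage V l x = volume.real (V ∩ D.interval Q) := by
    rw [setIntegral_congr_fun (D.measurableSet_interval Q)
      (fun x hx => D.stoppingAverage_of_mem hQ hx), setIntegral_const, smul_eq_mul, Measure.real,
      volume_interval, ENNReal.toReal_ofReal (D.length_pos Q).le,
      mul_div_cancel₀ _ (D.length_pos Q).ne']
  constructor
  · rw [integral_sub h1 h2, D.setIntegral_interval_indicator hVm, e, sub_self]
  · calc _ ≤ ∫ x in D.interval Q, (V.indicator (fun _ => (1 : ℝ)) x + D.stoppingAverage V l x) := by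
          refine integral_mono (h1.sub h2).abs (h1.add h2) fun x => ?_
          refine (abs_sub _ _).trans (le_of_eq ?_)
          rw [abs_of_nonneg (D.stoppingAverage_nonneg x), abs_of_nonneg
            (Set.indicator_nonneg (fun _ _ => zero_le_one) _)]
      _ = _ := by rw [integral_add h1 h2, D.setIntegral_interval_indicator hVm, e]; ring

end DyadicGrid

/-! ### Cancellation of the oscillating part on stopping intervals -/

namespace DyadicGrid

variable (D : DyadicGrid) {V : Set ℝ} {l : ℝ}

/-- The interval `Q` is shorter than `I` and meets the `K`-fold neighbourhood of its center. -/
def Near (K : ℝ) (I Q : ℤ × ℤ) : Prop :=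
  Q.1 < I.1 ∧ ∃ y ∈ D.interval Q, |y - D.center I| ≤ K * D.length I

open Classical in
/-- The weight `(|Q| / |I|) ^ s` of a near pair of intervals. -/
noncomputable def nearWeight (K s : ℝ) (I Q : ℤ × ℤ) : ℝ :=
  if D.Near K I Q then (D.length Q / D.length I) ^ s else 0

variable {D}

lemma Near.subset {K : ℝ} {I Q : ℤ × ℤ} (h : D.Near K I Q) :
    D.interval Q ⊆ Set.Icc (D.center I - (K + 1) * D.length I)
      (D.center I + (K + 1) * D.length I) := by
  obtain ⟨h1, y, hy, hyI⟩ := h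
  intro x hx
  have h2 := abs_le.1 (D.abs_sub_le_of_mem hx hy)
  have h3 := D.length_le_length h1.le
  have h4 := abs_le.1 hyI
  constructor <;> nlinarith [h2.1, h2.2, h4.1, h4.2]

variable (D)

lemma nearWeight_nonneg (K s : ℝ) (I Q : ℤ × ℤ) : 0 ≤ D.nearWeight K s I Q := by
  have h1 := D.length_pos I
  have h2 := D.length_pos Q
  unfold nearWeight
  split_ifs <;> positivity

lemma nearWeight_le_one {K s : ℝ} (hs : 0 ≤ s) (I Q : ℤ × ℤ) : D.nearWeight K s I Q ≤ 1 := by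
  have h1 := D.length_pos I
  have h2 := D.length_pos Q
  unfold nearWeight
  split_ifs with h
  · exact Real.rpow_le_one (by positivity) ((div_le_one h1).2 (D.length_le_length h.1.le)) hs
  · exact zero_le_one

/-- At each scale boundedly many `I` are near a given `Q`, and the weights decay geometrically in
the scale difference. -/
lemma exists_sum_nearWeight_le {K s : ℝ} (hK : 0 ≤ K) (hs : 0 < s) :
    ∃ T : ℝ, 0 < T ∧ ∀ (D : DyadicGrid) (Q : ℤ × ℤ) (F : Finset (ℤ × ℤ)),
      ∑ I ∈ F, D.nearWeight K s I Q ≤ T := by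
  obtain ⟨T, hT0, hT⟩ := exists_sum_geometric_le (θ := (2 : ℝ) ^ (-s)) (by positivity)
    (Real.rpow_lt_one_of_one_lt_of_neg (by norm_num) (by linarith))
  have hΛ := latticeConst_pos (q := 2) (by norm_num)
  refine ⟨(K + 2) ^ (2 : ℝ) * latticeConst 2 * T, by positivity, fun D Q F => ?_⟩
  refine sum_le_of_rows (B := fun i => (K + 2) ^ (2 : ℝ) * latticeConst 2 *
    ((2 : ℝ) ^ (-s)) ^ (Q.1 - i).natAbs) (fun I => D.nearWeight_nonneg K s I Q)
    (fun i Ks => ?_) (fun Ks => ?_) F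
  -- For a near pair the rescaled distance of centers is at most `K + 1`, so `(K + 2) ^ 2 * bump 2`
  -- dominates `1`; this turns counting into a lattice sum.
  · calc _ ≤ ∑ k ∈ Ks, (((2 : ℝ) ^ (-s)) ^ (Q.1 - i).natAbs * (K + 2) ^ (2 : ℝ)) *
          bump 2 ((D.center Q - D.center (i, k)) / D.length (i, k)) := by
          refine Finset.sum_le_sum fun k _ => ?_
          unfold nearWeight
          split_ifs with h
          · have hp := D.length_pos (i, k)
            rw [D.length_div_rpow (I := (i, k)) (J := Q) h.1.le, ← Int.natAbs_neg, neg_sub,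
              mul_assoc]
            refine le_mul_of_one_le_right (by positivity) ?_
            have h2 : |(D.center Q - D.center (i, k)) / D.length (i, k)| ≤ K + 1 := by
              have := h.subset (D.center_mem Q)
              rw [abs_div, abs_of_pos hp, div_le_iff₀ hp, abs_le]
              constructor <;> linarith [this.1, this.2]
            unfold bump
            rw [Real.rpow_neg (by positivity), ← div_eq_mul_inv, one_le_div (by positivity)]
            exact Real.rpow_le_rpow (by positivity) (by linarith) (by norm_num)
          · have := bump_nonneg 2 ((D.center Q - D.center (i, k)) / D.length (i, k))
            positivity
      _ ≤ (((2 : ℝ) ^ (-s)) ^ (Q.1 - i).natAbs * (K + 2) ^ (2 : ℝ)) * latticeConst 2 := by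
          rw [← Finset.mul_sum]
          gcongr
          exact D.sum_bump_center_le (by norm_num) _ i Ks
      _ = _ := by ring
  · rw [← Finset.mul_sum]
    gcongr
    exact hT _ _

lemma summable_real_volume_stopping (hVm : MeasurableSet V) (hV : volume V ≠ ∞) :
    Summable (fun Q : D.stopping V l => volume.real (V ∩ D.interval Q)) ∧
      ∑' Q : D.stopping V l, volume.real (V ∩ D.interval Q) ≤ volume.real V := by
  have h := D.tsum_volume_inter_maximals_le hVm (D.dense V l)
  refine ⟨ENNReal.summable_toReal (h.trans_lt hV.lt_top).ne, ?_⟩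
  simp only [Measure.real]
  rw [← ENNReal.tsum_toReal_eq fun Q => ((measure_mono Set.inter_subset_left).trans_lt
    hV.lt_top).ne]
  exact ENNReal.toReal_mono hV h

/-- The near `Q` are disjoint, have density at most `2l`, and lie in an interval of length `2 (K +
1) |I|`. -/
lemma tsum_nearWeight_mul_le (hVm : MeasurableSet V) (hV : volume V ≠ ∞) (hl : 0 < l) {K s : ℝ}
    (hK : 0 ≤ K) (hs : 0 ≤ s) (I : ℤ × ℤ) :
    Summable (fun Q : D.stopping V l => D.nearWeight K s I Q * volume.real (V ∩ D.interval Q)) ∧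
      ∑' Q : D.stopping V l, D.nearWeight K s I Q * volume.real (V ∩ D.interval Q) ≤
        4 * l * (K + 1) * D.length I := by
  have hI := D.length_pos I
  have hsum : Summable fun Q : D.stopping V l =>
      D.nearWeight K s I Q * volume.real (V ∩ D.interval Q) :=
    Summable.of_nonneg_of_le
      (fun Q => mul_nonneg (D.nearWeight_nonneg K s I Q) measureReal_nonneg)
      (fun Q => mul_le_of_le_one_left measureReal_nonneg (D.nearWeight_le_one hs I Q))
      (D.summable_real_volume_stopping (l := l) hVm hV).1
  refine ⟨hsum, hsum.tsum_le_of_sum_le fun G => ?_⟩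
  classical
  set G' : Finset (D.stopping V l) := G.filter fun Q => D.Near K I Q.1 with hG'
  have hdisj : (G' : Set (D.stopping V l)).PairwiseDisjoint fun Q => D.interval Q :=
    fun Q _ Q' _ h => D.pairwise_disjoint_maximals _ h
  calc _ ≤ ∑ Q ∈ G, if D.Near K I Q then 2 * l * D.length Q else 0 := by
        refine Finset.sum_le_sum fun Q _ => ?_
        split_ifs with h
        · exact (mul_le_of_le_one_left measureReal_nonneg (D.nearWeight_le_one hs I Q)).trans
            (D.real_volume_inter_le_of_mem_stopping hl Q.2)
        · simp [nearWeight, h]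
    _ = 2 * l * ∑ Q ∈ G', volume.real (D.interval Q) := by
        rw [← Finset.sum_filter, Finset.mul_sum]
        refine Finset.sum_congr rfl fun Q _ => ?_
        rw [Measure.real, volume_interval, ENNReal.toReal_ofReal (D.length_pos _).le]
    _ = 2 * l * volume.real (⋃ Q ∈ G', D.interval Q) := by
        rw [measureReal_biUnion_finset hdisj (fun Q _ => D.measurableSet_interval Q)
          (fun Q _ => by rw [volume_interval]; exact ENNReal.ofReal_ne_top)]
    _ ≤ 2 * l * volume.real (Set.Icc (D.center I - (K + 1) * D.length I)
      (D.center I + (K + 1) * D.length I)) := by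
        refine mul_le_mul_of_nonneg_left (measureReal_mono (Set.iUnion₂_subset fun Q hQ => ?_)
          measure_Icc_lt_top.ne) (by positivity)
        exact ((Finset.mem_filter.1 hQ).2).subset
    _ = _ := by
        rw [Real.volume_real_Icc_of_le (by nlinarith)]
        ring

lemma memLp_indicator_one (hVm : MeasurableSet V) (hV : volume V ≠ ∞) :
    MemLp (V.indicator fun _ => (1 : ℝ)) 2 := memLp_indicator_const 2 hVm 1 (Or.inr hV)

lemma memLp_stoppingAverage (hVm : MeasurableSet V) (hV : volume V ≠ ∞) (hl : 0 < l) :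
    MemLp (D.stoppingAverage V l) 2 :=
  (memLp_two_iff_integrable_sq D.measurable_stoppingAverage.aestronglyMeasurable).2
    (D.integral_stoppingAverage_sq_le hVm hV hl).1

/-- Pairing of the oscillating part with a rescaled compactly supported function. -/
lemma abs_integral_sub_stoppingAverage_mul_le (hVm : MeasurableSet V) (hV : volume V ≠ ∞)
    (hl : 0 < l) (hl1 : l < 1) {K s H : ℝ} (hK : 0 ≤ K) (hs : 0 < s) (hH : 0 ≤ H) {u : ℝ → ℝ}
    (huc : Continuous u) (hu2 : MemLp u 2) (hsupp : ∀ x, u x ≠ 0 → |x| ≤ K)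
    (hol : ∀ x y, |u x - u y| ≤ H * |x - y| ^ s) {I : ℤ × ℤ}
    (hI : ∀ Q ∈ D.stopping V l, (∃ y ∈ D.interval Q, |y - D.center I| ≤ K * D.length I) →
      Q.1 < I.1) :
    |∫ x, (V.indicator (fun _ => (1 : ℝ)) x - D.stoppingAverage V l x) * wavelet u D I x| ≤
      2 * H * D.length I ^ (-(1 / 2) : ℝ) *
        ∑' Q : D.stopping V l, D.nearWeight K s I Q * volume.real (V ∩ D.interval Q) := by
  have hLI := D.length_pos I
  set N := D.length I ^ (-(1 / 2) : ℝ) with hN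
  have hN0 : 0 < N := D.length_rpow_pos I
  set b : ℝ → ℝ := fun x => V.indicator (fun _ => (1 : ℝ)) x - D.stoppingAverage V l x with hb
  have hb1 : Integrable b :=
    (integrable_indicator_one hVm hV).sub (D.integrable_stoppingAverage hVm hV)
  have hb2 : MemLp b 2 := (memLp_indicator_one hVm hV).sub (D.memLp_stoppingAverage hVm hV hl)
  have hbu : Integrable fun x => b x * wavelet u D I x :=
    hb2.integrable_mul (memLp_wavelet D I huc hu2)
  have hsum := hasSum_integral_iUnion (μ := volume)
    (fun Q : D.stopping V l => D.measurableSet_interval Q)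
    (D.pairwise_disjoint_maximals _) hbu.integrableOn
  have hΩ : ∫ x in ⋃ Q : D.stopping V l, D.interval Q, b x * wavelet u D I x =
      ∫ x, b x * wavelet u D I x := by
    refine setIntegral_eq_integral_of_ae_compl_eq_zero ?_
    filter_upwards [D.ae_mem_stopping hVm hV hl hl1] with x hx hxΩ
    have h1 : ∀ Q ∈ D.stopping V l, x ∉ D.interval Q := fun Q hQ hxQ =>
      hxΩ (Set.mem_iUnion.2 ⟨⟨Q, hQ⟩, hxQ⟩)
    have h2 : x ∉ V := fun hxV => by
      obtain ⟨Q, hQ, hxQ⟩ := hx hxV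
      exact h1 Q hQ hxQ
    simp [hb, h2, D.stoppingAverage_of_notMem h1]
  rw [hΩ] at hsum
  have hw := (D.tsum_nearWeight_mul_le hVm hV hl hK hs.le I).1
  rw [← tsum_mul_left]
  refine hsum.norm_le_of_bounded (hw.mul_left (2 * H * N)).hasSum fun Q => ?_
  by_cases hnear : ∃ y ∈ D.interval Q, |y - D.center I| ≤ K * D.length I
  · have hQI := hI Q Q.2 hnear
    have hW : D.nearWeight K s I Q = (D.length Q / D.length I) ^ s := if_pos ⟨hQI, hnear⟩
    obtain ⟨h0, habs⟩ := D.setIntegral_sub_stoppingAverage hVm hV Q.2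
    -- The oscillating part has mean zero on `Q`, so the value of the wavelet at the center of `Q`
    -- may be subtracted.
    have e : ∫ x in D.interval Q, b x * wavelet u D I x =
        ∫ x in D.interval Q, b x * (wavelet u D I x - wavelet u D I (D.center Q)) := by
      simp_rw [mul_sub]
      rw [integral_sub hbu.integrableOn (hb1.mul_const _).integrableOn, integral_mul_const, h0]
      simp
    rw [e, hW]
    have hdiff : ∀ x ∈ D.interval Q, |wavelet u D I x - wavelet u D I (D.center Q)| ≤
        N * (H * (D.length Q / D.length I) ^ s) := by
      intro x hx
      unfold wavelet
      rw [← mul_sub, abs_mul, abs_of_pos hN0]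
      refine mul_le_mul_of_nonneg_left ((hol _ _).trans ?_) hN0.le
      have e2 : (x - D.center I) / D.length I - (D.center Q - D.center I) / D.length I =
          (x - D.center Q) / D.length I := by ring
      rw [e2, abs_div, abs_of_pos hLI]
      gcongr
      exact D.abs_sub_le_of_mem hx (D.center_mem Q)
    calc _ ≤ ∫ x in D.interval Q, |b x| * (N * (H * (D.length Q / D.length I) ^ s)) := by
          refine norm_integral_le_of_norm_le (hb1.abs.mul_const _).integrableOn ?_
          refine (ae_restrict_iff' (D.measurableSet_interval Q)).2
            (Filter.Eventually.of_forall fun x hx => ?_)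
          rw [Real.norm_eq_abs, abs_mul]
          exact mul_le_mul_of_nonneg_left (hdiff x hx) (abs_nonneg _)
      _ = (∫ x in D.interval Q, |b x|) * (N * (H * (D.length Q / D.length I) ^ s)) :=
          integral_mul_const _ _
      _ ≤ 2 * volume.real (V ∩ D.interval Q) * (N * (H * (D.length Q / D.length I) ^ s)) := by
          have hp := D.length_pos Q
          gcongr
      _ = _ := by ring
  · have hz : ∀ x ∈ D.interval Q, b x * wavelet u D I x = 0 := by
      intro x hx
      have : u ((x - D.center I) / D.length I) = 0 := by
        by_contra hne
        refine hnear ⟨x, hx, ?_⟩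
        have := hsupp _ hne
        rwa [abs_div, abs_of_pos hLI, div_le_iff₀ hLI] at this
      simp [wavelet, this]
    rw [setIntegral_congr_fun (D.measurableSet_interval Q) hz]
    simp only [integral_zero, norm_zero]
    exact mul_nonneg (by positivity) (mul_nonneg (D.nearWeight_nonneg _ _ _ _) measureReal_nonneg)

/-- Summation of the pairings of the oscillating part over the intervals that are longer than all
stopping intervals near them. -/
lemma exists_sum_sub_stoppingAverage_le {K s H : ℝ} (hK : 0 ≤ K) (hs : 0 < s) (hH : 0 ≤ H) :
    ∃ c : ℝ, 0 ≤ c ∧ ∀ (D : DyadicGrid) (u : ℝ → ℝ), Continuous u → MemLp u 2 →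
      (∀ x, u x ≠ 0 → |x| ≤ K) → (∀ x y, |u x - u y| ≤ H * |x - y| ^ s) →
      ∀ (V : Set ℝ) (l : ℝ), MeasurableSet V → volume V ≠ ∞ → 0 < l → l < 1 →
      ∀ F : Finset (ℤ × ℤ), (∀ I ∈ F, ∀ Q ∈ D.stopping V l,
        (∃ y ∈ D.interval Q, |y - D.center I| ≤ K * D.length I) → Q.1 < I.1) →
      ∑ I ∈ F, (∫ x, (V.indicator (fun _ => (1 : ℝ)) x - D.stoppingAverage V l x) *
        wavelet u D I x) ^ 2 ≤ c * l * volume.real V := by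
  obtain ⟨T, hT0, hT⟩ := exists_sum_nearWeight_le hK hs
  refine ⟨16 * H ^ 2 * (K + 1) * T, by positivity,
    fun D u huc hu2 hsupp hol V l hVm hV hl hl1 F hF => ?_⟩
  set m : D.stopping V l → ℝ := fun Q => volume.real (V ∩ D.interval Q) with hm
  have hm0 : ∀ Q, 0 ≤ m Q := fun Q => measureReal_nonneg
  have hsm := D.summable_real_volume_stopping (l := l) hVm hV
  have hS := fun I => D.tsum_nearWeight_mul_le hVm hV hl hK hs.le I
  have hS0 : ∀ I, 0 ≤ ∑' Q : D.stopping V l, D.nearWeight K s I Q * m Q := fun I =>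
    tsum_nonneg fun Q => mul_nonneg (D.nearWeight_nonneg _ _ _ _) (hm0 Q)
  calc _ ≤ ∑ I ∈ F, 16 * H ^ 2 * (K + 1) * l *
        ∑' Q : D.stopping V l, D.nearWeight K s I Q * m Q := by
        refine Finset.sum_le_sum fun I hI => ?_
        have h := D.abs_integral_sub_stoppingAverage_mul_le hVm hV hl hl1 hK hs hH huc hu2 hsupp
          hol (hF I hI)
        have hLI := D.length_pos I
        set S := ∑' Q : D.stopping V l, D.nearWeight K s I Q * m Q with hSdef
        have hSI : S ≤ 4 * l * (K + 1) * D.length I := (hS I).2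
        have hSI0 : 0 ≤ S := hS0 I
        rw [← sq_abs]
        -- One factor `S` is bounded by its maximum, which cancels `|I|⁻¹` and supplies `l`; the
        -- other is kept and summed over `I`.
        calc _ ≤ (2 * H * D.length I ^ (-(1 / 2) : ℝ) * S) ^ 2 := by gcongr
          _ = 4 * H ^ 2 * (D.length I ^ (-(1 / 2) : ℝ) * D.length I ^ (-(1 / 2) : ℝ)) *
              (S * S) := by ring
          _ ≤ 4 * H ^ 2 * (D.length I)⁻¹ * (S * (4 * l * (K + 1) * D.length I)) := by
              rw [D.length_rpow_mul_self]
              gcongr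
          _ = _ := by field_simp; ring
    _ = 16 * H ^ 2 * (K + 1) * l *
        ∑' Q : D.stopping V l, (∑ I ∈ F, D.nearWeight K s I Q) * m Q := by
        rw [← Finset.mul_sum, ← Summable.tsum_finsetSum fun I _ => (hS I).1]
        simp_rw [Finset.sum_mul]
        rfl
    _ ≤ 16 * H ^ 2 * (K + 1) * l * ∑' Q : D.stopping V l, T * m Q := by
        refine mul_le_mul_of_nonneg_left (Summable.tsum_le_tsum (fun Q => ?_) ?_
          (hsm.1.mul_left T)) (by positivity)
        · exact mul_le_mul_of_nonneg_right (hT D Q F) (hm0 Q)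
        · simp_rw [Finset.sum_mul]
          exact summable_sum fun I _ => (hS I).1
    _ ≤ 16 * H ^ 2 * (K + 1) * l * (T * volume.real V) := by
        rw [tsum_mul_left]
        gcongr
        exact hsm.2
    _ = _ := by ring

end DyadicGrid

/-! ### Low-mass coefficients and the conclusion -/

section Main

variable {D : DyadicGrid} {V : Set ℝ} {l : ℝ} {u w : ℝ → ℝ}

lemma integral_indicator_one_sq (hVm : MeasurableSet V) :
    ∫ x, V.indicator (fun _ => (1 : ℝ)) x ^ 2 = volume.real V := by
  have : ∀ x, V.indicator (fun _ => (1 : ℝ)) x ^ 2 = V.indicator (fun _ => (1 : ℝ)) x := fun x => by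
    by_cases hx : x ∈ V <;> simp [hx]
  simp_rw [this]
  rw [integral_indicator hVm, setIntegral_const, smul_eq_mul, mul_one]

/-- The coefficients over the intervals that are longer than all stopping intervals near them. -/
lemma sum_sq_coarse_le {Bu K s H c : ℝ} (huc : Continuous u) (hu2 : MemLp u 2)
    (hB : ∀ f : ℝ → ℝ, MemLp f 2 → ∀ F : Finset (ℤ × ℤ),
      ∑ I ∈ F, (∫ x, f x * wavelet u D I x) ^ 2 ≤ Bu * ∫ x, f x ^ 2) (hBu : 0 ≤ Bu)
    (hsupp : ∀ x, u x ≠ 0 → |x| ≤ K) (hol : ∀ x y, |u x - u y| ≤ H * |x - y| ^ s)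
    (hc : ∀ (D : DyadicGrid) (u : ℝ → ℝ), Continuous u → MemLp u 2 →
      (∀ x, u x ≠ 0 → |x| ≤ K) → (∀ x y, |u x - u y| ≤ H * |x - y| ^ s) →
      ∀ (V : Set ℝ) (l : ℝ), MeasurableSet V → volume V ≠ ∞ → 0 < l → l < 1 →
      ∀ F : Finset (ℤ × ℤ), (∀ I ∈ F, ∀ Q ∈ D.stopping V l,
        (∃ y ∈ D.interval Q, |y - D.center I| ≤ K * D.length I) → Q.1 < I.1) →
      ∑ I ∈ F, (∫ x, (V.indicator (fun _ => (1 : ℝ)) x - D.stoppingAverage V l x) *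
        wavelet u D I x) ^ 2 ≤ c * l * volume.real V)
    (hVm : MeasurableSet V) (hV : volume V ≠ ∞) (hl : 0 < l) (hl1 : l < 1)
    {F : Finset (ℤ × ℤ)} (hF : ∀ I ∈ F, ∀ Q ∈ D.stopping V l,
        (∃ y ∈ D.interval Q, |y - D.center I| ≤ K * D.length I) → Q.1 < I.1) :
    ∑ I ∈ F, (∫ x, V.indicator (fun _ => (1 : ℝ)) x * wavelet u D I x) ^ 2 ≤
      (4 * Bu + 2 * c) * l * volume.real V := by
  have h1 := hc D u huc hu2 hsupp hol V l hVm hV hl hl1 F hF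
  have h2 := hB _ (D.memLp_stoppingAverage hVm hV hl) F
  have h3 := mul_le_mul_of_nonneg_left (D.integral_stoppingAverage_sq_le hVm hV hl).2 hBu
  have hw : ∀ I, MemLp (wavelet u D I) 2 := fun I => memLp_wavelet D I huc hu2
  calc _ ≤ ∑ I ∈ F, (2 * (∫ x, D.stoppingAverage V l x * wavelet u D I x) ^ 2 +
        2 * (∫ x, (V.indicator (fun _ => (1 : ℝ)) x - D.stoppingAverage V l x) *
          wavelet u D I x) ^ 2) := by
        refine Finset.sum_le_sum fun I _ => ?_
        have i1 : Integrable fun x => V.indicator (fun _ => (1 : ℝ)) x * wavelet u D I x :=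
          (DyadicGrid.memLp_indicator_one hVm hV).integrable_mul (hw I)
        have i2 : Integrable fun x => D.stoppingAverage V l x * wavelet u D I x :=
          (D.memLp_stoppingAverage hVm hV hl).integrable_mul (hw I)
        simp_rw [sub_mul]
        rw [integral_sub i1 i2]
        set a := ∫ x, V.indicator (fun _ => (1 : ℝ)) x * wavelet u D I x
        set b := ∫ x, D.stoppingAverage V l x * wavelet u D I x
        nlinarith [sq_nonneg (a - 2 * b)]
    _ ≤ _ := by
        rw [Finset.sum_add_distrib, ← Finset.mul_sum, ← Finset.mul_sum]
        linarith

/-- Where the wavelet is not small, `V` has low density if the mass of `w_I ^ 2` on `V` is low. -/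
lemma volume_inter_cell_le {A s κ δ : ℝ} {n : ℕ} (hwc : Continuous w) (hw2 : MemLp w 2)
    (hκ : 0 < κ) (hs : 0 < s) (hA : 0 < A)
    (hol : ∀ x y, |w x - w y| ≤ A * |x - y| ^ s) (hn : A * ((1 / 2 : ℝ) ^ n) ^ s ≤ κ / 2)
    (hVm : MeasurableSet V) (hV : volume V ≠ ∞) {I J : ℤ × ℤ} (hJ : J.1 = I.1 - n) {x₀ : ℝ}
    (hx₀ : x₀ ∈ D.interval J) (hκx : κ ≤ |w ((x₀ - D.center I) / D.length I)|)
    (hI : ∫ x in V, wavelet w D I x ^ 2 ≤ δ) :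
    volume (V ∩ D.interval J) ≤ ENNReal.ofReal (4 * δ * 2 ^ n / κ ^ 2 * D.length J) := by
  have hLI := D.length_pos I
  have hlen : D.length J = D.length I * (1 / 2) ^ n := by
    rw [DyadicGrid.length, hJ, zpow_sub₀ (by norm_num), zpow_natCast, one_div, inv_pow]
    rfl
  -- The cell is so short relative to `I` that `|w|` cannot fall below `κ / 2` on it; the density
  -- bound is then Chebyshev's inequality.
  have hlow : ∀ x ∈ D.interval J, (D.length I)⁻¹ * (κ / 2) ^ 2 ≤ wavelet w D I x ^ 2 := by
    intro x hx
    rw [wavelet_sq]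
    refine mul_le_mul_of_nonneg_left ?_ (by positivity)
    rw [← sq_abs (w _)]
    refine pow_le_pow_left₀ (by positivity) ?_ 2
    have h1 := hol ((x₀ - D.center I) / D.length I) ((x - D.center I) / D.length I)
    have h2 : |(x₀ - D.center I) / D.length I - (x - D.center I) / D.length I| ≤ (1 / 2) ^ n := by
      rw [← sub_div, abs_div, abs_of_pos hLI, div_le_iff₀ hLI]
      have := D.abs_sub_le_of_mem hx₀ hx
      rw [hlen] at this
      calc _ = |x₀ - x| := by ring_nf
        _ ≤ _ := by linarith
    have h3 : A * |(x₀ - D.center I) / D.length I - (x - D.center I) / D.length I| ^ s ≤ κ / 2 :=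
      le_trans (by gcongr) hn
    have h4 := abs_sub_abs_le_abs_sub (w ((x₀ - D.center I) / D.length I))
      (w ((x - D.center I) / D.length I))
    linarith
  have hi : Integrable fun x => wavelet w D I x ^ 2 :=
    (memLp_two_iff_integrable_sq (continuous_wavelet D I hwc).aestronglyMeasurable).1
      (memLp_wavelet D I hwc hw2)
  have hfin : volume (V ∩ D.interval J) ≠ ∞ :=
    ((measure_mono Set.inter_subset_left).trans_lt hV.lt_top).ne
  have h5 : volume.real (V ∩ D.interval J) * ((D.length I)⁻¹ * (κ / 2) ^ 2) ≤ δ := by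
    calc _ = ∫ _ in V ∩ D.interval J, (D.length I)⁻¹ * (κ / 2) ^ 2 := by
          rw [setIntegral_const, smul_eq_mul]
      _ ≤ ∫ x in V ∩ D.interval J, wavelet w D I x ^ 2 :=
          setIntegral_mono_on (integrableOn_const hfin) hi.integrableOn
            (hVm.inter (D.measurableSet_interval J)) fun x hx => hlow x hx.2
      _ ≤ ∫ x in V, wavelet w D I x ^ 2 :=
          setIntegral_mono_set hi.integrableOn (Filter.Eventually.of_forall fun x => sq_nonneg _)
            (Filter.Eventually.of_forall fun x hx => hx.1)
      _ ≤ δ := hI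
  rw [← ENNReal.ofReal_toReal hfin]
  refine ENNReal.ofReal_le_ofReal ?_
  change volume.real (V ∩ D.interval J) ≤ _
  have e : volume.real (V ∩ D.interval J) =
      volume.real (V ∩ D.interval J) * ((D.length I)⁻¹ * (κ / 2) ^ 2) *
        (4 / κ ^ 2 * D.length I) := by
    field_simp
    norm_num
  have e2 : 4 * δ * 2 ^ n / κ ^ 2 * D.length J = δ * (4 / κ ^ 2 * D.length I) := by
    have : (2 : ℝ) ^ n * (1 / 2) ^ n = 1 := by rw [← mul_pow]; norm_num
    rw [hlen]
    calc _ = δ * (4 / κ ^ 2 * D.length I) * (2 ^ n * (1 / 2) ^ n) := by ring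
      _ = _ := by rw [this, mul_one]
  rw [e, e2]
  exact mul_le_mul_of_nonneg_right h5 (by positivity)

/-- The coefficients over the intervals of low mass near a longer stopping interval. -/
lemma sum_sq_fine_le {Bu K A s κ δ : ℝ} {n : ℕ} (hwc : Continuous w) (hw2 : MemLp w 2)
    (hB : ∀ f : ℝ → ℝ, MemLp f 2 → ∀ F : Finset (ℤ × ℤ),
      ∑ I ∈ F, (∫ x, f x * wavelet u D I x) ^ 2 ≤ Bu * ∫ x, f x ^ 2) (hBu : 0 ≤ Bu)
    (hK : 0 ≤ K) (hκ : 0 < κ) (hs : 0 < s) (hA : 0 < A) (hδ : 0 ≤ δ)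
    (hsupp : ∀ x, u x ≠ 0 → κ ≤ |w x| ∧ |x| ≤ K)
    (hol : ∀ x y, |w x - w y| ≤ A * |x - y| ^ s) (hn : A * ((1 / 2 : ℝ) ^ n) ^ s ≤ κ / 2)
    (hVm : MeasurableSet V) (hV : volume V ≠ ∞) (hl : 0 < l)
    {F : Finset (ℤ × ℤ)} (hbad : ∀ I ∈ F, ∫ x in V, wavelet w D I x ^ 2 ≤ δ)
    (hF : ∀ I ∈ F, ∃ Q ∈ D.stopping V l, I.1 ≤ Q.1 ∧
      ∃ y ∈ D.interval Q, |y - D.center I| ≤ K * D.length I) :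
    ∑ I ∈ F, (∫ x, V.indicator (fun _ => (1 : ℝ)) x * wavelet u D I x) ^ 2 ≤
      Bu * ((4 * δ * 2 ^ n / κ ^ 2) * (2 * (2 * K + 2)) / l * volume.real V) := by
  set β := 4 * δ * 2 ^ n / κ ^ 2 with hβ
  have hβ0 : 0 ≤ β := by positivity
  -- The cells, `n` generations below the members of `F`, that meet the set where `u_I` is nonzero.
  -- Their union contains that set for every `I ∈ F`, so replacing `V` by `V ∩ U` does not change
  -- the coefficients.
  set N : Set (ℤ × ℤ) := {J | ∃ I ∈ F, J.1 = I.1 - n ∧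
    ∃ x ∈ D.interval J, u ((x - D.center I) / D.length I) ≠ 0} with hN
  set U := ⋃ J ∈ N, D.interval J with hU
  have hUm : MeasurableSet U :=
    MeasurableSet.biUnion (Set.to_countable N) fun J _ => D.measurableSet_interval J
  have hvol : volume (V ∩ U) ≤ ENNReal.ofReal (β * (2 * (2 * K + 2)) / l) * volume V := by
    refine D.volume_inter_cells_le hVm hV hl (by positivity) hβ0 ?_ ?_
    · rintro J ⟨I, hI, hJ, x, hx, hux⟩
      exact volume_inter_cell_le hwc hw2 hκ hs hA hol hn hVm hV hJ hx (hsupp _ hux).1 (hbad I hI)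
    · rintro J ⟨I, hI, hJ, x, hx, hux⟩
      obtain ⟨Q, hQ, hIQ, y, hy, hyI⟩ := hF I hI
      -- The radius `2 * K + 2` is reached from the cell to `c_I` (`K + 1`), to a point of `Q` (`K`)
      -- and to the center of `Q` (`1`), all lengths being at most `|Q|`.
      refine ⟨Q, hQ, by omega, fun z hz => ?_⟩
      have hLI := D.length_pos I
      have h1 := (hsupp _ hux).2
      rw [abs_div, abs_of_pos hLI, div_le_iff₀ hLI] at h1
      have h2 := abs_le.1 (D.abs_sub_le_of_mem hz hx)
      have h3 := D.length_le_length (I := J) (J := I) (by omega)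
      have h4 := D.length_le_length hIQ
      have h5 := abs_le.1 (D.abs_sub_le_of_mem hy (D.center_mem Q))
      have h6 := abs_le.1 hyI
      have h1 := abs_le.1 h1
      have h7 := mul_le_mul_of_nonneg_left h4 hK
      constructor <;> nlinarith [h1.1, h1.2, h2.1, h2.2, h5.1, h5.2, h6.1, h6.2]
  have hfin : volume (V ∩ U) ≠ ∞ := ((measure_mono Set.inter_subset_left).trans_lt hV.lt_top).ne
  have hreal : volume.real (V ∩ U) ≤ β * (2 * (2 * K + 2)) / l * volume.real V := by
    have := ENNReal.toReal_mono (ENNReal.mul_ne_top ENNReal.ofReal_ne_top hV) hvol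
    rwa [ENNReal.toReal_mul, ENNReal.toReal_ofReal (by positivity)] at this
  have e : ∀ I ∈ F, ∫ x, V.indicator (fun _ => (1 : ℝ)) x * wavelet u D I x =
      ∫ x, (V ∩ U).indicator (fun _ => (1 : ℝ)) x * wavelet u D I x := by
    intro I hI
    congr 1 with x
    by_cases hu : u ((x - D.center I) / D.length I) = 0
    · simp [wavelet, hu]
    · have hxU : x ∈ U := by
        obtain ⟨k, hk⟩ := D.exists_mem_interval (I.1 - n) x
        exact Set.mem_biUnion (x := (I.1 - (n : ℤ), k)) ⟨I, hI, rfl, x, hk, hu⟩ hk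
      by_cases hxV : x ∈ V <;> simp [hxU, hxV]
  rw [Finset.sum_congr rfl fun I hI => by rw [e I hI]]
  refine (hB _ (DyadicGrid.memLp_indicator_one (hVm.inter hUm) hfin) F).trans ?_
  rw [integral_indicator_one_sq (hVm.inter hUm)]
  gcongr

lemma wavelet_add {v : ℝ → ℝ} (h : ∀ x, w x = u x + v x) (I : ℤ × ℤ) (x : ℝ) :
    wavelet w D I x = wavelet u D I x + wavelet v D I x := by
  simp only [wavelet, h]
  ring

/-- The wavelet coefficients of an indicator over the intervals on which the set has little mass
carry at most half of the norm. -/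
theorem exists_sum_sq_le_half {r C : ℝ} (hc : Continuous w) (hr : 1 < r)
    (hw : ∀ x, |w x| ≤ C * bump r x) (hb : IsL2OrthonormalBasis (wavelet w D)) :
    ∃ δ : ℝ, 0 < δ ∧ ∀ V : Set ℝ, MeasurableSet V → volume V ≠ ∞ → ∀ F : Finset (ℤ × ℤ),
      (∀ I ∈ F, ∫ x in V, wavelet w D I x ^ 2 ≤ δ) →
      ∑ I ∈ F, (∫ x, V.indicator (fun _ => (1 : ℝ)) x * wavelet w D I x) ^ 2 ≤
        volume.real V / 2 := by
  obtain ⟨s, A, hs, hA, hol⟩ := exists_holder hr hc hw hb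
  have hw2 := memLp_two_of_le_bump hc hr hw
  obtain ⟨P, hP, hsplit⟩ := exists_split hr hc hw hA hol
    (integral_eq_zero_of_isL2OrthonormalBasis hr hc hw hb)
    (exists_ne_zero_of_isL2OrthonormalBasis hb)
  -- Chosen so that `r * (1 - 2 * θ) - s * θ = (r + 1) / 2`, which is above the threshold `1` of the
  -- Bessel inequality.
  set θ := (r - 1) / (2 * (2 * r + s)) with hθ
  have hr1 : 0 < r - 1 := by linarith
  have hθ0 : 0 < θ := by positivity
  have hθe : θ * (2 * (2 * r + s)) = r - 1 := div_mul_cancel₀ _ (by positivity)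
  have hθ1 : 2 * θ < 1 := by nlinarith
  have hq : 1 < r * (1 - 2 * θ) - s * θ := by nlinarith
  obtain ⟨B, hB0, hB⟩ := IsMolecule.exists_bessel (mul_pos hs hθ0) hq
  -- Makes `B * (2 * P * t) ^ 2 ≤ 1 / 16`. There is no circularity: `P` and `B` are fixed before
  -- `ε`, while `κ`, `K`, `l`, `n` and `δ` come after it.
  set t := 1 / (8 * P * (B + 1)) with ht
  have ht0 : 0 < t := by positivity
  set ε := min 1 (t ^ (1 / θ)) with hε
  have hε0 : 0 < ε := by positivity
  have hεt : ε ^ θ ≤ t := by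
    calc ε ^ θ ≤ (t ^ (1 / θ)) ^ θ := by gcongr; exact min_le_right _ _
      _ = t := by rw [← Real.rpow_mul ht0.le, one_div_mul_cancel hθ0.ne', Real.rpow_one]
  obtain ⟨κ, K, u, v, hκ, hK, huv, hsupp, hu1, hu2, hu3, hv0, hv1, hv2, hv3⟩ :=
    hsplit ε hε0 (min_le_left _ _)
  have hum : IsMolecule (2 * P * 1 ^ θ) (r * (1 - 2 * θ)) (s * θ) u :=
    isMolecule_of_bounds hr hθ0 hθ1 hP.le zero_le_one
      (fun x => (hu1 x).trans (mul_le_mul_of_nonneg_left (bump_le_one (by linarith) x) hP.le))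
      hu1 hu2 hu3
  have hvm := isMolecule_of_bounds hr hθ0 hθ1 hP.le hε0.le hv0 hv1 hv2 hv3
  rw [Real.one_rpow, mul_one] at hum
  have hq0 : 0 ≤ r * (1 - 2 * θ) := by nlinarith [mul_pos hs hθ0]
  have huc := hum.continuous (mul_pos hs hθ0) hq0
  have hvc := hvm.continuous (mul_pos hs hθ0) hq0
  have huL := memLp_two_of_le_bump huc hr hu1
  have hvL := memLp_two_of_le_bump hvc hr hv1
  set Bu := B * (2 * P) ^ 2 with hBu
  have hBu0 : 0 ≤ Bu := by positivity
  have hBessel : ∀ f : ℝ → ℝ, MemLp f 2 → ∀ F : Finset (ℤ × ℤ),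
      ∑ I ∈ F, (∫ x, f x * wavelet u D I x) ^ 2 ≤ Bu * ∫ x, f x ^ 2 := fun f hf F =>
    hB _ u hum D f hf F
  obtain ⟨c, hc0, hcc⟩ := DyadicGrid.exists_sum_sub_stoppingAverage_le hK hs hP.le
  set l := 1 / (32 * (4 * Bu + 2 * c + 1)) with hl
  have hl0 : 0 < l := by positivity
  have hl1 : l < 1 := by
    rw [hl, div_lt_one (by positivity)]
    linarith
  obtain ⟨n, hn⟩ : ∃ n : ℕ, A * ((1 / 2 : ℝ) ^ n) ^ s ≤ κ / 2 := by
    have h1 : Filter.Tendsto (fun n : ℕ => A * ((1 / 2 : ℝ) ^ n) ^ s) Filter.atTop (nhds 0) := by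
      have h2 := (tendsto_pow_atTop_nhds_zero_of_lt_one (r := (1 / 2 : ℝ)) (by norm_num)
        (by norm_num)).rpow_const (p := s) (Or.inr hs.le)
      rw [Real.zero_rpow hs.ne'] at h2
      simpa using h2.const_mul A
    exact ((h1.eventually (gt_mem_nhds (half_pos hκ))).mono fun _ h => h.le).exists
  -- The admissible cell density: Bessel and the covering by dilates then cost at most `|V| / 16`.
  -- The witness for `δ` solves `4 * δ * 2 ^ n / κ ^ 2 = β`.
  set β := l / (64 * (Bu + 1) * (K + 1)) with hβ
  have hβ0 : 0 < β := by positivity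
  refine ⟨β * κ ^ 2 / (4 * 2 ^ n), by positivity, fun V hVm hV F hF => ?_⟩
  set μ := volume.real V with hμ
  have hμ0 : 0 ≤ μ := measureReal_nonneg
  have hVL := DyadicGrid.memLp_indicator_one hVm hV
  have hsumv : ∑ I ∈ F, (∫ x, V.indicator (fun _ => (1 : ℝ)) x * wavelet v D I x) ^ 2 ≤
      μ / 16 := by
    have h1 := hB _ v hvm D _ hVL F
    rw [integral_indicator_one_sq hVm] at h1
    refine h1.trans ?_
    have h2 : B * (2 * P * ε ^ θ) ^ 2 ≤ 1 / 16 := by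
      calc B * (2 * P * ε ^ θ) ^ 2 ≤ B * (2 * P * t) ^ 2 := by gcongr
        _ = B / (16 * (B + 1) ^ 2) := by rw [ht]; field_simp; ring
        _ ≤ 1 / 16 := by
          rw [div_le_div_iff₀ (by positivity) (by norm_num)]
          nlinarith
    calc _ ≤ 1 / 16 * μ := by gcongr
      _ = _ := by ring
  have hsumu : ∑ I ∈ F, (∫ x, V.indicator (fun _ => (1 : ℝ)) x * wavelet u D I x) ^ 2 ≤
      μ / 8 := by
    classical
    rw [← Finset.sum_filter_add_sum_filter_not F (fun I => ∃ Q ∈ D.stopping V l, I.1 ≤ Q.1 ∧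
      ∃ y ∈ D.interval Q, |y - D.center I| ≤ K * D.length I)]
    have h1 := sum_sq_fine_le (l := l) hc hw2 hBessel hBu0 hK hκ hs hA (by positivity) hsupp hol
      hn hVm hV hl0 (F := F.filter fun I => ∃ Q ∈ D.stopping V l, I.1 ≤ Q.1 ∧
        ∃ y ∈ D.interval Q, |y - D.center I| ≤ K * D.length I)
      (fun I hI => hF I (Finset.mem_filter.1 hI).1) (fun I hI => (Finset.mem_filter.1 hI).2)
    have h2 := sum_sq_coarse_le (D := D) huc huL hBessel hBu0 (fun x hx => (hsupp x hx).2) hu2 hcc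
      hVm hV hl0 hl1 (F := F.filter fun I => ¬ ∃ Q ∈ D.stopping V l, I.1 ≤ Q.1 ∧
        ∃ y ∈ D.interval Q, |y - D.center I| ≤ K * D.length I) (fun I hI Q hQ hy => by
          by_contra! hcon
          exact (Finset.mem_filter.1 hI).2 ⟨Q, hQ, hcon, hy⟩)
    have e1 : Bu * (4 * (β * κ ^ 2 / (4 * 2 ^ n)) * 2 ^ n / κ ^ 2 * (2 * (2 * K + 2)) / l * μ) =
        Bu / (16 * (Bu + 1)) * μ := by
      rw [hβ]
      field_simp
      ring
    have e2 : Bu / (16 * (Bu + 1)) ≤ 1 / 16 := by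
      rw [div_le_div_iff₀ (by positivity) (by norm_num)]
      linarith
    have e3 : (4 * Bu + 2 * c) * l ≤ 1 / 16 := by
      rw [hl, mul_one_div, div_le_div_iff₀ (by positivity) (by norm_num)]
      linarith
    rw [e1] at h1
    have e4 := mul_le_mul_of_nonneg_right e2 hμ0
    have e5 := mul_le_mul_of_nonneg_right e3 hμ0
    linarith
  -- The parts add up to `2 * (1 / 8) + 2 * (1 / 16) = 3 / 8` of `|V|`, below one half.
  calc _ ≤ ∑ I ∈ F, (2 * (∫ x, V.indicator (fun _ => (1 : ℝ)) x * wavelet u D I x) ^ 2 +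
        2 * (∫ x, V.indicator (fun _ => (1 : ℝ)) x * wavelet v D I x) ^ 2) := by
        refine Finset.sum_le_sum fun I _ => ?_
        have i1 : Integrable fun x => V.indicator (fun _ => (1 : ℝ)) x * wavelet u D I x :=
          hVL.integrable_mul (memLp_wavelet D I huc huL)
        have i2 : Integrable fun x => V.indicator (fun _ => (1 : ℝ)) x * wavelet v D I x :=
          hVL.integrable_mul (memLp_wavelet D I hvc hvL)
        simp_rw [wavelet_add huv, mul_add]
        rw [integral_add i1 i2]
        set a := ∫ x, V.indicator (fun _ => (1 : ℝ)) x * wavelet u D I x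
        set b := ∫ x, V.indicator (fun _ => (1 : ℝ)) x * wavelet v D I x
        nlinarith [sq_nonneg (a - b)]
    _ ≤ _ := by
        rw [Finset.sum_add_distrib, ← Finset.mul_sum, ← Finset.mul_sum]
        linarith

/-- The integral of the squared square function. -/
lemma setLIntegral_waveletSquareFunction_sq (hc : Continuous w) (f : ℝ → ℝ) :
    ∫⁻ x in V, waveletSquareFunction w D f x ^ 2 =
      ∑' I : ℤ × ℤ, ∫⁻ x in V,
        ENNReal.ofReal ((∫ y, f y * wavelet w D I y) ^ 2 * wavelet w D I x ^ 2) := by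
  have h : ∀ x, waveletSquareFunction w D f x ^ 2 = ∑' I : ℤ × ℤ,
      ENNReal.ofReal ((∫ y, f y * wavelet w D I y) ^ 2 * wavelet w D I x ^ 2) := fun x => by
    unfold waveletSquareFunction
    rw [← ENNReal.rpow_natCast, ← ENNReal.rpow_mul]
    norm_num
  simp_rw [h]
  refine lintegral_tsum fun I => ?_
  have := continuous_wavelet D I hc
  exact (ENNReal.continuous_ofReal.comp (by fun_prop : Continuous fun x =>
    (∫ y, f y * wavelet w D I y) ^ 2 * wavelet w D I x ^ 2)).measurable.aemeasurable

end Main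

theorem theorem2 (w : ℝ → ℝ) (D : DyadicGrid) (hw : ContDiff ℝ 2 w)
    (r C : ℝ) (hr : 1 < r) (hdecay : ∀ x : ℝ, |w x| ≤ C * (1 + |x|) ^ (-r))
    (hbasis : IsL2OrthonormalBasis (wavelet w D)) :
    ∃ η : ℝ, 0 < η ∧
      ∀ V : Set ℝ, NullMeasurableSet V volume → volume V < ∞ →
        ENNReal.ofReal η * volume V ≤
          ∫⁻ x in V, waveletSquareFunction w D (V.indicator (fun _ => (1 : ℝ))) x ^ 2 := by
  have hc := hw.continuous
  have hdecay' : ∀ x, |w x| ≤ C * bump r x := hdecay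
  have hw2 := memLp_two_of_le_bump hc hr hdecay'
  obtain ⟨δ, hδ, hmain⟩ := exists_sum_sq_le_half hc hr hdecay' hbasis
  refine ⟨δ / 4, by positivity, fun V₀ hV₀ hV₀fin => ?_⟩
  -- A null-measurable set is replaced by a measurable one equal to it almost everywhere; both sides
  -- are unchanged.
  obtain ⟨V, -, hVm, hVae⟩ := hV₀.exists_measurable_subset_ae_eq
  have hV : volume V ≠ ∞ := by rw [measure_congr hVae]; exact hV₀fin.ne
  rw [setLIntegral_waveletSquareFunction_sq hc, ← measure_congr hVae,
    ← Measure.restrict_congr_set hVae]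
  have hcoef : ∀ I, ∫ y, V₀.indicator (fun _ => (1 : ℝ)) y * wavelet w D I y =
      ∫ y, V.indicator (fun _ => (1 : ℝ)) y * wavelet w D I y := fun I => by
    refine integral_congr_ae ?_
    filter_upwards [indicator_ae_eq_of_ae_eq_set (f := fun _ => (1 : ℝ)) hVae] with x hx
    rw [hx]
  simp_rw [hcoef]
  set a : ℤ × ℤ → ℝ := fun I => ∫ y, V.indicator (fun _ => (1 : ℝ)) y * wavelet w D I y with ha
  set p : ℤ × ℤ → ℝ := fun I => ∫ x in V, wavelet w D I x ^ 2 with hp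
  set μ := volume.real V with hμ
  have hterm : ∀ I, ∫⁻ x in V, ENNReal.ofReal (a I ^ 2 * wavelet w D I x ^ 2) =
      ENNReal.ofReal (a I ^ 2 * p I) := fun I => by
    have hi : Integrable (fun x => wavelet w D I x ^ 2) (volume.restrict V) :=
      ((memLp_two_iff_integrable_sq (continuous_wavelet D I hc).aestronglyMeasurable).1
        (memLp_wavelet D I hc hw2)).integrableOn
    rw [hp, ← integral_const_mul, ofReal_integral_eq_lintegral_ofReal (hi.const_mul _)
      (Filter.Eventually.of_forall fun x => by positivity)]
  rw [tsum_congr hterm]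
  have hVμ : volume V = ENNReal.ofReal μ := (ENNReal.ofReal_toReal hV).symm
  have hμ0 : 0 ≤ μ := measureReal_nonneg
  rw [hVμ, ← ENNReal.ofReal_mul (by positivity)]
  rcases hμ0.eq_or_lt with h0 | hμpos
  · simp [← h0]
  have hL := DyadicGrid.memLp_indicator_one hVm hV
  have hsum : HasSum (fun I => a I ^ 2) μ := by
    have h1 := hbasis.hasSum_integral_mul hL hL
    simp only [← pow_two] at h1
    rwa [integral_indicator_one_sq hVm] at h1
  -- Finitely many coefficients carry three quarters of `|V|`; the low-mass ones carry at most half,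
  -- which leaves a quarter with `p_I > δ`, whence `η = δ / 4`.
  obtain ⟨F, hF⟩ := (hsum.eventually (lt_mem_nhds (by linarith : 3 / 4 * μ < μ))).exists
  have hp0 : ∀ I, 0 ≤ p I := fun I => integral_nonneg fun x => sq_nonneg _
  have hbad := hmain V hVm hV (F.filter fun I => p I ≤ δ) fun I hI => (Finset.mem_filter.1 hI).2
  rw [← Finset.sum_filter_add_sum_filter_not F (fun I => p I ≤ δ)] at hF
  have hgood : δ * ∑ I ∈ F.filter (fun I => ¬ p I ≤ δ), a I ^ 2 ≤
      ∑ I ∈ F.filter (fun I => ¬ p I ≤ δ), a I ^ 2 * p I := by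
    rw [Finset.mul_sum]
    refine Finset.sum_le_sum fun I hI => ?_
    rw [mul_comm]
    have := not_le.1 (Finset.mem_filter.1 hI).2
    gcongr
  calc ENNReal.ofReal (δ / 4 * μ)
      ≤ ENNReal.ofReal (∑ I ∈ F.filter (fun I => ¬ p I ≤ δ), a I ^ 2 * p I) := by
        refine ENNReal.ofReal_le_ofReal (le_trans ?_ hgood)
        have hbad' : ∑ I ∈ F.filter (fun I => p I ≤ δ), a I ^ 2 ≤ μ / 2 := hbad
        have : μ / 4 ≤ ∑ I ∈ F.filter (fun I => ¬ p I ≤ δ), a I ^ 2 := by linarith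
        nlinarith
    _ = ∑ I ∈ F.filter (fun I => ¬ p I ≤ δ), ENNReal.ofReal (a I ^ 2 * p I) :=
        ENNReal.ofReal_sum_of_nonneg fun I _ => mul_nonneg (sq_nonneg _) (hp0 I)
    _ ≤ _ := ENNReal.sum_le_tsum _
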